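/- **Setting.** Let $\Omega\subset\mathbb R^3$ be a connected (open, equal to the interior of its closure) polyhedral domain with a polyhedral mesh consisting of finite sets $\mathcal T_h$ (elements $T$: disjoint, connected, open, bounded polyhedra, the closures of which cover $\overline\Omega$), $\mathcal F_h$ (faces $F$: disjoint, connected, bounded, relatively open planar polygons), $\mathcal E_h$ (edges $E$: disjoint open segments) and $\mathcal V_h$ (vertices $V$, located at $x_V$). Faces, edges and vertices are mutually disjoint; $\partial T$ is the union of the closures of the faces in $\mathcal F_T=\{F\subset\partial T\}$; the relative boundary $\overline F\setminus F$ is the union of the closures of the edges in $\mathcal E_F=\{E\subset\overline F\setminus F\}$; each face lies on the boundary of two elements, or of one element and of $\Omega$; each edge is an edge of some face; the vertices are the endpoints of the edges; elements and faces are equal to the interior (for faces, in their plane) of their closure. No further assumption on the topology of elements, faces or $\Omega$ is made. Fix points $x_T\in T$, $x_F\in F$, unit normals $n_F$, and unit tangents $t_E$ pointing from the vertex $V_1$ to the vertex $V_2$ of $E$. For $F\in\mathcal F_T$, $\omega_{TF}\in\{\pm1\}$ is such that $\omega_{TF}n_F$ points out of $T$; $n_{FE}=n_F\times t_E$, and,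 for $E\in\mathcal E_F$, $\omega_{FE}\in\{\pm1\}$ is such that $\omega_{FE}n_{FE}$ points out of $F$. Integrals over $P=T,F,E$ are with respect to the 3-, 2-, 1-dimensional Hausdorff (Lebesgue) measure. $\mathcal P^\ell(P)$ is the space of restrictions to $P$ of polynomials of degree $\le\ell$ ($\{0\}$ if $\ell<0$), $\mathcal P^{0,\ell}(P)$ its zero-mean subspace, $\boldsymbol{\mathcal P}^\ell(F)$ the polynomial vector fields of degree $\le\ell$ tangent to $F$, $\boldsymbol{\mathcal P}^\ell(T)=\mathcal P^\ell(T)^3$. With $z^\perp=z\times n_F$ and $\mathrm{rot}_Fr=(\nabla_Fr)^\perp$, $\mathcal R^\ell(F)=\mathrm{rot}_F\mathcal P^{\ell+1}(F)$, $\mathcal R^{c,\ell}(F)=(x-x_F)\mathcal P^{\ell-1}(F)$, $\mathcal R^\ell(T)=\mathrm{curl}\,\boldsymbol{\mathcal P}^{\ell+1}(T)$, $\mathcal R^{c,\ell}(T)=(x-x_T)\mathcal P^{\ell-1}(T)$, $\mathcal G^\ell(T)=\nabla\mathcal P^{\ell+1}(T)$, $\mathcal G^{c,\ell}(T)=(x-x_T)\times\boldsymbol{\mathcal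 P}^{\ell-1}(T)$. $\pi^\ell_P$ and $\pi^\ell_{\mathcal X,P}$, $\pi^{c,\ell}_{\mathcal X,P}$ are the $L^2$-orthogonal projectors on $\mathcal P^\ell(P)$ and on $\mathcal X^\ell(P)$, $\mathcal X^{c,\ell}(P)$. **Spaces** ($k\ge0$). $X^k_{\nabla}=\{((q_T)_T,(q_F)_F,(q_E)_E,(q_V)_V): q_P\in\mathcal P^{k-1}(P)\text{ for }P=T,F,E,\ q_V\in\mathbb R\}$; $X^k_{\rm curl}=\{((v_{\mathcal R,T},v^c_{\mathcal R,T})_T,(v_{\mathcal R,F},v^c_{\mathcal R,F})_F,(v_E)_E): v_{\mathcal R,P}\in\mathcal R^{k-1}(P), v^c_{\mathcal R,P}\in\mathcal R^{c,k}(P)\text{ for }P=T,F,\ v_E\in\mathcal P^k(E)\}$; $X^k_{\rm div}=\{((w_{\mathcal G,T},w^c_{\mathcal G,T})_T,(w_F)_F): w_{\mathcal G,T}\in\mathcal G^{k-1}(T), w^c_{\mathcal G,T}\in\mathcal G^{c,k}(T), w_F\in\mathcal P^k(F)\}$; $\mathcal P^k(\mathcal T_h)=\{r_h=(r_T)_T: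 r_T=(r_h)_{|T}\in\mathcal P^k(T)\}$. **Operators.** Each of the following is the unique polynomial, in the space named, that satisfies the stated identities. *Gradient.* $\gamma_E^{k+1}q\in\mathcal P^{k+1}(E)$ takes the values $q_V$ at the endpoints $V$ of $E$ and $\pi^{k-1}_E\gamma^{k+1}_Eq=q_E$. $G^k_Eq\in\mathcal P^k(E)$: $\int_EG^k_Eq\,r=-\int_Eq_Er'+q_{V_2}r(x_{V_2})-q_{V_1}r(x_{V_1})$ for all $r\in\mathcal P^k(E)$ (derivative along $t_E$). $\mathsf G^k_Fq\in\boldsymbol{\mathcal P}^k(F)$: $\int_F\mathsf G^k_Fq\cdot v=-\int_Fq_F\,\mathrm{div}_Fv+\sum_{E\in\mathcal E_F}\omega_{FE}\int_E\gamma^{k+1}_Eq\,(v\cdot n_{FE})$ for all $v\in\boldsymbol{\mathcal P}^k(F)$. $\gamma^{k+1}_Fq\in\mathcal P^{k+1}(F)$: $\int_F\gamma_F^{k+1}q\,\mathrm{div}_Fv=-\int_F\mathsf G^k_Fq\cdot v+\sum_{E\in\mathcal E_F}\omega_{FE}\int_E\gamma_E^{k+1}q\,(v\cdot n_{FE})$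 for all $v\in\mathcal R^{c,k+2}(F)$. $\mathsf G^k_Tq\in\boldsymbol{\mathcal P}^k(T)$: $\int_T\mathsf G^k_Tq\cdot v=-\int_Tq_T\,\mathrm{div}\,v+\sum_{F\in\mathcal F_T}\omega_{TF}\int_F\gamma^{k+1}_Fq\,(v\cdot n_F)$ for all $v\in\boldsymbol{\mathcal P}^k(T)$. Then $G^k_h:X^k_\nabla\to X^k_{\rm curl}$, $G_h^kq=\big((\pi^{k-1}_{\mathcal R,T}\mathsf G^k_Tq,\pi^{c,k}_{\mathcal R,T}\mathsf G^k_Tq)_T,(\pi^{k-1}_{\mathcal R,F}\mathsf G^k_Fq,\pi^{c,k}_{\mathcal R,F}\mathsf G^k_Fq)_F,(G^k_Eq)_E\big)$. *Curl.* $C^k_Fv\in\mathcal P^k(F)$: $\int_FC^k_Fv\,r=\int_Fv_{\mathcal R,F}\cdot\mathrm{rot}_Fr-\sum_{E\in\mathcal E_F}\omega_{FE}\int_Ev_Er$ for all $r\in\mathcal P^k(F)$. $\gamma^k_{t,F}v\in\boldsymbol{\mathcal P}^k(F)$: $\int_F\gamma^k_{t,F}v\cdot(\mathrm{rot}_Fr+w)=\int_FC^k_Fv\,r+\sum_{E\in\mathcal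 E_F}\omega_{FE}\int_Ev_Er+\int_Fv^c_{\mathcal R,F}\cdot w$ for all $(r,w)\in\mathcal P^{0,k+1}(F)\times\mathcal R^{c,k}(F)$. $\mathsf C^k_Tv\in\boldsymbol{\mathcal P}^k(T)$: $\int_T\mathsf C^k_Tv\cdot w=\int_Tv_{\mathcal R,T}\cdot\mathrm{curl}\,w+\sum_{F\in\mathcal F_T}\omega_{TF}\int_F\gamma^k_{t,F}v\cdot(w\times n_F)$ for all $w\in\boldsymbol{\mathcal P}^k(T)$. $P^k_{{\rm curl},T}v\in\boldsymbol{\mathcal P}^k(T)$: $\int_TP^k_{{\rm curl},T}v\cdot(\mathrm{curl}\,w+z)=\int_T\mathsf C^k_Tv\cdot w-\sum_{F\in\mathcal F_T}\omega_{TF}\int_F\gamma^k_{t,F}v\cdot(w\times n_F)+\int_Tv^c_{\mathcal R,T}\cdot z$ for all $(w,z)\in\mathcal G^{c,k+1}(T)\times\mathcal R^{c,k}(T)$. Then $C_h^k:X^k_{\rm curl}\to X^k_{\rm div}$, $C^k_hv=\big((\pi^{k-1}_{\mathcal G,T}\mathsf C^k_Tv,\pi^{c,k}_{\mathcal G,T}\mathsf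 C^k_Tv)_T,(C^k_Fv)_F\big)$. *Divergence.* $D^k_Tw\in\mathcal P^k(T)$: $\int_TD^k_Tw\,r=-\int_Tw_{\mathcal G,T}\cdot\nabla r+\sum_{F\in\mathcal F_T}\omega_{TF}\int_Fw_Fr$ for all $r\in\mathcal P^k(T)$. $P^k_{{\rm div},T}w\in\boldsymbol{\mathcal P}^k(T)$: $\int_TP^k_{{\rm div},T}w\cdot(\nabla r+z)=-\int_TD^k_Tw\,r+\sum_{F\in\mathcal F_T}\omega_{TF}\int_Fw_Fr+\int_Tw^c_{\mathcal G,T}\cdot z$ for all $(r,z)\in\mathcal P^{0,k+1}(T)\times\mathcal G^{c,k}(T)$. Then $D^k_h:X^k_{\rm div}\to\mathcal P^k(\mathcal T_h)$, $(D^k_hw)_{|T}=D^k_Tw$. *Interpolator.* For a function $q$, $I^k_hq=\big((\pi^{k-1}_Tq)_T,(\pi^{k-1}_Fq)_F,(\pi^{k-1}_Eq)_E,(q(x_V))_V\big)$. **Reductions** to the case $k=0$ (whose spaces have nonzero components only on vertices, edges, faces, elements, respectively): $R_\nabla q=(q_V)_V$, $R_{\rm curl}v=(\pi^0_Ev_E)_E$,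 $R_{\rm div}w=(\pi^0_Fw_F)_F$, $\pi^0_hr_h=(\pi^0_Tr_T)_T$. **Extensions.** $E_\nabla q=\big((E_{\mathcal P,T}q)_T,(E_{\mathcal P,F}q)_F,(E_{\mathcal P,E}q)_E,(q_V)_V\big)$ for $q\in X^0_\nabla$, where $E_{\mathcal P,P}q\in\mathcal P^{k-1}(P)$ and $\int_EE_{\mathcal P,E}q\,r'=-\int_EG^0_Eq\,r+q_{V_2}r(x_{V_2})-q_{V_1}r(x_{V_1})$ for all $r\in\mathcal P^k(E)$; $\int_FE_{\mathcal P,F}q\,\mathrm{div}_Fv=-\int_F\mathsf G^0_Fq\cdot v+\sum_{E\in\mathcal E_F}\omega_{FE}\int_E\gamma^{k+1}_E(E_\nabla q)\,(v\cdot n_{FE})$ for all $v\in\mathcal R^{c,k}(F)$; $\int_TE_{\mathcal P,T}q\,\mathrm{div}\,v=-\int_T\mathsf G^0_Tq\cdot v+\sum_{F\in\mathcal F_T}\omega_{TF}\int_F\gamma^{k+1}_F(E_\nabla q)\,(v\cdot n_F)$ for all $v\in\mathcal R^{c,k}(T)$ (the traces involve only the components of $E_\nabla q$ on lower-dimensional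 entities, defined before). $E_{\rm curl}v=\big((E_{\mathcal R,T}v,\pi^{c,k}_{\mathcal R,T}P^0_{{\rm curl},T}v)_T,(E_{\mathcal R,F}v,\pi^{c,k}_{\mathcal R,F}\gamma^0_{t,F}v)_F,(v_E)_E\big)$ for $v\in X^0_{\rm curl}$, where $E_{\mathcal R,P}v\in\mathcal R^{k-1}(P)$ and $\int_FE_{\mathcal R,F}v\cdot\mathrm{rot}_Fr=\int_FC^0_Fv\,r+\sum_{E\in\mathcal E_F}\omega_{FE}\int_Ev_Er$ for all $r\in\mathcal P^k(F)$; $\int_TE_{\mathcal R,T}v\cdot\mathrm{curl}\,w=\int_T\mathsf C^0_Tv\cdot w-\sum_{F\in\mathcal F_T}\omega_{TF}\int_F\gamma^k_{t,F}(E_{\rm curl}v)\cdot(w\times n_F)$ for all $w\in\mathcal G^{c,k}(T)$. $E_{\rm div}w=\big((E_{\mathcal G,T}w,\pi^{c,k}_{\mathcal G,T}P^0_{{\rm div},T}w)_T,(w_F)_F\big)$ for $w\in X^0_{\rm div}$, where $E_{\mathcal G,T}w\in\mathcal G^{k-1}(T)$ and $\int_TE_{\mathcal G,T}w\cdot\nabla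 r=-\int_TD^0_Tw\,r+\sum_{F\in\mathcal F_T}\omega_{TF}\int_Fw_Fr$ for all $r\in\mathcal P^k(T)$. **Lemma.** For every $k\ge0$: 1. for all $q_h\in\ker G^k_h$ there is $C\in\mathbb R$ such that $E_\nabla R_\nabla q_h-q_h=I^k_hC$; 2. for all $v_h\in\ker C^k_h$ there is $q_h\in X^k_\nabla$ such that $E_{\rm curl}R_{\rm curl}v_h-v_h=G^k_hq_h$; 3. for all $w_h\in\ker D^k_h$ there is $v_h\in X^k_{\rm curl}$ such that $E_{\rm div}R_{\rm div}w_h-w_h=C^k_hv_h$; 4. for all $r_h\in\mathcal P^k(\mathcal T_h)$ there is $w_h\in X^k_{\rm div}$ such that $\pi^0_hr_h-r_h=D^k_hw_h$. -/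

import Mathlib

open scoped Matrix MeasureTheory Topology
open MeasureTheory

noncomputable section

namespace DDR

/-! ## Polynomials and polynomial vector fields -/

/-- The Euclidean space of dimension three. -/
abbrev E3 : Type := EuclideanSpace ℝ (Fin 3)

/-- Three-variate real polynomials. -/
abbrev P3 : Type := MvPolynomial (Fin 3) ℝ

/-- Vector fields on `E3` with polynomial components. -/
abbrev V3 : Type := Fin 3 → P3

/-- Three-variate polynomials of total degree at most `ℓ`; the zero space if `ℓ < 0`. -/
def Pol (ℓ : ℤ) : Submodule ℝ P3 :=
  MvPolynomial.restrictSupport ℝ {m : Fin 3 →₀ ℕ | (m.degree : ℤ) ≤ ℓ}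

/-- Vector fields all of whose components have total degree at most `ℓ`. -/
def VPol (ℓ : ℤ) : Submodule ℝ V3 := Submodule.pi Set.univ fun _ => Pol ℓ

lemma Pol_mono {ℓ m : ℤ} (h : ℓ ≤ m) : Pol ℓ ≤ Pol m :=
  MvPolynomial.restrictSupport_mono ℝ fun _ hx => le_trans hx h

/-- A constant vector, as a constant polynomial vector field. -/
def cst (a : E3) : V3 := fun i => MvPolynomial.C (a i)

/-- The vector field `x ↦ x - a`. -/
def pos (a : E3) : V3 := fun i => MvPolynomial.X i - MvPolynomial.C (a i)

/-- The gradient. -/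
def grad : P3 →ₗ[ℝ] V3 := LinearMap.pi fun i => (MvPolynomial.pderiv i).toLinearMap

/-- The divergence. -/
def div (v : V3) : P3 := ∑ i, MvPolynomial.pderiv i (v i)

/-- The curl. -/
def curl : V3 →ₗ[ℝ] V3 where
  toFun v := ![MvPolynomial.pderiv 1 (v 2) - MvPolynomial.pderiv 2 (v 1),
    MvPolynomial.pderiv 2 (v 0) - MvPolynomial.pderiv 0 (v 2),
    MvPolynomial.pderiv 0 (v 1) - MvPolynomial.pderiv 1 (v 0)]
  map_add' v w := by
    funext i
    fin_cases i <;> simp <;> ring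
  map_smul' c v := by
    funext i
    fin_cases i <;> simp [smul_sub]

/-- `curl` of the vector polynomials of degree at most `ℓ + 1`. -/
def RolT (ℓ : ℤ) : Submodule ℝ V3 := (VPol (ℓ + 1)).map curl

/-- `grad` of the polynomials of degree at most `ℓ + 1`. -/
def GolT (ℓ : ℤ) : Submodule ℝ V3 := (Pol (ℓ + 1)).map grad

/-- Multiplication of a scalar polynomial by the vector field `x - a`. -/
def posMul (a : E3) : P3 →ₗ[ℝ] V3 :=
  LinearMap.pi fun i => LinearMap.mulLeft ℝ (pos a i)

/-- The map `w ↦ (x - a) × w`. -/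
def posCross (a : E3) : V3 →ₗ[ℝ] V3 := (crossProduct (pos a)).restrictScalars ℝ

/-- Derivative in the direction of the vector `t`. -/
def dirDeriv (t : E3) (p : P3) : P3 := cst t ⬝ᵥ grad p

/-- Gradient tangential to the planes with unit normal `n`:
`∇ r - (n · ∇ r) n`. -/
def gradTan (n : E3) : P3 →ₗ[ℝ] V3 where
  toFun r := grad r - (cst n ⬝ᵥ grad r) • cst n
  map_add' r s := by
    simp only [map_add, dotProduct_add, add_smul]
    abel
  map_smul' c r := by
    simp only [map_smul, dotProduct_smul, smul_sub, RingHom.id_apply, smul_assoc]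

/-- Divergence tangential to the planes with unit normal `n`, that is, the trace of the
tangential derivative. On a plane with normal `n` it depends only on the values of `v` there. -/
def divTan (n : E3) (v : V3) : P3 := ∑ i, gradTan n (v i) i

/-- The vector curl `rot r = (∇ r)^⊥` in the planes with unit normal `n`, where `⊥` is the
rotation of angle `-π/2` in the tangent plane oriented by `n`, i.e. `z^⊥ = z × n`. -/
def rotTan (n : E3) : P3 →ₗ[ℝ] V3 where
  toFun r := gradTan n r ⨯₃ cst n
  map_add' r s := by simp
  map_smul' c r := by
    rw [map_smul, ← LinearMap.flip_apply, ← LinearMap.restrictScalars_apply ℝ, map_smul]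
    rfl

/-- Vector fields of degree at most `ℓ` that are orthogonal to `n`. -/
def VPolTan (n : E3) (ℓ : ℤ) : Submodule ℝ V3 where
  carrier := {v | v ∈ VPol ℓ ∧ v ⬝ᵥ cst n = 0}
  add_mem' hv hw := ⟨add_mem hv.1 hw.1, by rw [add_dotProduct, hv.2, hw.2, add_zero]⟩
  zero_mem' := ⟨zero_mem _, zero_dotProduct _⟩
  smul_mem' c _ hv := ⟨Submodule.smul_mem _ c hv.1, by rw [smul_dotProduct, hv.2, smul_zero]⟩

/-! ## Restriction to a set, `L²` products and projectors -/

/-- Restriction of a polynomial to a set. -/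
def restr (P : Set E3) : P3 →ₗ[ℝ] (P → ℝ) :=
  LinearMap.pi fun x => (MvPolynomial.aeval (fun i => (x : E3) i)).toLinearMap

/-- Restriction of a polynomial vector field to a set. -/
def restrV (P : Set E3) : V3 →ₗ[ℝ] (P → E3) :=
  LinearMap.pi fun x => (WithLp.linearEquiv 2 ℝ (Fin 3 → ℝ)).symm.toLinearMap ∘ₗ
    LinearMap.pi fun i =>
      (MvPolynomial.aeval (fun j => (x : E3) j)).toLinearMap ∘ₗ LinearMap.proj i

/-- The space spanned by the restrictions to `P` of the polynomials of degree at most `ℓ`. -/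
def PolyOn (ℓ : ℤ) (P : Set E3) : Submodule ℝ (P → ℝ) := (Pol ℓ).map (restr P)

/-- The restrictions to `P` of the vector fields in `S`. -/
def VOn (S : Submodule ℝ V3) (P : Set E3) : Submodule ℝ (P → E3) := S.map (restrV P)

lemma PolyOn_mono {ℓ m : ℤ} (h : ℓ ≤ m) (P : Set E3) : PolyOn ℓ P ≤ PolyOn m P :=
  Submodule.map_mono (Pol_mono h)

/-- The integral of `f · g` over `P` for the `d`-dimensional Hausdorff measure, normalised to be
the `d`-dimensional Lebesgue measure on subspaces of dimension `d`. -/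
def ip {H : Type*} [NormedAddCommGroup H] [InnerProductSpace ℝ H] (d : ℕ) {P : Set E3}
    (f g : P → H) : ℝ :=
  ∫ x : P, inner ℝ (f x) (g x) ∂((μHE[d] : Measure E3).comap Subtype.val)

/-- The element of the space `S` characterised by the property `p`. It is only used where `p`
determines exactly one element. -/
def the {X : Type*} [AddCommGroup X] [Module ℝ X] (S : Submodule ℝ X) (p : S → Prop) : S :=
  Classical.epsilon p

/-- The `L²`-orthogonal projector on a space `S` of polynomial functions on `P`. -/
def proj {H : Type*} [NormedAddCommGroup H] [InnerProductSpace ℝ H] (d : ℕ) {P : Set E3}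
    (S : Submodule ℝ (P → H)) (f : P → H) : S :=
  the S fun g => ∀ s ∈ S, ip d (g : P → H) s = ip d f s

/-! ## Polyhedral meshes -/

/-- A polyhedral mesh of the connected polyhedral domain `Ω`, with elements, faces, edges and
vertices indexed by `𝒯`, `ℱ`, `ℰ`, `𝒱`.

Elements and faces are open (the latter in their planes); edges are open segments. Elements,
faces, edges and vertices form a partition of the closure of `Ω`; the boundary of each element
is made of closures of mesh faces, the relative boundary of each face is made of closed mesh edges.
The conditions `elem_regular` and `face_regular` (an element is the interior of its closure,
and likewise for faces in their planes), with boundedness and piecewise flatness of the boundary,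
say that elements and faces are interiors of finite unions of closed simplices.

The mesh comes with a point in each element and face, a unit normal to each face, and an
orientation of each edge, given by the order of its two vertices. -/
structure PolyhedralMesh (Ω : Set E3) (𝒯 ℱ ℰ 𝒱 : Type*) where
  /-- The elements. -/
  elem : 𝒯 → Set E3
  /-- The faces. -/
  face : ℱ → Set E3
  /-- The coordinates of the vertices. -/
  vert : 𝒱 → E3
  /-- The first vertex of an edge. -/
  src : ℰ → 𝒱
  /-- The second vertex of an edge. -/
  tgt : ℰ → 𝒱
  /-- The point `x_T` of an element. -/
  centerT : 𝒯 → E3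
  /-- The point `x_F` of a face. -/
  centerF : ℱ → E3
  /-- The unit normal to a face. -/
  normal : ℱ → E3
  domain_open : IsOpen Ω
  domain_connected : IsConnected Ω
  domain_regular : interior (closure Ω) = Ω
  domain_closure : closure Ω = ⋃ T, closure (elem T)
  elem_open : ∀ T, IsOpen (elem T)
  elem_bounded : ∀ T, Bornology.IsBounded (elem T)
  elem_connected : ∀ T, IsConnected (elem T)
  elem_regular : ∀ T, interior (closure (elem T)) = elem T
  elem_disjoint : Pairwise fun T T' => Disjoint (elem T) (elem T')
  centerT_mem : ∀ T, centerT T ∈ elem T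
  elem_frontier : ∀ T,
    frontier (elem T) = ⋃ F ∈ {F | face F ⊆ frontier (elem T)}, closure (face F)
  normal_norm : ∀ F, ‖normal F‖ = 1
  face_planar : ∀ F, face F ⊆ {x | inner ℝ (normal F) (x - centerF F) = 0}
  face_open : ∀ F, ∃ U, IsOpen U ∧
    face F = U ∩ {x | inner ℝ (normal F) (x - centerF F) = 0}
  face_bounded : ∀ F, Bornology.IsBounded (face F)
  face_connected : ∀ F, IsConnected (face F)
  face_regular : ∀ F, ∀ U, IsOpen U →
    U ∩ {x | inner ℝ (normal F) (x - centerF F) = 0} ⊆ closure (face F) →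
    U ∩ {x | inner ℝ (normal F) (x - centerF F) = 0} ⊆ face F
  centerF_mem : ∀ F, centerF F ∈ face F
  /-- A face is an interface between two elements or a boundary face. -/
  face_adjacent : ∀ F,
    (∃ T T', T ≠ T' ∧ face F ⊆ frontier (elem T) ∩ frontier (elem T')) ∨
      (∃ T, face F ⊆ frontier (elem T) ∩ frontier Ω)
  face_frontier : ∀ F, closure (face F) \ face F =
    ⋃ E ∈ {E | openSegment ℝ (vert (src E)) (vert (tgt E)) ⊆ closure (face F) \ face F},
      segment ℝ (vert (src E)) (vert (tgt E))
  edge_nondegenerate : ∀ E, src E ≠ tgt E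
  edge_adjacent : ∀ E, ∃ F,
    openSegment ℝ (vert (src E)) (vert (tgt E)) ⊆ closure (face F) \ face F
  vert_injective : Function.Injective vert
  vert_adjacent : ∀ V, ∃ E, V = src E ∨ V = tgt E
  face_disjoint : Pairwise fun F F' => Disjoint (face F) (face F')
  edge_disjoint : Pairwise fun E E' => Disjoint
    (openSegment ℝ (vert (src E)) (vert (tgt E))) (openSegment ℝ (vert (src E')) (vert (tgt E')))
  face_edge_disjoint : ∀ F E,
    Disjoint (face F) (openSegment ℝ (vert (src E)) (vert (tgt E)))
  vert_notMem_face : ∀ V F, vert V ∉ face F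
  vert_notMem_edge : ∀ V E, vert V ∉ openSegment ℝ (vert (src E)) (vert (tgt E))

namespace PolyhedralMesh

variable {Ω : Set E3} {𝒯 ℱ ℰ 𝒱 : Type*} [Fintype 𝒯] [Fintype ℱ] [Fintype ℰ] [Fintype 𝒱]
variable (M : PolyhedralMesh Ω 𝒯 ℱ ℰ 𝒱)

/-- The (open) edge. -/
def edge (E : ℰ) : Set E3 := openSegment ℝ (M.vert (M.src E)) (M.vert (M.tgt E))

/-- The unit tangent `t_E`, pointing from the first to the second vertex. -/
def tangent (E : ℰ) : E3 :=
  ‖M.vert (M.tgt E) - M.vert (M.src E)‖⁻¹ • (M.vert (M.tgt E) - M.vert (M.src E))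

open Classical in
/-- The faces on the boundary of an element. -/
def facesOf (T : 𝒯) : Finset ℱ := {F | M.face F ⊆ frontier (M.elem T)}

open Classical in
/-- The edges of a face. -/
def edgesOf (F : ℱ) : Finset ℰ := {E | M.edge E ⊆ closure (M.face F) \ M.face F}

/-- The unit normal `n_{FE} = n_F × t_E` to `E` in the plane of `F`: the system
`(t_E, n_{FE}, n_F)` is right-handed. -/
def normalFE (F : ℱ) (E : ℰ) : E3 :=
  WithLp.toLp 2 ((M.normal F : Fin 3 → ℝ) ⨯₃ (M.tangent E : Fin 3 → ℝ))

open Classical in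
/-- The orientation `ω_{TF}`: it is `1` if `n_F` points out of `T` (so that `T` lies on the side
of `-n_F`) and `-1` otherwise. -/
def ωTF (T : 𝒯) (F : ℱ) : ℝ :=
  if ∀ x ∈ M.face F, ∀ᶠ ε : ℝ in 𝓝[>] 0, x - ε • M.normal F ∈ M.elem T then 1 else -1

open Classical in
/-- The orientation `ω_{FE}`: it is `1` if, in the plane of `F` oriented by `n_F`, the tangent
`t_E` runs along the boundary of `F` clockwise, that is, if `F` lies on the right
`t_E × n_F = -n_{FE}` of `t_E`; it is `-1` otherwise. Hence `ω_{FE} n_{FE}` points out of `F`. -/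
def ωFE (F : ℱ) (E : ℰ) : ℝ :=
  if ∀ x ∈ M.edge E, ∀ᶠ ε : ℝ in 𝓝[>] 0, x - ε • M.normalFE F E ∈ M.face F then 1 else -1

/-! ## Polynomial vector spaces on faces and elements

The spaces without `On` consist of polynomial fields on `E3`; they serve as test functions and
their restrictions to the mesh entity are the spaces of the complex. -/

/-- `rot_F` of the polynomials of degree at most `ℓ + 1`. -/
def RolF (F : ℱ) (ℓ : ℤ) : Submodule ℝ V3 := (Pol (ℓ + 1)).map (rotTan (M.normal F))

/-- `(x - x_F)` times the polynomials of degree at most `ℓ - 1`. -/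
def cRolF (F : ℱ) (ℓ : ℤ) : Submodule ℝ V3 := (Pol (ℓ - 1)).map (posMul (M.centerF F))

/-- `(x - x_T)` times the polynomials of degree at most `ℓ - 1`. -/
def cRolT (T : 𝒯) (ℓ : ℤ) : Submodule ℝ V3 := (Pol (ℓ - 1)).map (posMul (M.centerT T))

/-- `(x - x_T) ×` the vector polynomials of degree at most `ℓ - 1`. -/
def cGolT (T : 𝒯) (ℓ : ℤ) : Submodule ℝ V3 := (VPol (ℓ - 1)).map (posCross (M.centerT T))

abbrev RolOnF (F : ℱ) (ℓ : ℤ) : Submodule ℝ (M.face F → E3) := VOn (M.RolF F ℓ) (M.face F)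
abbrev cRolOnF (F : ℱ) (ℓ : ℤ) : Submodule ℝ (M.face F → E3) := VOn (M.cRolF F ℓ) (M.face F)
/-- Tangential vector polynomials on a face. -/
abbrev VPolOnF (F : ℱ) (ℓ : ℤ) : Submodule ℝ (M.face F → E3) :=
  VOn (VPolTan (M.normal F) ℓ) (M.face F)
abbrev RolOnT (T : 𝒯) (ℓ : ℤ) : Submodule ℝ (M.elem T → E3) := VOn (RolT ℓ) (M.elem T)
abbrev cRolOnT (T : 𝒯) (ℓ : ℤ) : Submodule ℝ (M.elem T → E3) := VOn (M.cRolT T ℓ) (M.elem T)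
abbrev GolOnT (T : 𝒯) (ℓ : ℤ) : Submodule ℝ (M.elem T → E3) := VOn (GolT ℓ) (M.elem T)
abbrev cGolOnT (T : 𝒯) (ℓ : ℤ) : Submodule ℝ (M.elem T → E3) := VOn (M.cGolT T ℓ) (M.elem T)
abbrev VPolOnT (T : 𝒯) (ℓ : ℤ) : Submodule ℝ (M.elem T → E3) := VOn (VPol ℓ) (M.elem T)

/-! ## The discrete spaces

Each space is a product over mesh entities, listed from elements down to vertices; the spaces with
suffix `F` or `E` are their restrictions to the faces (with their edges and vertices) and to
the edges (with their vertices). -/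

/-- Components `(q_E)_E, (q_V)_V`. -/
abbrev XgradE (k : ℕ) : Type _ := (∀ E, PolyOn ((k : ℤ) - 1) (M.edge E)) × (𝒱 → ℝ)

/-- Components `(q_F)_F, (q_E)_E, (q_V)_V`. -/
abbrev XgradF (k : ℕ) : Type _ := (∀ F, PolyOn ((k : ℤ) - 1) (M.face F)) × M.XgradE k

/-- The discrete `H¹` space, with components `(q_T)_T, (q_F)_F, (q_E)_E, (q_V)_V`. -/
abbrev Xgrad (k : ℕ) : Type _ := (∀ T, PolyOn ((k : ℤ) - 1) (M.elem T)) × M.XgradF k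

/-- Components `(v_{R,F}, v^c_{R,F})_F, (v_E)_E`. -/
abbrev XcurlF (k : ℕ) : Type _ :=
  (∀ F, M.RolOnF F ((k : ℤ) - 1) × M.cRolOnF F k) × (∀ E, PolyOn k (M.edge E))

/-- The discrete `H(curl)` space, with components
`(v_{R,T}, v^c_{R,T})_T, (v_{R,F}, v^c_{R,F})_F, (v_E)_E`. -/
abbrev Xcurl (k : ℕ) : Type _ := (∀ T, M.RolOnT T ((k : ℤ) - 1) × M.cRolOnT T k) × M.XcurlF k

/-- The discrete `H(div)` space, with components `(w_{G,T}, w^c_{G,T})_T, (w_F)_F`. -/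
abbrev Xdiv (k : ℕ) : Type _ :=
  (∀ T, M.GolOnT T ((k : ℤ) - 1) × M.cGolOnT T k) × (∀ F, PolyOn k (M.face F))

/-- Broken polynomials `r_h` of degree at most `k`, given by their restrictions `r_T` to the
elements (the union of the elements has full measure in the domain). -/
abbrev PolyTh (k : ℕ) : Type _ := ∀ T, PolyOn k (M.elem T)

/-! ## The discrete operators -/

/-- The edge trace `γ_E^{k+1} q_E`: the polynomial of degree `k + 1` on `E` with value `q_V` at
the vertices of `E` and projection `q_E` on polynomials of degree `k - 1`. -/
def γE (k : ℕ) (q : M.XgradE k) (E : ℰ) : PolyOn ((k : ℤ) + 1) (M.edge E) :=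
  the _ fun g =>
    (∃ p ∈ Pol ((k : ℤ) + 1), restr (M.edge E) p = g ∧
      MvPolynomial.eval (fun i => M.vert (M.src E) i) p = q.2 (M.src E) ∧
      MvPolynomial.eval (fun i => M.vert (M.tgt E) i) p = q.2 (M.tgt E)) ∧
    proj 1 (PolyOn ((k : ℤ) - 1) (M.edge E)) g = q.1 E

/-- The edge gradient `G_E^k q_E`. -/
def gE (k : ℕ) (q : M.XgradE k) (E : ℰ) : PolyOn k (M.edge E) :=
  the _ fun g => ∀ r ∈ Pol k,
    ip 1 g (restr (M.edge E) r)
      = - ip 1 (q.1 E) (restr (M.edge E) (dirDeriv (M.tangent E) r))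
        + q.2 (M.tgt E) * MvPolynomial.eval (fun i => M.vert (M.tgt E) i) r
        - q.2 (M.src E) * MvPolynomial.eval (fun i => M.vert (M.src E) i) r

/-- The boundary term `∑_{E ∈ E_F} ω_{FE} ∫_E γ_E^{k+1} q_E (v · n_{FE})`. -/
def bdryGradF (k : ℕ) (q : M.XgradE k) (F : ℱ) (v : V3) : ℝ :=
  ∑ E ∈ M.edgesOf F, M.ωFE F E *
    ip 1 (M.γE k q E) (restr (M.edge E) (v ⬝ᵥ cst (M.normalFE F E)))

/-- The face gradient. -/
def gF (k : ℕ) (q : M.XgradF k) (F : ℱ) : M.VPolOnF F k :=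
  the _ fun g => ∀ v ∈ VPolTan (M.normal F) k,
    ip 2 g (restrV (M.face F) v)
      = - ip 2 (q.1 F) (restr (M.face F) (divTan (M.normal F) v)) + M.bdryGradF k q.2 F v

/-- The face scalar trace `γ_F^{k+1} q_F`. -/
def γF (k : ℕ) (q : M.XgradF k) (F : ℱ) : PolyOn ((k : ℤ) + 1) (M.face F) :=
  the _ fun g => ∀ v ∈ M.cRolF F ((k : ℤ) + 2),
    ip 2 g (restr (M.face F) (divTan (M.normal F) v))
      = - ip 2 (M.gF k q F) (restrV (M.face F) v) + M.bdryGradF k q.2 F v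

/-- The boundary term `∑_{F ∈ F_T} ω_{TF} ∫_F γ_F^{k+1} q_F (v · n_F)`. -/
def bdryGradT (k : ℕ) (q : M.XgradF k) (T : 𝒯) (v : V3) : ℝ :=
  ∑ F ∈ M.facesOf T, M.ωTF T F *
    ip 2 (M.γF k q F) (restr (M.face F) (v ⬝ᵥ cst (M.normal F)))

/-- The element gradient. -/
def gT (k : ℕ) (q : M.Xgrad k) (T : 𝒯) : M.VPolOnT T k :=
  the _ fun g => ∀ v ∈ VPol k,
    ip 3 g (restrV (M.elem T) v)
      = - ip 3 (q.1 T) (restr (M.elem T) (div v)) + M.bdryGradT k q.2 T v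

/-- The global discrete gradient. -/
def gradH (k : ℕ) (q : M.Xgrad k) : M.Xcurl k :=
  (fun T => (proj 3 _ (M.gT k q T), proj 3 _ (M.gT k q T)),
   fun F => (proj 2 _ (M.gF k q.2 F), proj 2 _ (M.gF k q.2 F)),
   fun E => M.gE k q.2.2 E)

/-- The boundary term `∑_{E ∈ E_F} ω_{FE} ∫_E v_E r`. -/
def bdryCurlF (k : ℕ) (v : ∀ E, PolyOn k (M.edge E)) (F : ℱ) (r : P3) : ℝ :=
  ∑ E ∈ M.edgesOf F, M.ωFE F E * ip 1 (v E) (restr (M.edge E) r)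

/-- The face curl `C_F^k v_F`. -/
def cF (k : ℕ) (v : M.XcurlF k) (F : ℱ) : PolyOn k (M.face F) :=
  the _ fun c => ∀ r ∈ Pol k,
    ip 2 c (restr (M.face F) r)
      = ip 2 (v.1 F).1 (restrV (M.face F) (rotTan (M.normal F) r)) - M.bdryCurlF k v.2 F r

/-- The face tangential trace. -/
def γtF (k : ℕ) (v : M.XcurlF k) (F : ℱ) : M.VPolOnF F k :=
  the _ fun g => ∀ r ∈ Pol ((k : ℤ) + 1), ip 2 (restr (M.face F) r) 1 = 0 →
    ∀ w ∈ M.cRolF F k,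
      ip 2 g (restrV (M.face F) (rotTan (M.normal F) r + w))
        = ip 2 (M.cF k v F) (restr (M.face F) r) + M.bdryCurlF k v.2 F r
          + ip 2 (v.1 F).2 (restrV (M.face F) w)

/-- The boundary term `∑_{F ∈ F_T} ω_{TF} ∫_F γ_{t,F}^k v_F · (w × n_F)`. -/
def bdryCurlT (k : ℕ) (v : M.XcurlF k) (T : 𝒯) (w : V3) : ℝ :=
  ∑ F ∈ M.facesOf T, M.ωTF T F *
    ip 2 (M.γtF k v F) (restrV (M.face F) (w ⨯₃ cst (M.normal F)))

/-- The element curl. -/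
def cT (k : ℕ) (v : M.Xcurl k) (T : 𝒯) : M.VPolOnT T k :=
  the _ fun c => ∀ w ∈ VPol k,
    ip 3 c (restrV (M.elem T) w)
      = ip 3 (v.1 T).1 (restrV (M.elem T) (curl w)) + M.bdryCurlT k v.2 T w

/-- The vector potential reconstruction on the discrete `H(curl)` space. -/
def pcurl (k : ℕ) (v : M.Xcurl k) (T : 𝒯) : M.VPolOnT T k :=
  the _ fun g => ∀ w ∈ M.cGolT T ((k : ℤ) + 1), ∀ z ∈ M.cRolT T k,
    ip 3 g (restrV (M.elem T) (curl w + z))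
      = ip 3 (M.cT k v T) (restrV (M.elem T) w) - M.bdryCurlT k v.2 T w
        + ip 3 (v.1 T).2 (restrV (M.elem T) z)

/-- The global discrete curl. -/
def curlH (k : ℕ) (v : M.Xcurl k) : M.Xdiv k :=
  (fun T => (proj 3 _ (M.cT k v T), proj 3 _ (M.cT k v T)), fun F => M.cF k v.2 F)

/-- The boundary term `∑_{F ∈ F_T} ω_{TF} ∫_F w_F r`. -/
def bdryDivT (k : ℕ) (w : ∀ F, PolyOn k (M.face F)) (T : 𝒯) (r : P3) : ℝ :=
  ∑ F ∈ M.facesOf T, M.ωTF T F * ip 2 (w F) (restr (M.face F) r)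

/-- The element divergence `D_T^k w_T`. -/
def dT (k : ℕ) (w : M.Xdiv k) (T : 𝒯) : PolyOn k (M.elem T) :=
  the _ fun d => ∀ r ∈ Pol k,
    ip 3 d (restr (M.elem T) r)
      = - ip 3 (w.1 T).1 (restrV (M.elem T) (grad r)) + M.bdryDivT k w.2 T r

/-- The vector potential reconstruction on the discrete `H(div)` space. -/
def pdiv (k : ℕ) (w : M.Xdiv k) (T : 𝒯) : M.VPolOnT T k :=
  the _ fun g => ∀ r ∈ Pol ((k : ℤ) + 1), ip 3 (restr (M.elem T) r) 1 = 0 →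
    ∀ z ∈ M.cGolT T k,
      ip 3 g (restrV (M.elem T) (grad r + z))
        = - ip 3 (M.dT k w T) (restr (M.elem T) r) + M.bdryDivT k w.2 T r
          + ip 3 (w.1 T).2 (restrV (M.elem T) z)

/-- The global discrete divergence. -/
def divH (k : ℕ) (w : M.Xdiv k) : M.PolyTh k := fun T => M.dT k w T

/-- The interpolator on the discrete `H¹` space. -/
def Igrad (k : ℕ) (q : E3 → ℝ) : M.Xgrad k :=
  (fun T => proj 3 _ (fun x : M.elem T => q x), fun F => proj 2 _ (fun x : M.face F => q x),
   fun E => proj 1 _ (fun x : M.edge E => q x), fun V => q (M.vert V))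

/-! ## Reductions -/

/-- Reduction of the discrete `H¹` space: the vertex values. -/
def Rgrad (k : ℕ) (q : M.Xgrad k) : M.Xgrad 0 := (0, 0, 0, q.2.2.2)

/-- Reduction of the discrete `H(curl)` space: the averages on the edges. -/
def Rcurl (k : ℕ) (v : M.Xcurl k) : M.Xcurl 0 := (0, 0, fun E => proj 1 _ (v.2.2 E))

/-- Reduction of the discrete `H(div)` space: the averages on the faces. -/
def Rdiv (k : ℕ) (w : M.Xdiv k) : M.Xdiv 0 := (0, fun F => proj 2 _ (w.2 F))

/-- The projector `π_h^0` on piecewise constant functions. -/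
def π0 (k : ℕ) (r : M.PolyTh k) : M.PolyTh 0 := fun T => proj 3 _ (r T)

/-! ## Extensions -/

/-- Piecewise constants as polynomials of degree at most `k`. -/
def incl (k : ℕ) {P : Set E3} (r : PolyOn ((0 : ℕ) : ℤ) P) : PolyOn k P :=
  Submodule.inclusion (PolyOn_mono (by simp) P) r

/-- The natural inclusion of `P^0(T_h)` in `P^k(T_h)`. -/
def inclTh (k : ℕ) (r : M.PolyTh 0) : M.PolyTh k := fun T => incl k (r T)

/-- The edge components of the extension of `q`. -/
def EpolE (k : ℕ) (q : M.XgradE 0) (E : ℰ) : PolyOn ((k : ℤ) - 1) (M.edge E) :=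
  the _ fun g => ∀ r ∈ Pol k,
    ip 1 g (restr (M.edge E) (dirDeriv (M.tangent E) r))
      = - ip 1 (M.gE 0 q E : M.edge E → ℝ) (restr (M.edge E) r)
        + q.2 (M.tgt E) * MvPolynomial.eval (fun i => M.vert (M.tgt E) i) r
        - q.2 (M.src E) * MvPolynomial.eval (fun i => M.vert (M.src E) i) r

/-- The extension of `q` on edges. -/
def EgradE (k : ℕ) (q : M.XgradE 0) : M.XgradE k := (fun E => M.EpolE k q E, q.2)

/-- The face components of the extension of `q`. -/
def EpolF (k : ℕ) (q : M.XgradF 0) (F : ℱ) : PolyOn ((k : ℤ) - 1) (M.face F) :=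
  the _ fun g => ∀ v ∈ M.cRolF F k,
    ip 2 g (restr (M.face F) (divTan (M.normal F) v))
      = - ip 2 (M.gF 0 q F) (restrV (M.face F) v)
        + M.bdryGradF k (M.EgradE k q.2) F v

/-- The extension of `q` on faces. -/
def EgradF (k : ℕ) (q : M.XgradF 0) : M.XgradF k :=
  (fun F => M.EpolF k q F, M.EgradE k q.2)

/-- The element components of the extension of `q`. -/
def EpolT (k : ℕ) (q : M.Xgrad 0) (T : 𝒯) : PolyOn ((k : ℤ) - 1) (M.elem T) :=
  the _ fun g => ∀ v ∈ M.cRolT T k,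
    ip 3 g (restr (M.elem T) (div v))
      = - ip 3 (M.gT 0 q T) (restrV (M.elem T) v)
        + M.bdryGradT k (M.EgradF k q.2) T v

/-- The extension to the discrete `H¹` space. -/
def Egrad (k : ℕ) (q : M.Xgrad 0) : M.Xgrad k :=
  (fun T => M.EpolT k q T, M.EgradF k q.2)

/-- The components in `RolOnF` of the extension of `v`. -/
def ErolF (k : ℕ) (v : M.XcurlF 0) (F : ℱ) : M.RolOnF F ((k : ℤ) - 1) :=
  the _ fun g => ∀ r ∈ Pol k,
    ip 2 g (restrV (M.face F) (rotTan (M.normal F) r))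
      = ip 2 (M.cF 0 v F) (restr (M.face F) r) + M.bdryCurlF 0 v.2 F r

/-- The extension of `v` on faces. -/
def EcurlF (k : ℕ) (v : M.XcurlF 0) : M.XcurlF k :=
  (fun F => (M.ErolF k v F, proj 2 _ (M.γtF 0 v F)), fun E => incl k (v.2 E))

/-- The components in `RolOnT` of the extension of `v`. -/
def ErolT (k : ℕ) (v : M.Xcurl 0) (T : 𝒯) : M.RolOnT T ((k : ℤ) - 1) :=
  the _ fun g => ∀ w ∈ M.cGolT T k,
    ip 3 g (restrV (M.elem T) (curl w))
      = ip 3 (M.cT 0 v T) (restrV (M.elem T) w)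
        - M.bdryCurlT k (M.EcurlF k v.2) T w

/-- The extension to the discrete `H(curl)` space. -/
def Ecurl (k : ℕ) (v : M.Xcurl 0) : M.Xcurl k :=
  (fun T => (M.ErolT k v T, proj 3 _ (M.pcurl 0 v T)), M.EcurlF k v.2)

/-- The components in `GolOnT` of the extension of `w`. -/
def EgolT (k : ℕ) (w : M.Xdiv 0) (T : 𝒯) : M.GolOnT T ((k : ℤ) - 1) :=
  the _ fun g => ∀ r ∈ Pol k,
    ip 3 g (restrV (M.elem T) (grad r))
      = - ip 3 (M.dT 0 w T) (restr (M.elem T) r) + M.bdryDivT 0 w.2 T r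

/-- The extension to the discrete `H(div)` space. -/
def Ediv (k : ℕ) (w : M.Xdiv 0) : M.Xdiv k :=
  (fun T => (M.EgolT k w T, proj 3 _ (M.pdiv 0 w T)), fun F => incl k (w.2 F))

end PolyhedralMesh

end DDR

end

set_option linter.unusedSectionVars false

namespace DDR

/-! ## Linear functionals on finite-dimensional spaces -/

/-! For items 2 to 4, put u = E R x - x, with x in the kernel (in item 4, u is the mean of r minus
r). Reduction preserves averages on edges, faces or elements respectively, so the component of u
there has zero mean. A preimage of u is then built upwards in dimension, with zero components on the
entities below. Each new component is the Riesz representative of a functional of test polynomials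
(`Good.exists_rep`). The only condition is that the functional vanishes when the differential
operator annihilates the test function on the entity. Either the test function is then constant
there, and zero mean gives the condition, or it belongs to a Koszul complement, (x - c)P or (x - c)
× P, on which div or curl is injective.

These choices prescribe the complementary components. The components in R or G on higher entities
are then forced: tested against rot, curl or grad, both sides reduce to boundary terms, which agree
because x and R x are both closed. The delicate case is the element gradient tested against curl z
(`gT_curl`), where the edge contributions must cancel: Σ_F ω_TF ω_FE = 0 (`sum_ωTF_mul_ωFE`). As
nothing is assumed about the topology of T, this is proved locally. Along a small circle around a
point of the edge, the indicator function of T jumps by ω_TF ω_FE at each face containing the edge,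
and it returns to its initial value.

For item 1 one even has E R q = q, so C = 0: vanishing gradients make q and E R q satisfy the same
recursive identities (`EgradE_eq`, `EgradF_eq`).

The algebra rests on the Euler operators m + (x - c)·∇, bijective on polynomials of bounded degree
for m > 0 (`exists_euler_eq`). With `grad_pos_dotProduct` and `euler_field_eq` they give the Koszul
decompositions. Test functions are polynomials on the whole space, so every functional on a face or
edge must be shown to depend only on restrictions; `StarIn.ev_eq_zero` is the unique continuation
used on faces. -/

lemma exists_rep_of_definite {S : Type*} [AddCommGroup S] [Module ℝ S] [FiniteDimensional ℝ S]
    (B : S →ₗ[ℝ] S →ₗ[ℝ] ℝ) (hB : ∀ s, B s s = 0 → s = 0) (l : S →ₗ[ℝ] ℝ) :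
    ∃ s, ∀ t, B s t = l t := by
  have hinj : Function.Injective B := by
    rw [← LinearMap.ker_eq_bot, LinearMap.ker_eq_bot']
    intro s hs
    exact hB s (by rw [hs]; rfl)
  have hsurj : Function.Surjective B :=
    (LinearMap.injective_iff_surjective_of_finrank_eq_finrank
      (Subspace.dual_finrank_eq (K := ℝ) (V := S)).symm).1 hinj
  obtain ⟨s, hs⟩ := hsurj l
  exact ⟨s, fun t => by rw [hs]⟩

/-- The range of the dual map is the annihilator of the kernel. This lets a functional on ambient
polynomials descend to functions on a mesh entity. -/
lemma exists_factor {S V : Type*} [AddCommGroup S] [Module ℝ S] [AddCommGroup V] [Module ℝ V]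
    (A : V →ₗ[ℝ] S) (L : V →ₗ[ℝ] ℝ) (h : ∀ v, A v = 0 → L v = 0) :
    ∃ l : S →ₗ[ℝ] ℝ, ∀ v, l (A v) = L v := by
  have : L ∈ (LinearMap.ker A).dualAnnihilator := by
    rw [Submodule.mem_dualAnnihilator]
    exact fun v hv => h v hv
  rw [← LinearMap.range_dualMap_eq_dualAnnihilator_ker] at this
  obtain ⟨l, hl⟩ := this
  exact ⟨l, fun v => by rw [← hl]; rfl⟩

/-! ## Integration over a piece of the mesh -/

variable {H : Type*} [NormedAddCommGroup H] [InnerProductSpace ℝ H]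

/-- A bounded set on which the `d`-dimensional measure is finite and positive on relatively open
sets. -/
structure Good (d : ℕ) (P : Set E3) : Prop where
  finite : IsFiniteMeasure ((μHE[d] : Measure E3).comap (Subtype.val : P → E3))
  openPos : ((μHE[d] : Measure E3).comap (Subtype.val : P → E3)).IsOpenPosMeasure
  bounded : Bornology.IsBounded P

/-- Bounded continuous functions on `P`. -/
def BC (P : Set E3) (H : Type*) [NormedAddCommGroup H] [InnerProductSpace ℝ H] :
    Submodule ℝ (P → H) where
  carrier := {f | Continuous f ∧ ∃ C, ∀ x, ‖f x‖ ≤ C}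
  add_mem' := by
    rintro f g ⟨hf, C, hC⟩ ⟨hg, D, hD⟩
    exact ⟨hf.add hg, C + D, fun x => (norm_add_le _ _).trans (add_le_add (hC x) (hD x))⟩
  zero_mem' := ⟨continuous_const, 0, fun x => by simp⟩
  smul_mem' := by
    rintro c f ⟨hf, C, hC⟩
    refine ⟨hf.const_smul c, ‖c‖ * C, fun x => ?_⟩
    rw [Pi.smul_apply, norm_smul]
    exact mul_le_mul_of_nonneg_left (hC x) (norm_nonneg c)

section ip

variable {d : ℕ} {P : Set E3}

lemma Good.integrable (hP : Good d P) {f : P → ℝ} (hf : f ∈ BC P ℝ) :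
    Integrable f ((μHE[d] : Measure E3).comap (Subtype.val : P → E3)) := by
  obtain ⟨hc, C, hC⟩ := hf
  have := hP.finite
  exact Integrable.of_bound hc.aestronglyMeasurable C (Filter.Eventually.of_forall hC)

lemma inner_mem_BC {f g : P → H} (hf : f ∈ BC P H) (hg : g ∈ BC P H) :
    (fun x => inner ℝ (f x) (g x)) ∈ BC P ℝ := by
  obtain ⟨hf, C, hC⟩ := hf
  obtain ⟨hg, D, hD⟩ := hg
  refine ⟨hf.inner hg, C * D, fun x => (norm_inner_le_norm _ _).trans ?_⟩
  exact mul_le_mul (hC x) (hD x) (norm_nonneg _) ((norm_nonneg _).trans (hC x))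

lemma Good.eq_zero_of_integral (hP : Good d P) {f : P → ℝ} (hf : f ∈ BC P ℝ) (h0 : ∀ x, 0 ≤ f x)
    (h : ∫ x, f x ∂((μHE[d] : Measure E3).comap (Subtype.val : P → E3)) = 0) : f = 0 := by
  have := hP.openPos
  have := (integral_eq_zero_iff_of_nonneg h0 (hP.integrable hf)).1 h
  exact (Continuous.ae_eq_iff_eq _ hf.1 continuous_const).1 this

lemma ip_comm (f g : P → H) : ip d f g = ip d g f := by
  unfold ip
  simp only [real_inner_comm]

lemma ip_smul_right (c : ℝ) (f g : P → H) : ip d f (c • g) = c * ip d f g := by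
  unfold ip
  simp only [Pi.smul_apply, real_inner_smul_right, integral_const_mul]

lemma ip_smul_left (c : ℝ) (f g : P → H) : ip d (c • f) g = c * ip d f g := by
  rw [ip_comm, ip_smul_right, ip_comm]

@[simp] lemma ip_zero_right (f : P → H) : ip d f 0 = 0 := by
  simp [ip]

@[simp] lemma ip_zero_left (f : P → H) : ip d 0 f = 0 := by
  simp [ip]

lemma Good.ip_add_right (hP : Good d P) {f g h : P → H} (hf : f ∈ BC P H) (hg : g ∈ BC P H)
    (hh : h ∈ BC P H) : ip d f (g + h) = ip d f g + ip d f h := by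
  unfold ip
  simp only [Pi.add_apply, inner_add_right]
  exact integral_add (hP.integrable (inner_mem_BC hf hg)) (hP.integrable (inner_mem_BC hf hh))

lemma Good.ip_add_left (hP : Good d P) {f g h : P → H} (hf : f ∈ BC P H) (hg : g ∈ BC P H)
    (hh : h ∈ BC P H) : ip d (f + g) h = ip d f h + ip d g h := by
  rw [ip_comm, hP.ip_add_right hh hf hg, ip_comm h, ip_comm h]

lemma Good.ip_sub_left (hP : Good d P) {f g h : P → H} (hf : f ∈ BC P H) (hg : g ∈ BC P H)
    (hh : h ∈ BC P H) : ip d (f - g) h = ip d f h - ip d g h := by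
  rw [sub_eq_add_neg, hP.ip_add_left hf (neg_mem hg) hh, ← neg_one_smul ℝ g, ip_smul_left]
  ring

lemma Good.ip_sub_right (hP : Good d P) {f g h : P → H} (hf : f ∈ BC P H) (hg : g ∈ BC P H)
    (hh : h ∈ BC P H) : ip d f (g - h) = ip d f g - ip d f h := by
  rw [ip_comm, hP.ip_sub_left hg hh hf, ip_comm f, ip_comm f]

lemma Good.eq_zero_of_ip_self (hP : Good d P) {f : P → H} (hf : f ∈ BC P H)
    (h : ip d f f = 0) : f = 0 := by
  have := hP.eq_zero_of_integral (inner_mem_BC hf hf) (fun x => real_inner_self_nonneg) h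
  funext x
  exact inner_self_eq_zero.1 (congrFun this x)

/-- Uniqueness in all weak identities, by testing against f - g. -/
lemma Good.ext (hP : Good d P) {S : Submodule ℝ (P → H)} (hS : S ≤ BC P H) {f g : P → H}
    (hf : f ∈ S) (hg : g ∈ S) (h : ∀ s ∈ S, ip d f s = ip d g s) : f = g := by
  rw [← sub_eq_zero]
  apply hP.eq_zero_of_ip_self (hS (sub_mem hf hg))
  rw [hP.ip_sub_left (hS hf) (hS hg) (hS (sub_mem hf hg)), h _ (sub_mem hf hg), sub_self]

/-- Riesz representation of a functional `L` that factors through `A` on the space `T`. -/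
lemma Good.exists_rep (hP : Good d P) {S : Submodule ℝ (P → H)} [FiniteDimensional ℝ S]
    (hS : S ≤ BC P H) {V : Type*} [AddCommGroup V] [Module ℝ V] (T : Submodule ℝ V)
    (A : V →ₗ[ℝ] (P → H)) (L : V →ₗ[ℝ] ℝ) (hA : ∀ v ∈ T, A v ∈ S)
    (hL : ∀ v ∈ T, A v = 0 → L v = 0) : ∃ g : S, ∀ v ∈ T, ip d (g : P → H) (A v) = L v := by
  let B : S →ₗ[ℝ] S →ₗ[ℝ] ℝ := LinearMap.mk₂ ℝ (fun f g => ip d (f : P → H) g)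
    (fun f g h => hP.ip_add_left (hS f.2) (hS g.2) (hS h.2))
    (fun c f g => ip_smul_left c _ _)
    (fun f g h => hP.ip_add_right (hS f.2) (hS g.2) (hS h.2))
    (fun c f g => ip_smul_right c _ _)
  let A' : T →ₗ[ℝ] S := (A.domRestrict T).codRestrict S fun v => hA v v.2
  obtain ⟨l, hl⟩ := exists_factor A' (L.domRestrict T) fun v hv =>
    hL v v.2 (congrArg Subtype.val hv)
  obtain ⟨g, hg⟩ := exists_rep_of_definite B
    (fun s hs => Subtype.ext (hP.eq_zero_of_ip_self (hS s.2) hs)) l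
  exact ⟨g, fun v hv => (hg (A' ⟨v, hv⟩)).trans (hl ⟨v, hv⟩)⟩

end ip

/-- To use the identities defining an operator only existence has to be proved; when two candidates
are to be identified, `Good.ext` supplies uniqueness. -/
lemma the_spec {X : Type*} [AddCommGroup X] [Module ℝ X] {S : Submodule ℝ X} {p : S → Prop}
    (h : ∃ x, p x) : p (the S p) := Classical.epsilon_spec h

/-! ### Orthogonal projectors. -/

section proj

variable {d : ℕ} {P : Set E3}

lemma Good.ip_proj (hP : Good d P) {S : Submodule ℝ (P → H)} [FiniteDimensional ℝ S]
    (hS : S ≤ BC P H) {f : P → H} (hf : f ∈ BC P H) {s : P → H} (hs : s ∈ S) :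
    ip d (proj d S f : P → H) s = ip d f s := by
  have h : ∃ g : S, ∀ s ∈ S, ip d (g : P → H) s = ip d f s := by
    let L : S →ₗ[ℝ] ℝ :=
      { toFun := fun s => ip d f s
        map_add' := fun g h => hP.ip_add_right hf (hS g.2) (hS h.2)
        map_smul' := fun c g => ip_smul_right c _ _ }
    obtain ⟨g, hg⟩ := hP.exists_rep hS ⊤ S.subtype L (fun v _ => v.2) (fun v _ hv => by
      have : v = 0 := Subtype.ext hv
      rw [this, map_zero])
    exact ⟨g, fun s hs => hg ⟨s, hs⟩ trivial⟩
  exact the_spec h s hs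

lemma Good.proj_eq (hP : Good d P) {S : Submodule ℝ (P → H)} [FiniteDimensional ℝ S]
    (hS : S ≤ BC P H) {f : P → H} (hf : f ∈ BC P H) (g : S)
    (h : ∀ s ∈ S, ip d f s = ip d (g : P → H) s) : proj d S f = g :=
  Subtype.ext <| hP.ext hS (proj d S f).2 g.2 fun s hs => by
    rw [hP.ip_proj hS hf hs, h s hs]

end proj

/-! ## Isometric charts -/

/-- The normalised Hausdorff measure is invariant under isometries and is Lebesgue measure on a
Euclidean space of its own dimension, so finiteness and positivity are inherited from a bounded open
set of V. -/
lemma good_of_chart {d : ℕ} {V : Type*} [NormedAddCommGroup V] [InnerProductSpace ℝ V]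
    [FiniteDimensional ℝ V] [MeasurableSpace V] [BorelSpace V] (hd : Module.finrank ℝ V = d)
    {φ : V → E3} (hφ : Isometry φ) {O : Set V} (hO : IsOpen O) (hb : Bornology.IsBounded O) :
    Good d (φ '' O) := by
  subst hd
  have hm : MeasurableSet (φ '' O) :=
    hφ.isClosedEmbedding.measurableEmbedding.measurableSet_image.2 hO.measurableSet
  have hvol : ∀ s : Set V, (μHE[Module.finrank ℝ V] : Measure E3) (φ '' s) = volume s := by
    intro s
    rw [hφ.euclideanHausdorffMeasure_image,
      InnerProductSpace.euclideanHausdorffMeasure_eq_volume]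
  refine ⟨⟨?_⟩, ⟨?_⟩, hφ.lipschitz.isBounded_image hb⟩
  · rw [(MeasurableEmbedding.subtype_coe hm).comap_apply, Set.image_univ, Subtype.range_coe, hvol]
    exact hb.measure_lt_top
  · intro U hU ⟨x, hx⟩
    obtain ⟨W, hW, rfl⟩ := isOpen_induced_iff.1 hU
    rw [(MeasurableEmbedding.subtype_coe hm).comap_apply, Subtype.image_preimage_coe,
      ← Set.image_inter_preimage, hvol]
    obtain ⟨y, hy, hyx⟩ := x.2
    refine ((hO.inter (hW.preimage hφ.continuous)).measure_pos volume ⟨y, hy, ?_⟩).ne'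
    change φ y ∈ W
    rw [hyx]
    exact hx

lemma good_of_isOpen {P : Set E3} (h : IsOpen P) (hb : Bornology.IsBounded P) : Good 3 P := by
  simpa using good_of_chart (d := 3) (by simp) (isometry_id (α := E3)) h hb

lemma good_of_plane {n c : E3} (hn : ‖n‖ = 1) {U : Set E3} (hU : IsOpen U)
    (hb : Bornology.IsBounded (U ∩ {x | inner ℝ n (x - c) = 0})) :
    Good 2 (U ∩ {x | inner ℝ n (x - c) = 0}) := by
  have hn0 : n ≠ 0 := by rintro rfl; simp at hn
  let φ : (ℝ ∙ n)ᗮ → E3 := fun v => v + c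
  have hφ : Isometry φ := fun x y => by
    simp only [φ, edist_add_right]
    rfl
  have himg : φ '' (φ ⁻¹' U) = U ∩ {x | inner ℝ n (x - c) = 0} := by
    rw [Set.image_preimage_eq_inter_range]
    congr 1
    ext x
    constructor
    · rintro ⟨v, rfl⟩
      have := Submodule.mem_orthogonal_singleton_iff_inner_right.1 v.2
      simpa [φ] using this
    · intro hx
      exact ⟨⟨x - c, Submodule.mem_orthogonal_singleton_iff_inner_right.2 hx⟩, by simp [φ]⟩
  rw [← himg] at hb ⊢
  have : Fact (Module.finrank ℝ E3 = 2 + 1) := ⟨by simp⟩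
  refine good_of_chart (Submodule.finrank_orthogonal_span_singleton hn0) hφ
    (hU.preimage hφ.continuous) ?_
  have := hφ.antilipschitz.isBounded_preimage hb
  rwa [hφ.injective.preimage_image] at this

/-- The parametrisation by arc length of the line through `a` and `b`. -/
noncomputable def lineMap (a b : E3) (s : ℝ) : E3 := a + s • (‖b - a‖⁻¹ • (b - a))

lemma isometry_lineMap {a b : E3} (h : a ≠ b) : Isometry (lineMap a b) := by
  have hn : ‖b - a‖ ≠ 0 := norm_ne_zero_iff.2 (sub_ne_zero.2 h.symm)
  refine Isometry.of_dist_eq fun s t => ?_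
  rw [lineMap, lineMap, dist_add_left, dist_eq_norm, dist_eq_norm, ← sub_smul, norm_smul,
    norm_smul, norm_inv, norm_norm, inv_mul_cancel₀ hn, mul_one]

lemma openSegment_eq_lineMap {a b : E3} (h : a ≠ b) :
    openSegment ℝ a b = lineMap a b '' Set.Ioo 0 ‖b - a‖ := by
  have hn : 0 < ‖b - a‖ := norm_pos_iff.2 (sub_ne_zero.2 h.symm)
  rw [openSegment_eq_image']
  ext x
  constructor
  · rintro ⟨θ, ⟨h0, h1⟩, rfl⟩
    refine ⟨θ * ‖b - a‖, ⟨mul_pos h0 hn, by nlinarith⟩, ?_⟩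
    simp only [lineMap, smul_smul]
    rw [mul_assoc, mul_inv_cancel₀ hn.ne', mul_one]
  · rintro ⟨s, ⟨h0, h1⟩, rfl⟩
    refine ⟨s * ‖b - a‖⁻¹, ⟨by positivity, ?_⟩, by simp [lineMap, smul_smul]⟩
    rw [← div_eq_mul_inv, div_lt_one hn]
    exact h1

lemma good_openSegment {a b : E3} (h : a ≠ b) : Good 1 (openSegment ℝ a b) := by
  rw [openSegment_eq_lineMap h]
  exact good_of_chart (by simp) (isometry_lineMap h) isOpen_Ioo (Metric.isBounded_Ioo _ _)

/-- Arc length is an isometry onto the line, which reduces integration by parts on an edge to the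
fundamental theorem of calculus. -/
lemma integral_openSegment {a b : E3} (h : a ≠ b) (f : E3 → ℝ) :
    ∫ x : openSegment ℝ a b, f x
        ∂((μHE[1] : Measure E3).comap (Subtype.val : openSegment ℝ a b → E3))
      = ∫ s in (0 : ℝ)..‖b - a‖, f (lineMap a b s) := by
  have hi := isometry_lineMap h
  have hm : MeasurableSet (openSegment ℝ a b) := by
    rw [openSegment_eq_lineMap h]
    exact hi.isClosedEmbedding.measurableEmbedding.measurableSet_image.2 measurableSet_Ioo
  have hvol : (μHE[1] : Measure ℝ) = volume := by
    have := InnerProductSpace.euclideanHausdorffMeasure_eq_volume (V := ℝ)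
    rwa [Module.finrank_self] at this
  rw [integral_subtype_comap hm, intervalIntegral.integral_of_le (norm_nonneg _),
    integral_Ioc_eq_integral_Ioo, openSegment_eq_lineMap h,
    ← Measure.restrict_restrict_of_subset (Set.image_subset_range (lineMap a b) _),
    ← hi.map_euclideanHausdorffMeasure, hvol,
    hi.isClosedEmbedding.measurableEmbedding.setIntegral_map, hi.injective.preimage_image]


/-! ## Polynomials of bounded degree -/

lemma map_mem_of_monomial {f : P3 →ₗ[ℝ] P3} {l l' : ℤ}
    (h : ∀ m : Fin 3 →₀ ℕ, (m.degree : ℤ) ≤ l → f (MvPolynomial.monomial m 1) ∈ Pol l') {p : P3}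
    (hp : p ∈ Pol l) : f p ∈ Pol l' := by
  have : Pol l ≤ (Pol l').comap f := by
    conv_lhs => rw [Pol, MvPolynomial.restrictSupport_eq_span]
    rw [Submodule.span_le]
    rintro _ ⟨m, hm, rfl⟩
    exact h m hm
  exact this hp

lemma monomial_mem_Pol {m : Fin 3 →₀ ℕ} {l : ℤ} (c : ℝ) (h : (m.degree : ℤ) ≤ l) :
    MvPolynomial.monomial m c ∈ Pol l :=
  (MvPolynomial.monomial_mem_restrictSupport (R := ℝ)).2 (Or.inl h)

lemma pderiv_mem {p : P3} {l : ℤ} (hp : p ∈ Pol l) (i : Fin 3) :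
    MvPolynomial.pderiv i p ∈ Pol (l - 1) := by
  refine map_mem_of_monomial (f := (MvPolynomial.pderiv i).toLinearMap) (fun m hm => ?_) hp
  rw [Derivation.coeFn_coe, MvPolynomial.pderiv_monomial]
  rcases Nat.eq_zero_or_pos (m i) with h0 | h0
  · simp [h0]
  · apply monomial_mem_Pol
    have h1 : m - Finsupp.single i 1 + Finsupp.single i 1 = m :=
      tsub_add_cancel_of_le (Finsupp.single_le_iff.2 h0)
    have h2 := congrArg Finsupp.degree h1
    rw [map_add, Finsupp.degree_single] at h2
    omega

lemma X_mul_mem {p : P3} {l : ℤ} (hp : p ∈ Pol l) (i : Fin 3) :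
    MvPolynomial.X i * p ∈ Pol (l + 1) := by
  refine map_mem_of_monomial (f := LinearMap.mulLeft ℝ (MvPolynomial.X i)) (fun m hm => ?_) hp
  rw [LinearMap.mulLeft_apply, MvPolynomial.X, MvPolynomial.monomial_mul]
  apply monomial_mem_Pol
  rw [map_add, Finsupp.degree_single]
  push_cast
  linarith

lemma C_mul_mem {p : P3} {l : ℤ} (hp : p ∈ Pol l) (c : ℝ) : MvPolynomial.C c * p ∈ Pol l := by
  rw [MvPolynomial.C_mul']
  exact Submodule.smul_mem _ _ hp

lemma C_mem {l : ℤ} (hl : 0 ≤ l) (c : ℝ) : (MvPolynomial.C c : P3) ∈ Pol l :=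
  monomial_mem_Pol c (by simpa using hl)

lemma pos_mul_mem {p : P3} {l : ℤ} (hp : p ∈ Pol l) (c : E3) (i : Fin 3) :
    pos c i * p ∈ Pol (l + 1) := by
  rw [pos, sub_mul]
  exact sub_mem (X_mul_mem hp i) (C_mul_mem (Pol_mono (by linarith) hp) _)

lemma Pol_eq_bot {l : ℤ} (hl : l < 0) : Pol l = ⊥ := by
  rw [Pol, MvPolynomial.restrictSupport_eq_span, Submodule.span_eq_bot]
  rintro _ ⟨m, hm, rfl⟩
  exact absurd hm (by simp only [Set.mem_ofPred_eq]; omega)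

lemma eq_C_of_mem_Pol_zero {p : P3} (hp : p ∈ Pol 0) : ∃ c, p = MvPolynomial.C c := by
  have hb : ∀ i, MvPolynomial.pderiv i p = 0 := fun i => by
    have := pderiv_mem hp i
    rwa [Pol_eq_bot (by norm_num), Submodule.mem_bot] at this
  refine ⟨p.coeff 0, ?_⟩
  refine MvPolynomial.ext _ _ fun m => ?_
  rw [MvPolynomial.coeff_C]
  split_ifs with h
  · rw [h]
  · by_contra hm
    have h1 := hp (MvPolynomial.mem_support_iff.2 hm)
    have h2 : m.degree = 0 := by
      have : (m.degree : ℤ) ≤ 0 := h1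
      omega
    exact h ((Finsupp.degree_eq_zero_iff m).1 h2).symm

instance finiteDimensional_Pol (l : ℤ) : FiniteDimensional ℝ (Pol l) := by
  have hfin : {m : Fin 3 →₀ ℕ | (m.degree : ℤ) ≤ l}.Finite := by
    refine (Finsupp.finite_of_degree_le (σ := Fin 3) l.toNat).subset fun m hm => ?_
    have : (m.degree : ℤ) ≤ l := hm
    simp only [Set.mem_ofPred_eq]
    omega
  have := hfin.to_subtype
  exact Module.Finite.of_basis (MvPolynomial.basisRestrictSupport ℝ _)

lemma mem_VPol {v : V3} {l : ℤ} : v ∈ VPol l ↔ ∀ i, v i ∈ Pol l := by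
  simp [VPol, Submodule.mem_pi]

instance finiteDimensional_VPol (l : ℤ) : FiniteDimensional ℝ (VPol l) :=
  Module.Finite.of_injective
    (LinearMap.pi fun i => ((LinearMap.proj i).domRestrict (VPol l)).codRestrict (Pol l)
      fun v => mem_VPol.1 v.2 i : VPol l →ₗ[ℝ] (Fin 3 → Pol l))
    fun _ _ h => Subtype.ext <| funext fun i => congrArg Subtype.val (congrFun h i)

instance finiteDimensional_VPolTan (n : E3) (l : ℤ) : FiniteDimensional ℝ (VPolTan n l) :=
  Submodule.finiteDimensional_of_le (S₂ := VPol l) fun _ hv => hv.1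

instance (l : ℤ) (P : Set E3) : FiniteDimensional ℝ (PolyOn l P) :=
  inferInstanceAs (FiniteDimensional ℝ ((Pol l).map (restr P)))

instance (S : Submodule ℝ V3) [FiniteDimensional ℝ S] (P : Set E3) :
    FiniteDimensional ℝ (VOn S P) :=
  inferInstanceAs (FiniteDimensional ℝ (S.map (restrV P)))

instance (l : ℤ) : FiniteDimensional ℝ (RolT l) :=
  inferInstanceAs (FiniteDimensional ℝ ((VPol (l + 1)).map curl))

instance (l : ℤ) : FiniteDimensional ℝ (GolT l) :=
  inferInstanceAs (FiniteDimensional ℝ ((Pol (l + 1)).map grad))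

section

variable {Ω : Set E3} {𝒯 ℱ ℰ 𝒱 : Type*} [Fintype 𝒯] [Fintype ℱ] [Fintype ℰ] [Fintype 𝒱]
  (M : PolyhedralMesh Ω 𝒯 ℱ ℰ 𝒱)

instance (F : ℱ) (l : ℤ) : FiniteDimensional ℝ (M.RolF F l) :=
  inferInstanceAs (FiniteDimensional ℝ ((Pol (l + 1)).map (rotTan (M.normal F))))

instance (F : ℱ) (l : ℤ) : FiniteDimensional ℝ (M.cRolF F l) :=
  inferInstanceAs (FiniteDimensional ℝ ((Pol (l - 1)).map (posMul (M.centerF F))))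

instance (T : 𝒯) (l : ℤ) : FiniteDimensional ℝ (M.cRolT T l) :=
  inferInstanceAs (FiniteDimensional ℝ ((Pol (l - 1)).map (posMul (M.centerT T))))

instance (T : 𝒯) (l : ℤ) : FiniteDimensional ℝ (M.cGolT T l) :=
  inferInstanceAs (FiniteDimensional ℝ ((VPol (l - 1)).map (posCross (M.centerT T))))

end

/-! ## Evaluation -/

/-- Evaluation of a polynomial at a point. -/
noncomputable def ev (x : E3) : P3 →ₐ[ℝ] ℝ := MvPolynomial.aeval fun i => x i

lemma eval_eq_ev (x : E3) (p : P3) : MvPolynomial.eval (fun i => x i) p = ev x p := by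
  rw [ev, MvPolynomial.aeval_eq_eval]

lemma restr_apply (P : Set E3) (p : P3) (x : P) : restr P p x = ev x p := rfl

lemma restrV_apply (P : Set E3) (v : V3) (x : P) (i : Fin 3) : restrV P v x i = ev x (v i) := rfl

lemma restr_eq_zero {P : Set E3} {p : P3} : restr P p = 0 ↔ ∀ x ∈ P, ev x p = 0 :=
  ⟨fun h x hx => congrFun h ⟨x, hx⟩, fun h => funext fun x => h x x.2⟩

lemma restr_congr {P : Set E3} {p q : P3} : restr P p = restr P q ↔ ∀ x ∈ P, ev x p = ev x q :=
  ⟨fun h x hx => congrFun h ⟨x, hx⟩, fun h => funext fun x => h x x.2⟩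

lemma restrV_eq_zero {P : Set E3} {v : V3} :
    restrV P v = 0 ↔ ∀ x ∈ P, ∀ i, ev x (v i) = 0 :=
  ⟨fun h x hx i => congrFun (congrArg WithLp.ofLp (congrFun h ⟨x, hx⟩)) i,
    fun h => funext fun x => PiLp.ext fun i => h x x.2 i⟩

lemma restrV_congr {P : Set E3} {v w : V3} :
    restrV P v = restrV P w ↔ ∀ x ∈ P, ∀ i, ev x (v i) = ev x (w i) := by
  rw [← sub_eq_zero, ← map_sub, restrV_eq_zero]
  simp [sub_eq_zero]

lemma continuous_ev (p : P3) : Continuous fun x : E3 => ev x p := by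
  simp only [← eval_eq_ev]
  exact (MvPolynomial.continuous_eval p).comp (continuous_pi fun i => by fun_prop)

lemma restr_mem_BC {P : Set E3} (hP : Bornology.IsBounded P) (p : P3) : restr P p ∈ BC P ℝ := by
  refine ⟨(continuous_ev p).comp continuous_subtype_val, ?_⟩
  obtain ⟨C, hC⟩ := hP.isCompact_closure.exists_bound_of_continuousOn
    (continuous_ev p).continuousOn
  exact ⟨C, fun x => hC x (subset_closure x.2)⟩

lemma restrV_mem_BC {P : Set E3} (hP : Bornology.IsBounded P) (v : V3) :
    restrV P v ∈ BC P E3 := by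
  have h : restrV P v = ∑ i, fun x : P => restr P (v i) x • EuclideanSpace.single i (1 : ℝ) := by
    funext x
    refine PiLp.ext fun j => ?_
    simp [restrV_apply, restr_apply, Finset.sum_apply, Pi.single_apply]
  rw [h]
  refine Submodule.sum_mem _ fun i _ => ?_
  obtain ⟨hc, C, hC⟩ := restr_mem_BC hP (v i)
  refine ⟨hc.smul continuous_const, C, fun x => ?_⟩
  rw [norm_smul]
  simpa using hC x

lemma Good.PolyOn_le {d : ℕ} {P : Set E3} (hP : Good d P) (l : ℤ) : PolyOn l P ≤ BC P ℝ := by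
  rintro _ ⟨p, _, rfl⟩
  exact restr_mem_BC hP.bounded p

lemma Good.VOn_le {d : ℕ} {P : Set E3} (hP : Good d P) (S : Submodule ℝ V3) :
    VOn S P ≤ BC P E3 := by
  rintro _ ⟨p, _, rfl⟩
  exact restrV_mem_BC hP.bounded p

/-! ## Restriction to lines -/

/-- Restriction of a polynomial to the line `s ↦ c + s u`. -/
noncomputable def line (c u : E3) : P3 →ₐ[ℝ] Polynomial ℝ :=
  MvPolynomial.aeval fun i => Polynomial.C (c i) + Polynomial.X * Polynomial.C (u i)

lemma eval_line (c u : E3) (p : P3) (s : ℝ) : (line c u p).eval s = ev (c + s • u) p := by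
  have : ((Polynomial.aeval s).comp (line c u) : P3 →ₐ[ℝ] ℝ) = ev (c + s • u) := by
    refine MvPolynomial.algHom_ext fun i => ?_
    simp only [line, ev, AlgHom.comp_apply, MvPolynomial.aeval_X, map_add, map_mul,
      Polynomial.aeval_C, Polynomial.aeval_X]
    simp
  rw [← this]
  simp

/-- Chain rule, checked on generators. Vector calculus questions become questions on univariate
polynomials through it. -/
lemma derivative_line (c u : E3) (p : P3) :
    Polynomial.derivative (line c u p) = line c u (dirDeriv u p) := by
  induction p using MvPolynomial.induction_on with
  | C a => simp [line, dirDeriv, grad, dotProduct]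
  | add p q hp hq =>
    rw [map_add, Polynomial.derivative_add, hp, hq, ← map_add]
    simp only [dirDeriv, map_add, dotProduct_add]
  | mul_X p i hp =>
    have h1 : dirDeriv u (p * MvPolynomial.X i)
        = dirDeriv u p * MvPolynomial.X i + p * MvPolynomial.C (u i) := by
      simp only [dirDeriv, grad, dotProduct, LinearMap.pi_apply, Derivation.coeFn_coe,
        Derivation.leibniz, MvPolynomial.pderiv_X, smul_eq_mul, mul_add, Finset.sum_add_distrib,
        Finset.sum_mul, cst]
      fin_cases i <;> simp [Fin.sum_univ_three] <;> ring
    have h2 : line c u (MvPolynomial.X i) = Polynomial.C (c i) + Polynomial.X * Polynomial.C (u i) := by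
      simp [line]
    have h3 : line c u (MvPolynomial.C (u i)) = Polynomial.C (u i) := by
      simp [line]
    rw [map_mul, Polynomial.derivative_mul, hp, h1, map_add, map_mul, map_mul, h2, h3]
    simp

lemma line_eq_zero {c u : E3} {p : P3} (h : ∀ᶠ s : ℝ in 𝓝 0, ev (c + s • u) p = 0) :
    line c u p = 0 := by
  refine Polynomial.eq_zero_of_infinite_isRoot _ ((infinite_of_mem_nhds (0 : ℝ) h).mono ?_)
  intro s hs
  rw [Set.mem_ofPred_eq, Polynomial.IsRoot.def, eval_line]
  exact hs

/-- `P` is a neighbourhood of `c` in the union `W` of lines through `c`. -/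
structure StarIn (P W : Set E3) (c : E3) : Prop where
  line_mem : ∀ y ∈ W, ∀ s : ℝ, c + s • (y - c) ∈ W
  eventually_mem : ∀ y ∈ W, ∀ᶠ s : ℝ in 𝓝 0, c + s • (y - c) ∈ P

/-- Unique continuation: on each line through c the polynomial has infinitely many zeros near c.
Hence identities on an open face extend to its whole plane, in particular to its edges and vertices.
-/
lemma StarIn.ev_eq_zero {P W : Set E3} {c : E3} (h : StarIn P W c) {p : P3}
    (hp : restr P p = 0) {y : E3} (hy : y ∈ W) : ev y p = 0 := by
  rw [restr_eq_zero] at hp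
  have h1 : line c (y - c) p = 0 :=
    line_eq_zero ((h.eventually_mem y hy).mono fun s hs => hp _ hs)
  have h2 := eval_line c (y - c) p 1
  rw [h1] at h2
  simpa using h2.symm

/-! ### Euler operators and their inverses. -/

/-- The operator `m + (x - c) · ∇`. -/
noncomputable def euler (m : ℕ) (c : E3) : P3 →ₗ[ℝ] P3 :=
  (m : ℝ) • LinearMap.id + ∑ i, LinearMap.mulLeft ℝ (pos c i) ∘ₗ
    (MvPolynomial.pderiv i).toLinearMap

lemma euler_apply (m : ℕ) (c : E3) (p : P3) : euler m c p = m * p + pos c ⬝ᵥ grad p := by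
  simp [euler, dotProduct, grad, LinearMap.sum_apply, MvPolynomial.smul_eq_C_mul]

lemma euler_mem {m : ℕ} {c : E3} {p : P3} {l : ℤ} (hp : p ∈ Pol l) : euler m c p ∈ Pol l := by
  rw [euler, LinearMap.add_apply, LinearMap.sum_apply]
  refine add_mem (Submodule.smul_mem _ _ hp) (Submodule.sum_mem _ fun i _ => ?_)
  have := pos_mul_mem (pderiv_mem hp i) c i
  rwa [sub_add_cancel] at this

/-- On rays from c the operator becomes m + X d/dX. -/
lemma line_euler (m : ℕ) (c u : E3) (p : P3) : line c u (euler m c p) =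
    (m : Polynomial ℝ) * line c u p + Polynomial.X * Polynomial.derivative (line c u p) := by
  rw [derivative_line, euler_apply, map_add, map_mul, map_natCast]
  congr 1
  simp only [dirDeriv, dotProduct, map_sum, map_mul, Finset.mul_sum]
  refine Finset.sum_congr rfl fun i _ => ?_
  simp only [line, pos, cst, map_sub, MvPolynomial.aeval_X, MvPolynomial.aeval_C,
    Polynomial.algebraMap_eq]
  ring

/-- The coefficient of degree j is multiplied by m + j, which is positive. -/
lemma eq_zero_of_euler {m : ℕ} (hm : 0 < m) {φ : Polynomial ℝ}
    (h : (m : Polynomial ℝ) * φ + Polynomial.X * Polynomial.derivative φ = 0) : φ = 0 := by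
  ext j
  have h1 := congrArg (fun f => Polynomial.coeff f j) h
  simp only [Polynomial.coeff_add, Polynomial.coeff_natCast_mul, Polynomial.coeff_zero] at h1
  have h2 : (Polynomial.X * Polynomial.derivative φ).coeff j = j * φ.coeff j := by
    cases j with
    | zero => simp
    | succ j => rw [Polynomial.coeff_X_mul, Polynomial.coeff_derivative]; push_cast; ring
  rw [h2, ← add_mul] at h1
  rcases mul_eq_zero.1 h1 with h3 | h3
  · have : (0 : ℝ) < m := by exact_mod_cast hm
    have : (0 : ℝ) ≤ j := by positivity
    linarith
  · simpa using h3

lemma StarIn.ev_eq_zero_of_euler {P W : Set E3} {c : E3} (h : StarIn P W c) {m : ℕ} (hm : 0 < m)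
    {p : P3} (hp : ∀ y ∈ W, ev y (euler m c p) = 0) {y : E3} (hy : y ∈ W) : ev y p = 0 := by
  have h1 : line c (y - c) (euler m c p) = 0 :=
    line_eq_zero (Filter.Eventually.of_forall fun s => hp _ (h.line_mem y hy s))
  rw [line_euler] at h1
  have h2 := eval_line c (y - c) p 1
  rw [eq_zero_of_euler hm h1] at h2
  simpa using h2.symm

lemma starIn_of_isOpen {P : Set E3} (hP : IsOpen P) {c : E3} (hc : c ∈ P) :
    StarIn P Set.univ c := by
  refine ⟨fun _ _ _ => trivial, fun y _ => ?_⟩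
  have : Continuous fun s : ℝ => c + s • (y - c) := by fun_prop
  exact this.continuousAt.eventually_mem (by simpa using hP.mem_nhds hc)

lemma eq_zero_of_ev {p : P3} (h : ∀ x : E3, ev x p = 0) : p = 0 := by
  refine MvPolynomial.funext fun x => ?_
  have := h (WithLp.toLp 2 x)
  rw [← eval_eq_ev] at this
  rw [map_zero]
  exact this

lemma eq_zero_of_restr {P : Set E3} (hP : IsOpen P) (hne : P.Nonempty) {p : P3}
    (h : restr P p = 0) : p = 0 := by
  obtain ⟨c, hc⟩ := hne
  exact eq_zero_of_ev fun x => (starIn_of_isOpen hP hc).ev_eq_zero h trivial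

lemma eq_zero_of_restrV {P : Set E3} (hP : IsOpen P) (hne : P.Nonempty) {v : V3}
    (h : restrV P v = 0) : v = 0 :=
  funext fun i => eq_zero_of_restr hP hne
    (restr_eq_zero.2 fun x hx => restrV_eq_zero.1 h x hx i)

lemma euler_injective {m : ℕ} (hm : 0 < m) (c : E3) : Function.Injective (euler m c) := by
  rw [← LinearMap.ker_eq_bot, LinearMap.ker_eq_bot']
  intro p hp
  refine eq_zero_of_ev fun x => (starIn_of_isOpen isOpen_univ
    (Set.mem_univ c)).ev_eq_zero_of_euler hm (fun y _ => ?_) trivial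
  rw [hp, map_zero]

/-- An injective endomorphism of the finite-dimensional space `Pol l` is onto. The value m = 1
serves for vector fields and for primitives on edges, m = 2 for the divergence on faces, m = 3 for
the divergence on elements. -/
lemma exists_euler_eq {m : ℕ} (hm : 0 < m) (c : E3) {l : ℤ} {p : P3} (hp : p ∈ Pol l) :
    ∃ u ∈ Pol l, euler m c u = p := by
  let A : Pol l →ₗ[ℝ] Pol l := (euler m c).restrict fun p hp => euler_mem hp
  have hA : Function.Injective A := fun u v h =>
    Subtype.ext (euler_injective hm c (congrArg Subtype.val h))
  obtain ⟨u, hu⟩ := LinearMap.surjective_of_injective hA ⟨p, hp⟩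
  exact ⟨u, u.2, congrArg Subtype.val hu⟩


/-! ## Vector calculus for polynomial fields -/

/-- The commutator of two derivations is a derivation, and this one kills the variables. -/
lemma pderiv_comm (i j : Fin 3) (p : P3) :
    MvPolynomial.pderiv i (MvPolynomial.pderiv j p)
      = MvPolynomial.pderiv j (MvPolynomial.pderiv i p) := by
  have h : ⁅(MvPolynomial.pderiv i : Derivation ℝ P3 P3),
      (MvPolynomial.pderiv j : Derivation ℝ P3 P3)⁆ = 0 := by
    refine MvPolynomial.derivation_ext fun k => ?_
    rw [Derivation.commutator_apply]
    simp only [MvPolynomial.pderiv_X, Pi.single_apply]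
    split_ifs <;> simp
  have := DFunLike.congr_fun h p
  rw [Derivation.commutator_apply] at this
  exact sub_eq_zero.1 this

lemma dotProduct_three {R : Type*} [CommRing R] (v w : Fin 3 → R) :
    v ⬝ᵥ w = v 0 * w 0 + v 1 * w 1 + v 2 * w 2 := by
  simp [dotProduct, Fin.sum_univ_three]

lemma vec3_ext {R : Type*} {v w : Fin 3 → R} (h0 : v 0 = w 0) (h1 : v 1 = w 1) (h2 : v 2 = w 2) :
    v = w := by
  funext i
  fin_cases i
  exacts [h0, h1, h2]

@[simp] lemma grad_apply (p : P3) (i : Fin 3) : grad p i = MvPolynomial.pderiv i p := rfl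

lemma div_eq (v : V3) : div v = MvPolynomial.pderiv 0 (v 0) + MvPolynomial.pderiv 1 (v 1)
    + MvPolynomial.pderiv 2 (v 2) := by
  simp [div, Fin.sum_univ_three]

lemma curl_apply (v : V3) : curl v = ![MvPolynomial.pderiv 1 (v 2) - MvPolynomial.pderiv 2 (v 1),
    MvPolynomial.pderiv 2 (v 0) - MvPolynomial.pderiv 0 (v 2),
    MvPolynomial.pderiv 0 (v 1) - MvPolynomial.pderiv 1 (v 0)] := rfl

lemma posMul_apply (c : E3) (p : P3) (i : Fin 3) : posMul c p i = pos c i * p := rfl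

lemma posCross_apply (c : E3) (v : V3) : posCross c v = pos c ⨯₃ v := rfl

@[simp] lemma cst_apply (a : E3) (i : Fin 3) : cst a i = MvPolynomial.C (a i) := rfl

@[simp] lemma pderiv_pos_self (c : E3) (i : Fin 3) : MvPolynomial.pderiv i (pos c i) = 1 := by
  simp [pos]

lemma pderiv_pos_of_ne (c : E3) {i j : Fin 3} (h : j ≠ i) :
    MvPolynomial.pderiv i (pos c j) = 0 := by
  simp [pos, MvPolynomial.pderiv_X_of_ne h]

lemma pderiv_mul' (i : Fin 3) (p q : P3) : MvPolynomial.pderiv i (p * q) =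
    MvPolynomial.pderiv i p * q + p * MvPolynomial.pderiv i q := by
  rw [Derivation.leibniz, smul_eq_mul, smul_eq_mul]
  ring

lemma euler_eq (m : ℕ) (c : E3) (p : P3) : euler m c p = m * p
    + (pos c 0 * MvPolynomial.pderiv 0 p + pos c 1 * MvPolynomial.pderiv 1 p
    + pos c 2 * MvPolynomial.pderiv 2 p) := by
  rw [euler_apply, dotProduct_three]
  rfl

lemma curl_grad (p : P3) : curl (grad p) = 0 := by
  rw [curl_apply]
  refine vec3_ext ?_ ?_ ?_ <;> simp [pderiv_comm 1 0, pderiv_comm 2 0, pderiv_comm 2 1]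

lemma div_curl (v : V3) : div (curl v) = 0 := by
  rw [div_eq, curl_apply]
  simp [pderiv_comm 1 0, pderiv_comm 2 0, pderiv_comm 2 1]

lemma div_posMul (c : E3) (p : P3) : div (posMul c p) = euler 3 c p := by
  simp only [div_eq, posMul_apply, pderiv_mul', pderiv_pos_self, euler_eq]
  push_cast
  ring

/-- Koszul homotopy formula: up to the invertible Euler operator, every field is a gradient plus a
field (x - c) × z. -/
lemma grad_pos_dotProduct (c : E3) (u : V3) :
    grad (pos c ⬝ᵥ u) = (fun i => euler 1 c (u i)) + pos c ⨯₃ curl u := by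
  refine vec3_ext ?_ ?_ ?_ <;>
  · simp only [grad_apply, dotProduct_three, map_add, pderiv_mul', Pi.add_apply, cross_apply,
      curl_apply, euler_eq, pderiv_pos_self, Matrix.cons_val_zero, Matrix.cons_val_one,
      Matrix.cons_val, pderiv_pos_of_ne c (show (0 : Fin 3) ≠ 1 by decide),
      pderiv_pos_of_ne c (show (0 : Fin 3) ≠ 2 by decide),
      pderiv_pos_of_ne c (show (1 : Fin 3) ≠ 0 by decide),
      pderiv_pos_of_ne c (show (1 : Fin 3) ≠ 2 by decide),
      pderiv_pos_of_ne c (show (2 : Fin 3) ≠ 0 by decide),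
      pderiv_pos_of_ne c (show (2 : Fin 3) ≠ 1 by decide)]
    push_cast
    ring

lemma grad_mem {p : P3} {l : ℤ} (hp : p ∈ Pol l) : grad p ∈ VPol (l - 1) :=
  mem_VPol.2 fun i => pderiv_mem hp i

lemma div_mem {v : V3} {l : ℤ} (hv : v ∈ VPol l) : div v ∈ Pol (l - 1) :=
  Submodule.sum_mem _ fun i _ => pderiv_mem (mem_VPol.1 hv i) i

lemma curl_mem {v : V3} {l : ℤ} (hv : v ∈ VPol l) : curl v ∈ VPol (l - 1) := by
  rw [mem_VPol] at hv ⊢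
  intro i
  fin_cases i
  exacts [sub_mem (pderiv_mem (hv _) _) (pderiv_mem (hv _) _),
    sub_mem (pderiv_mem (hv _) _) (pderiv_mem (hv _) _),
    sub_mem (pderiv_mem (hv _) _) (pderiv_mem (hv _) _)]

lemma VPol_mono {l m : ℤ} (h : l ≤ m) : VPol l ≤ VPol m := fun _ hv =>
  mem_VPol.2 fun i => Pol_mono h (mem_VPol.1 hv i)

lemma dotProduct_pos_mem {u : V3} {l : ℤ} (hu : u ∈ VPol l) (c : E3) :
    pos c ⬝ᵥ u ∈ Pol (l + 1) :=
  Submodule.sum_mem _ fun i _ => pos_mul_mem (mem_VPol.1 hu i) c i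

lemma dotProduct_cst_mem {u : V3} {l : ℤ} (hu : u ∈ VPol l) (a : E3) : u ⬝ᵥ cst a ∈ Pol l :=
  Submodule.sum_mem _ fun i _ => by
    rw [mul_comm]
    exact C_mul_mem (mem_VPol.1 hu i) _

lemma cross_cst_mem {u : V3} {l : ℤ} (hu : u ∈ VPol l) (a : E3) : u ⨯₃ cst a ∈ VPol l := by
  rw [mem_VPol] at hu ⊢
  intro i
  rw [cross_apply]
  fin_cases i <;>
  · simp only [cst_apply, mul_comm _ (MvPolynomial.C _)]
    exact sub_mem (C_mul_mem (hu _) _) (C_mul_mem (hu _) _)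

lemma posMul_mem {p : P3} {l : ℤ} (hp : p ∈ Pol l) (c : E3) : posMul c p ∈ VPol (l + 1) :=
  mem_VPol.2 fun i => pos_mul_mem hp c i

lemma posCross_mem {u : V3} {l : ℤ} (hu : u ∈ VPol l) (c : E3) : posCross c u ∈ VPol (l + 1) := by
  rw [mem_VPol] at hu ⊢
  intro i
  rw [posCross_apply, cross_apply]
  fin_cases i <;>
  exact sub_mem (pos_mul_mem (hu _) _ _) (pos_mul_mem (hu _) _ _)

/-- Decomposition of a vector polynomial into a gradient and a Koszul complement. -/
lemma exists_grad_add_posCross (c : E3) {w : V3} {l : ℤ} (hw : w ∈ VPol l) :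
    ∃ r ∈ Pol (l + 1), ∃ z ∈ (VPol (l - 1)).map (posCross c), w = grad r + z := by
  -- With u the componentwise Euler preimage of w, the homotopy formula dictates r = (x - c)·u and z
  -- = -(x - c) × curl u.
  choose u hu huw using fun i => exists_euler_eq one_pos c (mem_VPol.1 hw i)
  have hu' : u ∈ VPol l := mem_VPol.2 hu
  refine ⟨pos c ⬝ᵥ u, dotProduct_pos_mem hu' c, _,
    ⟨-curl u, neg_mem (curl_mem hu'), rfl⟩, ?_⟩
  rw [map_neg, posCross_apply, grad_pos_dotProduct, add_neg_cancel_right]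
  funext i
  exact (huw i).symm

/-- A field w = (x - c) × u satisfies (x - c)·w = 0, so if curl w = 0 the homotopy formula says that
the Euler operator kills w. -/
lemma eq_zero_of_curl_posCross {c : E3} {u : V3} (h : curl (posCross c u) = 0) :
    posCross c u = 0 := by
  have h1 := grad_pos_dotProduct c (posCross c u)
  rw [h, posCross_apply, dot_self_cross, map_zero, map_zero, add_zero] at h1
  rw [posCross_apply]
  funext i
  exact euler_injective one_pos c ((congrFun h1.symm i).trans (map_zero _).symm)

lemma eq_zero_of_div_posMul {c : E3} {p : P3} (h : div (posMul c p) = 0) : p = 0 := by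
  rw [div_posMul] at h
  exact euler_injective three_pos c (h.trans (map_zero _).symm)

lemma eq_C_of_grad_eq_zero {r : P3} (h : grad r = 0) : ∃ a, r = MvPolynomial.C a := by
  have h1 : euler 1 0 (r - MvPolynomial.C (ev 0 r)) = r - MvPolynomial.C (ev 0 r) := by
    rw [euler_apply]
    have : grad (r - MvPolynomial.C (ev 0 r)) = 0 := by
      rw [map_sub, h]
      funext i
      simp
    rw [this]
    simp
  refine ⟨ev 0 r, ?_⟩
  refine sub_eq_zero.1 (eq_zero_of_ev fun x => ?_)
  have h2 : line 0 x (dirDeriv x r) = 0 := by simp [dirDeriv, h]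
  rw [← derivative_line] at h2
  have h3 := Polynomial.eq_C_of_derivative_eq_zero h2
  have h4 := eval_line 0 x r 1
  have h5 := eval_line 0 x r 0
  rw [h3, Polynomial.eval_C] at h4 h5
  simp only [one_smul, zero_add, zero_smul] at h4 h5
  rw [map_sub, ← h4, h5]
  simp [ev]

/-! ## Calculus in a plane -/

/-- The plane through `c` with normal `n`. -/
def plane (n c : E3) : Set E3 := {x | inner ℝ n (x - c) = 0}

lemma inner_three (a b : E3) : inner ℝ a b = a 0 * b 0 + a 1 * b 1 + a 2 * b 2 := by
  rw [PiLp.inner_apply]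
  simp [Fin.sum_univ_three, mul_comm]

@[simp] lemma ev_C (x : E3) (a : ℝ) : ev x (MvPolynomial.C a) = a := by
  simp [ev]

@[simp] lemma ev_pos (x c : E3) (i : Fin 3) : ev x (pos c i) = x i - c i := by
  simp [ev, pos]

lemma mem_plane {n c x : E3} :
    x ∈ plane n c ↔ n 0 * (x 0 - c 0) + n 1 * (x 1 - c 1) + n 2 * (x 2 - c 2) = 0 := by
  rw [plane, Set.mem_ofPred_eq, inner_three]
  rfl

lemma sq_sum_eq_one {n : E3} (hn : ‖n‖ = 1) : n 0 * n 0 + n 1 * n 1 + n 2 * n 2 = 1 := by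
  rw [← inner_three, real_inner_self_eq_norm_sq, hn, one_pow]

lemma gradTan_apply (n : E3) (r : P3) (i : Fin 3) : gradTan n r i = MvPolynomial.pderiv i r
    - (cst n ⬝ᵥ grad r) * MvPolynomial.C (n i) := rfl

lemma rotTan_eq (n : E3) (r : P3) : rotTan n r = grad r ⨯₃ cst n := by
  change (grad r - (cst n ⬝ᵥ grad r) • cst n) ⨯₃ cst n = _
  simp

lemma rotTan_eq_vec (n : E3) (r : P3) : rotTan n r =
    ![MvPolynomial.pderiv 1 r * MvPolynomial.C (n 2) - MvPolynomial.pderiv 2 r * MvPolynomial.C (n 1),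
      MvPolynomial.pderiv 2 r * MvPolynomial.C (n 0) - MvPolynomial.pderiv 0 r * MvPolynomial.C (n 2),
      MvPolynomial.pderiv 0 r * MvPolynomial.C (n 1)
        - MvPolynomial.pderiv 1 r * MvPolynomial.C (n 0)] := by
  rw [rotTan_eq, cross_apply]
  rfl

lemma divTan_eq (n : E3) (v : V3) : divTan n v = div v
    - (cst n ⬝ᵥ fun i => cst n ⬝ᵥ grad (v i)) := by
  simp only [divTan, div, gradTan_apply, dotProduct, Finset.sum_sub_distrib, cst_apply,
    Finset.sum_mul, Finset.mul_sum]
  congr 1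
  refine Finset.sum_congr rfl fun i _ => Finset.sum_congr rfl fun j _ => by ring

lemma divTan_rotTan (n : E3) (r : P3) : divTan n (rotTan n r) = 0 := by
  rw [divTan_eq, rotTan_eq]
  simp only [div_eq, cross_apply, dotProduct_three, grad_apply, cst_apply, map_sub, pderiv_mul',
    MvPolynomial.pderiv_C, Matrix.cons_val_zero, Matrix.cons_val_one, Matrix.cons_val,
    pderiv_comm 1 0, pderiv_comm 2 0, pderiv_comm 2 1]
  ring

/-- Turns the normal component of a curl on a face into a tangential divergence, the form against
which the face trace is defined. -/
lemma divTan_cross_cst (n : E3) (w : V3) : divTan n (w ⨯₃ cst n) = curl w ⬝ᵥ cst n := by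
  rw [divTan_eq]
  simp only [div_eq, curl_apply, cross_apply, dotProduct_three, grad_apply, cst_apply, map_sub,
    pderiv_mul', MvPolynomial.pderiv_C, Matrix.cons_val_zero, Matrix.cons_val_one,
    Matrix.cons_val]
  ring

/-- The tangential divergence of x - c is 3 - |n|² = 2. Away from the plane, the normal component of
x - c would contribute. -/
lemma ev_divTan_posMul {n c x : E3} (hn : ‖n‖ = 1) (hx : x ∈ plane n c) (p : P3) :
    ev x (divTan n (posMul c p)) = ev x (euler 2 c p) := by
  have h1 := sq_sum_eq_one hn
  rw [mem_plane] at hx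
  simp only [divTan_eq, euler_eq, div_eq, posMul_apply, dotProduct_three, grad_apply, cst_apply,
    pderiv_mul', pderiv_pos_self, pderiv_pos_of_ne c (show (0 : Fin 3) ≠ 1 by decide),
      pderiv_pos_of_ne c (show (0 : Fin 3) ≠ 2 by decide),
      pderiv_pos_of_ne c (show (1 : Fin 3) ≠ 0 by decide),
      pderiv_pos_of_ne c (show (1 : Fin 3) ≠ 2 by decide),
      pderiv_pos_of_ne c (show (2 : Fin 3) ≠ 0 by decide),
      pderiv_pos_of_ne c (show (2 : Fin 3) ≠ 1 by decide), map_add, map_sub, map_mul, ev_C, ev_pos,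
      map_natCast, map_one, map_zero]
  push_cast
  linear_combination (-ev x p) * h1 - (n 0 * ev x (MvPolynomial.pderiv 0 p)
    + n 1 * ev x (MvPolynomial.pderiv 1 p) + n 2 * ev x (MvPolynomial.pderiv 2 p)) * hx

/-- Lines of the plane stay in the zero set. This is what makes tangential operators well defined on
restrictions to a face. -/
lemma ev_dirDeriv_eq_zero {n c u x : E3} {p : P3} (hp : ∀ y ∈ plane n c, ev y p = 0)
    (hu : inner ℝ n u = 0) (hx : x ∈ plane n c) : ev x (dirDeriv u p) = 0 := by
  have h1 : line x u p = 0 := line_eq_zero <| Filter.Eventually.of_forall fun s => hp _ <| by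
    rw [plane, Set.mem_ofPred_eq] at hx ⊢
    rw [add_sub_right_comm, inner_add_right, hx, inner_smul_right, hu]
    simp
  have h2 := derivative_line x u p
  rw [h1, map_zero] at h2
  have h3 := eval_line x u (dirDeriv u p) 0
  rw [← h2] at h3
  simpa using h3.symm

lemma ev_gradTan_eq_zero {n c x : E3} (hn : ‖n‖ = 1) {p : P3}
    (hp : ∀ y ∈ plane n c, ev y p = 0) (hx : x ∈ plane n c) (i : Fin 3) :
    ev x (gradTan n p i) = 0 := by
  -- The i-th component is the derivative along the tangential part of the i-th basis vector.
  have h1 : gradTan n p i = dirDeriv (EuclideanSpace.single i 1 - n i • n) p := by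
    rw [gradTan_apply]
    simp only [dirDeriv, dotProduct_three, cst_apply, grad_apply, PiLp.sub_apply, PiLp.smul_apply,
      smul_eq_mul, map_sub, map_mul]
    fin_cases i <;> simp <;> ring
  rw [h1]
  refine ev_dirDeriv_eq_zero hp ?_ hx
  rw [inner_sub_right, inner_smul_right, real_inner_self_eq_norm_sq, hn, real_inner_comm,
    EuclideanSpace.inner_single_left]
  simp

lemma ev_divTan_eq_zero {n c x : E3} (hn : ‖n‖ = 1) {v : V3}
    (hv : ∀ y ∈ plane n c, ∀ i, ev y (v i) = 0) (hx : x ∈ plane n c) :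
    ev x (divTan n v) = 0 := by
  rw [divTan, map_sum]
  exact Finset.sum_eq_zero fun i _ => ev_gradTan_eq_zero hn (fun y hy => hv y hy i) hx i

lemma ev_rotTan_eq_zero {n c x : E3} (hn : ‖n‖ = 1) {p : P3}
    (hp : ∀ y ∈ plane n c, ev y p = 0) (hx : x ∈ plane n c) (i : Fin 3) :
    ev x (rotTan n p i) = 0 := by
  have h := ev_gradTan_eq_zero hn hp hx
  change ev x ((gradTan n p ⨯₃ cst n) i) = 0
  rw [cross_apply]
  fin_cases i <;> simp [h]

/-- Vanishing rotation means vanishing tangential gradient, so p has zero derivative along each line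
of the plane through c. -/
lemma ev_eq_of_rotTan {n c y : E3} (hn : ‖n‖ = 1) {p : P3}
    (hp : ∀ y ∈ plane n c, ∀ i, ev y (rotTan n p i) = 0) (hy : y ∈ plane n c) :
    ev y p = ev c p := by
  have h1 : line c (y - c) (dirDeriv (y - c) p) = 0 := by
    refine line_eq_zero <| Filter.Eventually.of_forall fun s => ?_
    set x := c + s • (y - c) with hx
    have hxp : x ∈ plane n c := by
      rw [plane, Set.mem_ofPred_eq] at hy ⊢
      rw [hx, add_sub_cancel_left, inner_smul_right, hy, mul_zero]
    have h0 := hp x hxp 0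
    have h1 := hp x hxp 1
    have h2 := hp x hxp 2
    rw [mem_plane] at hy
    have h3 := sq_sum_eq_one hn
    simp only [rotTan_eq, cross_apply, dirDeriv, dotProduct_three, cst_apply, grad_apply, map_sub,
      map_mul, map_add, ev_C, Matrix.cons_val_zero, Matrix.cons_val_one, Matrix.cons_val,
      PiLp.sub_apply] at h0 h1 h2 ⊢
    generalize ev x (MvPolynomial.pderiv 0 p) = g0 at *
    generalize ev x (MvPolynomial.pderiv 1 p) = g1 at *
    generalize ev x (MvPolynomial.pderiv 2 p) = g2 at *
    -- Lagrange's identity (g × n)·(d × n) = (g·d)|n|² - (g·n)(d·n) for d = y - c tangential and g =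
    -- ∇p.
    linear_combination ((y 1 - c 1) * n 2 - (y 2 - c 2) * n 1) * h0
      + ((y 2 - c 2) * n 0 - (y 0 - c 0) * n 2) * h1 + ((y 0 - c 0) * n 1 - (y 1 - c 1) * n 0) * h2
      + (n 0 * g0 + n 1 * g1 + n 2 * g2) * hy
      - ((y 0 - c 0) * g0 + (y 1 - c 1) * g1 + (y 2 - c 2) * g2) * h3
  rw [← derivative_line] at h1
  have h3 := Polynomial.eq_C_of_derivative_eq_zero h1
  have h4 := eval_line c (y - c) p 1
  have h5 := eval_line c (y - c) p 0
  rw [h3, Polynomial.eval_C] at h4 h5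
  simp only [one_smul, zero_smul, add_zero, add_sub_cancel] at h4 h5
  rw [← h4, h5]

lemma rotTan_mem {n : E3} {r : P3} {l : ℤ} (hr : r ∈ Pol (l + 1)) : rotTan n r ∈ VPolTan n l := by
  have := grad_mem hr
  rw [add_sub_cancel_right] at this
  refine ⟨?_, ?_⟩
  · rw [rotTan_eq]
    exact cross_cst_mem this n
  · rw [rotTan_eq, dotProduct_comm, dot_cross_self]

/-- Planar counterpart of `grad_pos_dotProduct`, with the rotation in the role of the gradient. It
uses that u is tangential, through the derivatives of u·n = 0, and it holds only on the plane. -/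
lemma euler_field_eq {n c x : E3} (hn : ‖n‖ = 1) (hx : x ∈ plane n c) {u : V3}
    (hu : u ⬝ᵥ cst n = 0) (i : Fin 3) : ev x (euler 1 c (u i)) =
      ev x (rotTan n (u ⬝ᵥ (pos c ⨯₃ cst n)) i) + ev x (posMul c (divTan n u) i) := by
  have hnn := sq_sum_eq_one hn
  rw [mem_plane] at hx
  have hd : ∀ j, MvPolynomial.pderiv j (u ⬝ᵥ cst n) = 0 := fun j => by rw [hu, map_zero]
  have hu' := congrArg (ev x) hu
  have hd0 := congrArg (ev x) (hd 0)
  have hd1 := congrArg (ev x) (hd 1)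
  have hd2 := congrArg (ev x) (hd 2)
  simp only [dotProduct_three, cst_apply, map_add, map_mul, ev_C, map_zero, pderiv_mul',
    MvPolynomial.pderiv_C, mul_zero, add_zero] at hu' hd0 hd1 hd2
  simp only [rotTan_eq_vec, euler_eq, posMul_apply, divTan_eq, div_eq]
  fin_cases i
  all_goals
    simp only [cross_apply, dotProduct_three, grad_apply, cst_apply, map_add, map_sub, map_mul,
      pderiv_mul', MvPolynomial.pderiv_C, ev_C, ev_pos, map_zero, map_one, map_natCast,
      Matrix.cons_val_zero, Matrix.cons_val_one, Matrix.cons_val, pderiv_pos_self,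
      pderiv_pos_of_ne c (show (0 : Fin 3) ≠ 1 by decide),
      pderiv_pos_of_ne c (show (0 : Fin 3) ≠ 2 by decide),
      pderiv_pos_of_ne c (show (1 : Fin 3) ≠ 0 by decide),
      pderiv_pos_of_ne c (show (1 : Fin 3) ≠ 2 by decide),
      pderiv_pos_of_ne c (show (2 : Fin 3) ≠ 0 by decide),
      pderiv_pos_of_ne c (show (2 : Fin 3) ≠ 1 by decide), Fin.zero_eta, Fin.mk_one,
      Fin.reduceFinMk]
    push_cast
    generalize ev x (u 0) = u0 at *
    generalize ev x (u 1) = u1 at *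
    generalize ev x (u 2) = u2 at *
    generalize ev x (MvPolynomial.pderiv 0 (u 0)) = j00 at *
    generalize ev x (MvPolynomial.pderiv 1 (u 0)) = j01 at *
    generalize ev x (MvPolynomial.pderiv 2 (u 0)) = j02 at *
    generalize ev x (MvPolynomial.pderiv 0 (u 1)) = j10 at *
    generalize ev x (MvPolynomial.pderiv 1 (u 1)) = j11 at *
    generalize ev x (MvPolynomial.pderiv 2 (u 1)) = j12 at *
    generalize ev x (MvPolynomial.pderiv 0 (u 2)) = j20 at *
    generalize ev x (MvPolynomial.pderiv 1 (u 2)) = j21 at *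
    generalize ev x (MvPolynomial.pderiv 2 (u 2)) = j22 at *
    generalize x 0 - c 0 = y0 at *
    generalize x 1 - c 1 = y1 at *
    generalize x 2 - c 2 = y2 at *
    first
    | linear_combination (-u0 - (y0 * j00 + y1 * j01 + y2 * j02)
        + y0 * (j00 + j11 + j22)) * hnn + n 0 * hu' + n 0 * (y0 * hd0 + y1 * hd1 + y2 * hd2)
        + (n 0 * j00 + n 1 * j01 + n 2 * j02 - (j00 + j11 + j22) * n 0) * hx
    | linear_combination (-u1 - (y0 * j10 + y1 * j11 + y2 * j12)
        + y1 * (j00 + j11 + j22)) * hnn + n 1 * hu' + n 1 * (y0 * hd0 + y1 * hd1 + y2 * hd2)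
        + (n 0 * j10 + n 1 * j11 + n 2 * j12 - (j00 + j11 + j22) * n 1) * hx
    | linear_combination (-u2 - (y0 * j20 + y1 * j21 + y2 * j22)
        + y2 * (j00 + j11 + j22)) * hnn + n 2 * hu' + n 2 * (y0 * hd0 + y1 * hd1 + y2 * hd2)
        + (n 0 * j20 + n 1 * j21 + n 2 * j22 - (j00 + j11 + j22) * n 2) * hx


/-! ### Decomposition of tangential fields and inverses of the divergences. -/

/-- The divergence as a linear map. -/
noncomputable def divL : V3 →ₗ[ℝ] P3 where
  toFun := div
  map_add' v w := by simp only [div, Pi.add_apply, map_add, Finset.sum_add_distrib]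
  map_smul' c v := by
    simp only [div, Pi.smul_apply, Derivation.map_smul, Finset.smul_sum, RingHom.id_apply]

/-- The tangential divergence as a linear map. -/
noncomputable def divTanL (n : E3) : V3 →ₗ[ℝ] P3 where
  toFun := divTan n
  map_add' v w := by simp only [divTan, Pi.add_apply, map_add, Finset.sum_add_distrib]
  map_smul' c v := by
    simp only [divTan, Pi.smul_apply, map_smul, Finset.smul_sum, RingHom.id_apply]

/-- The directional derivative as a linear map. -/
noncomputable def dirDerivL (t : E3) : P3 →ₗ[ℝ] P3 where
  toFun := dirDeriv t
  map_add' v w := by simp only [dirDeriv, map_add, dotProduct_add]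
  map_smul' c v := by simp only [dirDeriv, map_smul, dotProduct_smul, RingHom.id_apply]

/-- The scalar product with a constant field as a linear map. -/
noncomputable def dotCst (a : E3) : V3 →ₗ[ℝ] P3 where
  toFun v := v ⬝ᵥ cst a
  map_add' _ _ := add_dotProduct _ _ _
  map_smul' _ _ := smul_dotProduct _ _ _

/-- The cross product with a constant field as a linear map. -/
noncomputable def crossCst (a : E3) : V3 →ₗ[ℝ] V3 := (crossProduct.flip (cst a)).restrictScalars ℝ

/-- Evaluation as a linear map. -/
noncomputable def evL (x : E3) : P3 →ₗ[ℝ] ℝ := (ev x).toLinearMap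

lemma dirDeriv_mem {t : E3} {p : P3} {l : ℤ} (hp : p ∈ Pol l) : dirDeriv t p ∈ Pol (l - 1) := by
  rw [dirDeriv, dotProduct_comm]
  exact dotProduct_cst_mem (grad_mem hp) t

lemma gradTan_mem {n : E3} {p : P3} {l : ℤ} (hp : p ∈ Pol l) (i : Fin 3) :
    gradTan n p i ∈ Pol (l - 1) := by
  rw [gradTan_apply, mul_comm]
  exact sub_mem (pderiv_mem hp i) (C_mul_mem (dirDeriv_mem hp) _)

lemma divTan_mem {n : E3} {v : V3} {l : ℤ} (hv : v ∈ VPol l) : divTan n v ∈ Pol (l - 1) :=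
  Submodule.sum_mem _ fun i _ => gradTan_mem (mem_VPol.1 hv i) i

lemma starIn_plane {n c : E3} {U : Set E3} (hU : IsOpen U) (hc : c ∈ U) :
    StarIn (U ∩ plane n c) (plane n c) c := by
  have h : ∀ y ∈ plane n c, ∀ s : ℝ, c + s • (y - c) ∈ plane n c := fun y hy s => by
    rw [plane, Set.mem_ofPred_eq] at hy ⊢
    rw [add_sub_cancel_left, inner_smul_right, hy, mul_zero]
  refine ⟨h, fun y hy => ?_⟩
  have h1 : Continuous fun s : ℝ => c + s • (y - c) := by fun_prop
  exact (h1.continuousAt.eventually_mem (by simpa using hU.mem_nhds hc)).mono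
    fun s hs => ⟨hs, h y hy s⟩

lemma ev_eq_zero_of_divTan_posMul {n c : E3} (hn : ‖n‖ = 1) {p : P3}
    (h : ∀ y ∈ plane n c, ev y (divTan n (posMul c p)) = 0) {y : E3} (hy : y ∈ plane n c) :
    ev y p = 0 := by
  have hs : StarIn (Set.univ ∩ plane n c) (plane n c) c :=
    starIn_plane isOpen_univ (Set.mem_univ c)
  refine hs.ev_eq_zero_of_euler two_pos (fun y hy => ?_) hy
  rw [← ev_divTan_posMul hn hy, h y hy]

lemma exists_divTan_posMul_eq {n : E3} (hn : ‖n‖ = 1) (c : E3) {q : P3} {l : ℤ} (hq : q ∈ Pol l) :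
    ∃ p ∈ Pol l, ∀ y ∈ plane n c, ev y (divTan n (posMul c p)) = ev y q := by
  obtain ⟨p, hp, rfl⟩ := exists_euler_eq two_pos c hq
  exact ⟨p, hp, fun y hy => ev_divTan_posMul hn hy p⟩

lemma exists_div_posMul_eq (c : E3) {q : P3} {l : ℤ} (hq : q ∈ Pol l) :
    ∃ p ∈ Pol l, div (posMul c p) = q := by
  obtain ⟨p, hp, rfl⟩ := exists_euler_eq three_pos c hq
  exact ⟨p, hp, div_posMul c p⟩

/-- The tangential divergence kills the rotation and is injective on the Koszul part, so the two
summands are independent on the plane. -/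
lemma ev_eq_zero_of_rotTan_add_posMul {n c : E3} (hn : ‖n‖ = 1) {r p : P3}
    (h : ∀ y ∈ plane n c, ∀ i, ev y ((rotTan n r + posMul c p) i) = 0) {y : E3}
    (hy : y ∈ plane n c) : ev y p = 0 := by
  refine ev_eq_zero_of_divTan_posMul hn (fun y hy => ?_) hy
  have h1 := ev_divTan_eq_zero hn h hy
  have h2 : divTan n (rotTan n r + posMul c p) = divTan n (rotTan n r) + divTan n (posMul c p) :=
    (divTanL n).map_add _ _
  rwa [h2, divTan_rotTan, zero_add] at h1

/-- Decomposition of a tangential vector polynomial into a rotated gradient and a Koszul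
complement. -/
lemma exists_rotTan_add_posMul {n : E3} (hn : ‖n‖ = 1) (c : E3) {v : V3} {l : ℤ}
    (hv : v ∈ VPolTan n l) : ∃ r ∈ Pol (l + 1), ∃ p ∈ Pol (l - 1),
      ∀ x ∈ plane n c, ∀ i, ev x (v i) = ev x ((rotTan n r + posMul c p) i) := by
  choose u hu huv using fun i => exists_euler_eq one_pos c (mem_VPol.1 hv.1 i)
  have hu' : u ∈ VPol l := mem_VPol.2 hu
  -- The Euler operator commutes with the scalar product by a constant vector, so its injectivity
  -- carries the tangency of v over to u.
  have hun : u ⬝ᵥ cst n = 0 := by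
    refine euler_injective one_pos c ?_
    rw [map_zero, ← hv.2]
    simp only [dotProduct_three, ← huv, map_add, cst_apply, euler_eq, pderiv_mul',
      MvPolynomial.pderiv_C]
    ring
  refine ⟨u ⬝ᵥ (pos c ⨯₃ cst n), ?_, divTan n u, divTan_mem hu', fun x hx i => ?_⟩
  · rw [triple_product_permutation, ← cross_anticomm, dotProduct_neg]
    exact neg_mem (dotProduct_pos_mem (cross_cst_mem hu' n) c)
  · rw [← huv, euler_field_eq hn hx hun, Pi.add_apply, map_add]

/-- The tangential part of a vector field. -/
noncomputable def tang (n : E3) (v : V3) : V3 := v - (v ⬝ᵥ cst n) • cst n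

lemma tang_mem {n : E3} (hn : ‖n‖ = 1) {v : V3} {l : ℤ} (hv : v ∈ VPol l) :
    tang n v ∈ VPolTan n l := by
  refine ⟨sub_mem hv (mem_VPol.2 fun i => ?_), ?_⟩
  · rw [Pi.smul_apply, smul_eq_mul, mul_comm]
    exact C_mul_mem (dotProduct_cst_mem hv n) _
  · have : cst n ⬝ᵥ cst n = 1 := by
      rw [dotProduct_three]
      simp only [cst_apply, ← map_mul, ← map_add, sq_sum_eq_one hn, map_one]
    rw [tang, sub_dotProduct, smul_dotProduct, this, smul_eq_mul, mul_one, sub_self]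

lemma ev_tang {n x : E3} {v : V3} (h : ev x (v ⬝ᵥ cst n) = 0) (i : Fin 3) :
    ev x (tang n v i) = ev x (v i) := by
  rw [tang, Pi.sub_apply, Pi.smul_apply, smul_eq_mul, map_sub, map_mul, h, zero_mul, sub_zero]

lemma ev_posMul_dotProduct {n c x : E3} (hx : x ∈ plane n c) (p : P3) :
    ev x (posMul c p ⬝ᵥ cst n) = 0 := by
  rw [mem_plane] at hx
  simp only [dotProduct_three, posMul_apply, cst_apply, map_add, map_mul, ev_pos, ev_C]
  linear_combination ev x p * hx

/-- Primitives of polynomials on a line. -/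
lemma exists_dirDeriv_eq (a : E3) {t : E3} (ht : ‖t‖ = 1) {q : P3} {l : ℤ} (hq : q ∈ Pol l) :
    ∃ r ∈ Pol (l + 1), ∀ s : ℝ, ev (a + s • t) (dirDeriv t r) = ev (a + s • t) q := by
  obtain ⟨u, hu, rfl⟩ := exists_euler_eq one_pos a hq
  -- If r = ((x - a)·t) u, then at x = a + s t its derivative along t is u + s ∂_t u, which is the
  -- Euler operator applied to u.
  refine ⟨u * (pos a ⬝ᵥ cst t), ?_, fun s => ?_⟩
  · rw [dotProduct, Finset.mul_sum]
    refine Submodule.sum_mem _ fun i _ => ?_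
    rw [mul_comm (pos a i), mul_left_comm, mul_comm u]
    exact C_mul_mem (pos_mul_mem hu _ _) _
  · have h := sq_sum_eq_one ht
    simp only [dirDeriv, euler_eq, dotProduct_three, grad_apply, cst_apply, pderiv_mul', map_add,
      map_mul, MvPolynomial.pderiv_C, pderiv_pos_self, ev_C, ev_pos, map_one, map_natCast,
      map_zero, PiLp.add_apply, PiLp.smul_apply, smul_eq_mul,
      pderiv_pos_of_ne a (show (0 : Fin 3) ≠ 1 by decide),
      pderiv_pos_of_ne a (show (0 : Fin 3) ≠ 2 by decide),
      pderiv_pos_of_ne a (show (1 : Fin 3) ≠ 0 by decide),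
      pderiv_pos_of_ne a (show (1 : Fin 3) ≠ 2 by decide),
      pderiv_pos_of_ne a (show (2 : Fin 3) ≠ 0 by decide),
      pderiv_pos_of_ne a (show (2 : Fin 3) ≠ 1 by decide)]
    push_cast
    generalize ev (a + s • t) (MvPolynomial.pderiv 0 u) = g0
    generalize ev (a + s • t) (MvPolynomial.pderiv 1 u) = g1
    generalize ev (a + s • t) (MvPolynomial.pderiv 2 u) = g2
    linear_combination (ev (a + s • t) u + s * (t 0 * g0 + t 1 * g1 + t 2 * g2)) * h

lemma dirDeriv_mul (t : E3) (p q : P3) :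
    dirDeriv t (p * q) = dirDeriv t p * q + p * dirDeriv t q := by
  simp only [dirDeriv, dotProduct_three, grad_apply, pderiv_mul']
  ring

lemma dirDeriv_C (t : E3) (a : ℝ) : dirDeriv t (MvPolynomial.C a) = 0 := by
  simp [dirDeriv, dotProduct_three]

/-! ## Integration on an edge -/

lemma tangent_unit {a b : E3} (h : a ≠ b) : ‖‖b - a‖⁻¹ • (b - a)‖ = 1 := by
  rw [norm_smul, norm_inv, norm_norm, inv_mul_cancel₀ (norm_ne_zero_iff.2 (sub_ne_zero.2 h.symm))]

lemma lineMap_length {a b : E3} (h : a ≠ b) : lineMap a b ‖b - a‖ = b := by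
  rw [lineMap, smul_smul, mul_inv_cancel₀ (norm_ne_zero_iff.2 (sub_ne_zero.2 h.symm)), one_smul,
    add_sub_cancel]

lemma integral_dirDeriv {a b : E3} (h : a ≠ b) (p : P3) :
    ∫ x : openSegment ℝ a b, ev x (dirDeriv (‖b - a‖⁻¹ • (b - a)) p)
        ∂((μHE[1] : Measure E3).comap (Subtype.val : openSegment ℝ a b → E3))
      = ev b p - ev a p := by
  rw [integral_openSegment h fun x => ev x (dirDeriv (‖b - a‖⁻¹ • (b - a)) p)]
  set t := ‖b - a‖⁻¹ • (b - a) with ht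
  have h1 : ∀ s, ev (lineMap a b s) (dirDeriv t p)
      = (Polynomial.derivative (line a t p)).eval s := fun s => by
    rw [derivative_line, eval_line]
    rfl
  simp only [h1]
  rw [intervalIntegral.integral_eq_sub_of_hasDerivAt
    (fun s _ => (line a t p).hasDerivAt s)
    ((Polynomial.continuous _).intervalIntegrable _ _), eval_line, eval_line, zero_smul, add_zero]
  congr 2
  exact congrArg ev (lineMap_length h)

lemma ip_restr (d : ℕ) (P : Set E3) (p q : P3) : ip d (restr P p) (restr P q) =
    ∫ x : P, ev x (p * q) ∂((μHE[d] : Measure E3).comap (Subtype.val : P → E3)) := by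
  unfold ip
  simp only [restr_apply, map_mul]
  exact integral_congr_ae (Filter.Eventually.of_forall fun x => by simp [mul_comm])

lemma ip_dirDeriv {a b : E3} (h : a ≠ b) (p q : P3) :
    ip 1 (restr (openSegment ℝ a b) (dirDeriv (‖b - a‖⁻¹ • (b - a)) p))
        (restr (openSegment ℝ a b) q)
      = - ip 1 (restr (openSegment ℝ a b) p)
          (restr (openSegment ℝ a b) (dirDeriv (‖b - a‖⁻¹ • (b - a)) q))
        + ev b p * ev b q - ev a p * ev a q := by
  have h1 := integral_dirDeriv h (p * q)
  have hg := good_openSegment h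
  rw [dirDeriv_mul] at h1
  simp only [map_add] at h1
  have h2 := integral_add (hg.integrable (restr_mem_BC hg.bounded
      (dirDeriv (‖b - a‖⁻¹ • (b - a)) p * q)))
    (hg.integrable (restr_mem_BC hg.bounded (p * dirDeriv (‖b - a‖⁻¹ • (b - a)) q)))
  simp only [restr_apply] at h2
  rw [h2, ← ip_restr, ← ip_restr, map_mul, map_mul] at h1
  linarith

lemma real_inner_eq_mul (x y : ℝ) : inner ℝ x y = x * y := by
  simp [mul_comm]

/-- Existence of the edge trace. -/
lemma exists_edge_trace {a b : E3} (h : a ≠ b) (k : ℕ)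
    (q : PolyOn ((k : ℤ) - 1) (openSegment ℝ a b)) (α β : ℝ) :
    ∃ p ∈ Pol ((k : ℤ) + 1), ev a p = α ∧ ev b p = β ∧
      ∀ r ∈ Pol ((k : ℤ) - 1), ip 1 (restr (openSegment ℝ a b) p) (restr (openSegment ℝ a b) r)
        = ip 1 (q : openSegment ℝ a b → ℝ) (restr (openSegment ℝ a b) r) := by
  obtain ⟨q', -, hq'⟩ := q.2
  rw [← hq']
  clear hq' q
  set P := openSegment ℝ a b with hP
  have hg : Good 1 P := good_openSegment h
  have hn : 0 < ‖b - a‖ := norm_pos_iff.2 (sub_ne_zero.2 h.symm)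
  -- `s` is the affine coordinate
  let s : P3 := MvPolynomial.C (‖b - a‖⁻¹ * ‖b - a‖⁻¹) * (pos a ⬝ᵥ cst (b - a))
  have hs : ∀ θ : ℝ, ev (a + θ • (b - a)) s = θ := fun θ => by
    have h1 : inner ℝ (b - a) (b - a) = ‖b - a‖ ^ 2 := real_inner_self_eq_norm_sq _
    rw [inner_three] at h1
    simp only [s, dotProduct_three, cst_apply, map_add, map_mul, ev_C, ev_pos, PiLp.add_apply,
      PiLp.smul_apply, smul_eq_mul]
    field_simp
    rw [← h1]
    ring
  have hsm : ∀ {l : ℤ} {p : P3}, p ∈ Pol l → s * p ∈ Pol (l + 1) := fun {l p} hp => by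
    rw [mul_assoc, dotProduct, Finset.sum_mul]
    refine C_mul_mem (Submodule.sum_mem _ fun i _ => ?_) _
    rw [cst_apply, mul_comm (pos a i), mul_assoc]
    exact C_mul_mem (pos_mul_mem hp _ _) _
  have hsa : ev a s = 0 := by simpa using hs 0
  have hsb : ev b s = 1 := by simpa using hs 1
  -- The affine interpolant of the endpoint values; the correction s(1 - s)h does not disturb them.
  let ℓ : P3 := MvPolynomial.C α + s * MvPolynomial.C (β - α)
  have hℓ : ℓ ∈ Pol ((k : ℤ) + 1) :=
    add_mem (C_mem (by positivity) _) (Pol_mono (by linarith) (hsm (C_mem le_rfl _)))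
  -- unknown: `ℓ + s (1 - s) h`
  let W : Submodule ℝ (P → ℝ) := PolyOn ((k : ℤ) - 1) P
  let w : P → ℝ := restr P (s * (1 - s))
  have hw : w ∈ BC P ℝ := restr_mem_BC hg.bounded _
  have hmulBC : ∀ f ∈ W, w * f ∈ BC P ℝ := by
    rintro _ ⟨p, _, rfl⟩
    convert restr_mem_BC hg.bounded (s * (1 - s) * p) using 1
    funext x
    simp [w, restr_apply]
  have hmul : ∀ f g : W, ip 1 (w * (f : P → ℝ)) (g : P → ℝ)
      = ∫ x, w x * ((f : P → ℝ) x * (g : P → ℝ) x)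
        ∂((μHE[1] : Measure E3).comap (Subtype.val : P → E3)) := fun f g =>
    integral_congr_ae (Filter.Eventually.of_forall fun x =>
      (real_inner_eq_mul _ _).trans (mul_assoc _ _ _))
  -- The weight s(1 - s) is positive on the open edge, so this form is definite and h of degree at
  -- most k - 1 can be fitted to the moments.
  let Bf : W →ₗ[ℝ] W →ₗ[ℝ] ℝ := LinearMap.mk₂ ℝ (fun f g => ip 1 (w * (f : P → ℝ)) (g : P → ℝ))
    (fun f g e => by
      change ip 1 (w * ((f : P → ℝ) + (g : P → ℝ))) _ = _
      rw [mul_add]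
      exact hg.ip_add_left (hmulBC _ f.2) (hmulBC _ g.2) (hg.PolyOn_le _ e.2))
    (fun c f e => by
      change ip 1 (w * (c • (f : P → ℝ))) _ = _
      rw [mul_smul_comm]
      exact ip_smul_left _ _ _)
    (fun f g e => hg.ip_add_right (hmulBC _ f.2) (hg.PolyOn_le _ g.2) (hg.PolyOn_le _ e.2))
    (fun c f e => ip_smul_right _ _ _)
  let l : W →ₗ[ℝ] ℝ :=
    { toFun := fun f => ip 1 (restr P (q' - ℓ)) f
      map_add' := fun f g => hg.ip_add_right (restr_mem_BC hg.bounded _)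
        (hg.PolyOn_le _ f.2) (hg.PolyOn_le _ g.2)
      map_smul' := fun c f => ip_smul_right _ _ _ }
  obtain ⟨⟨_, p, hp, rfl⟩, hp'⟩ := exists_rep_of_definite Bf (fun f hf => by
    have hpos : ∀ x : P, 0 < w x := by
      rintro ⟨x, hx⟩
      rw [hP, openSegment_eq_image'] at hx
      obtain ⟨θ, ⟨h0, h1⟩, rfl⟩ := hx
      change 0 < ev (a + θ • (b - a)) (s * (1 - s))
      rw [map_mul, map_sub, map_one, hs]
      exact mul_pos h0 (by linarith)
    have hf' : ∫ x, w x * ((f : P → ℝ) x * (f : P → ℝ) x)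
        ∂((μHE[1] : Measure E3).comap (Subtype.val : P → E3)) = 0 := by
      rw [← hmul]
      exact hf
    have := hg.eq_zero_of_integral (f := fun x => w x * ((f : P → ℝ) x * (f : P → ℝ) x)) (by
        convert inner_mem_BC (hmulBC _ f.2) (hg.PolyOn_le _ f.2) using 1
        funext x
        exact ((real_inner_eq_mul _ _).trans (mul_assoc _ _ _)).symm)
      (fun x => mul_nonneg (hpos x).le (mul_self_nonneg _)) hf'
    refine Subtype.ext (funext fun x => ?_)
    rcases mul_eq_zero.1 (congrFun this x) with h1 | h1
    · exact absurd h1 (hpos x).ne'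
    · exact mul_self_eq_zero.1 h1) l
  refine ⟨ℓ + s * (1 - s) * p, add_mem hℓ ?_, ?_, ?_, fun r hr => ?_⟩
  · have h1 := hsm (hsm hp)
    have h2 := hsm hp
    rw [show s * (1 - s) * p = s * p - s * (s * p) by ring]
    refine sub_mem (Pol_mono (by linarith) h2) (Pol_mono (by linarith) h1)
  · simp [ℓ, hsa]
  · simp [ℓ, hsb]
  · have h1 : ip 1 (w * restr P p) (restr P r) = ip 1 (restr P (q' - ℓ)) (restr P r) :=
      hp' ⟨_, r, hr, rfl⟩
    have h2 : w * restr P p = restr P (s * (1 - s) * p) := by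
      funext x
      simp [w, restr_apply]
    rw [h2, map_sub, hg.ip_sub_left (restr_mem_BC hg.bounded _) (restr_mem_BC hg.bounded _)
      (restr_mem_BC hg.bounded _)] at h1
    rw [map_add, hg.ip_add_left (restr_mem_BC hg.bounded _) (restr_mem_BC hg.bounded _)
      (restr_mem_BC hg.bounded _), h1]
    ring


/-! ## Jumps of piecewise constant functions -/

/-- Induction on the number of jumps: cancelling one jump beyond its abscissa leaves a function with
the remaining ones. Without jumps, a locally constant function on an interval is constant. -/
lemma sum_jumps {ι : Type*} (S : Finset ι) (θ J : ι → ℝ) {a b : ℝ} (hab : a ≤ b)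
    (hinj : Set.InjOn θ S) (hθ : ∀ i ∈ S, a < θ i ∧ θ i < b) (χ : ℝ → ℝ)
    (hloc : ∀ x ∈ Set.Icc a b, (∀ i ∈ S, x ≠ θ i) → ∀ᶠ y in 𝓝 x, χ y = χ x)
    (hj : ∀ i ∈ S, ∃ c, (∀ᶠ y in 𝓝[<] θ i, χ y = c) ∧ ∀ᶠ y in 𝓝[>] θ i, χ y = c + J i) :
    ∑ i ∈ S, J i = χ b - χ a := by
  classical
  induction S using Finset.induction_on generalizing χ with
  | empty =>
    have hd : ∀ x ∈ Set.Icc a b, HasDerivAt χ 0 x := fun x hx =>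
      (hasDerivAt_const x (χ x)).congr_of_eventuallyEq (hloc x hx (by simp))
    have := constant_of_has_deriv_right_zero (f := χ) (a := a) (b := b)
      (fun x hx => (hd x hx).continuousAt.continuousWithinAt)
      (fun x hx => (hd x ⟨hx.1, hx.2.le⟩).hasDerivWithinAt) b ⟨hab, le_rfl⟩
    simp [this]
  | insert i S hi ih =>
    obtain ⟨c, hl, hr⟩ := hj i (Finset.mem_insert_self i S)
    -- The value c at the abscissa itself makes the new function locally constant there, whatever χ
    -- was at that point.
    let χ' : ℝ → ℝ := fun y => if y < θ i then χ y else if y = θ i then c else χ y - J i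
    have hlt : ∀ y, y < θ i → χ' y = χ y := fun y hy => if_pos hy
    have hgt : ∀ y, θ i < y → χ' y = χ y - J i := fun y hy => by
      simp only [χ', if_neg hy.not_gt, if_neg hy.ne']
    have hi' := hθ i (Finset.mem_insert_self i S)
    have hS : ∀ j ∈ S, θ j ≠ θ i := fun j hj h => hi <| by
      rw [← hinj (Finset.mem_insert_of_mem hj) (Finset.mem_insert_self i S) h]
      exact hj
    rw [Finset.sum_insert hi, ih (hinj.mono (by simp))
      (fun j hj => hθ j (Finset.mem_insert_of_mem hj)) χ' ?_ ?_, hlt a hi'.1, hgt b hi'.2]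
    · ring
    · intro x hx hxS
      rcases lt_trichotomy x (θ i) with h | h | h
      · filter_upwards [hloc x hx (by
          simp only [Finset.mem_insert, forall_eq_or_imp]; exact ⟨h.ne, hxS⟩),
          eventually_lt_nhds h] with y h1 h2
        rw [hlt y h2, hlt x h, h1]
      · have hx' : χ' x = c := by simp [χ', h]
        rw [hx', h, ← nhdsLT_sup_nhdsGE, ← Set.Ioi_insert, nhdsWithin_insert,
          Filter.eventually_sup, Filter.eventually_sup]
        refine ⟨?_, ?_, ?_⟩
        · filter_upwards [hl, self_mem_nhdsWithin] with y h1 h2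
          rw [hlt y h2, h1]
        · rw [← h]
          simpa using hx'
        · filter_upwards [hr, self_mem_nhdsWithin] with y h1 h2
          rw [hgt y h2, h1]
          ring
      · filter_upwards [hloc x hx (by
          simp only [Finset.mem_insert, forall_eq_or_imp]; exact ⟨h.ne', hxS⟩),
          eventually_gt_nhds h] with y h1 h2
        rw [hgt y h2, hgt x h, h1]
    · intro j hjS
      obtain ⟨d, hd1, hd2⟩ := hj j (Finset.mem_insert_of_mem hjS)
      rcases lt_or_gt_of_ne (hS j hjS) with h | h
      · refine ⟨d, ?_, ?_⟩
        · filter_upwards [hd1, nhdsWithin_le_nhds (eventually_lt_nhds h)] with y h1 h2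
          rw [hlt y h2, h1]
        · filter_upwards [hd2, nhdsWithin_le_nhds (eventually_lt_nhds h)] with y h1 h2
          rw [hlt y h2, h1]
      · refine ⟨d - J i, ?_, ?_⟩
        · filter_upwards [hd1, nhdsWithin_le_nhds (eventually_gt_nhds h)] with y h1 h2
          rw [hgt y h2, h1]
        · filter_upwards [hd2, nhdsWithin_le_nhds (eventually_gt_nhds h)] with y h1 h2
          rw [hgt y h2, h1]
          ring

/-! ## One-sidedness along flat pieces of the boundary -/

/-- Each open half of B ∩ W is convex and contains no boundary point of S, so by connectedness it
lies in S or misses its closure. Both halves in S would put x in S by regularity; both outside would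
contradict that x is a limit of points of S. -/
lemma one_sided {W S U : Set E3} (hU : IsOpen U) (hS : S = U ∩ W) (hW : Convex ℝ W) {x n : E3}
    {B : Set E3} (hBo : IsOpen B) (hBc : Convex ℝ B) (hx : x ∈ B) (hxS : x ∈ closure S)
    (hfr : ∀ y ∈ B, y ∈ W → (y ∈ closure S \ S ↔ inner ℝ n (y - x) = 0))
    (hreg : B ∩ W ⊆ closure S → B ∩ W ⊆ S) (hxW : x ∈ W) :
    (∀ y ∈ B, y ∈ W → (y ∈ S ↔ 0 < inner ℝ n (y - x))) ∨
      (∀ y ∈ B, y ∈ W → (y ∈ S ↔ inner ℝ n (y - x) < 0)) := by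
  have key : ∀ σ : ℝ, (∀ y ∈ B, y ∈ W → 0 < σ * inner ℝ n (y - x) → y ∈ S) ∨
      (∀ y ∈ B, y ∈ W → 0 < σ * inner ℝ n (y - x) → y ∉ closure S) := by
    intro σ
    have hconv : Convex ℝ {y : E3 | 0 < σ * inner ℝ n (y - x)} := by
      have : {y : E3 | 0 < σ * inner ℝ n (y - x)} = {y : E3 | σ * inner ℝ n x <
          (σ • innerSL ℝ n : E3 →L[ℝ] ℝ) y} := by
        ext y
        simp [inner_sub_right, mul_sub]
      rw [this]
      exact convex_halfSpace_gt ((σ • innerSL ℝ n : E3 →L[ℝ] ℝ).toLinearMap.isLinear) _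
    have hpre := ((hBc.inter hW).inter hconv).isPreconnected
    have hmem : ∀ y ∈ (B ∩ W) ∩ {y : E3 | 0 < σ * inner ℝ n (y - x)}, y ∈ closure S → y ∈ S := by
      rintro y ⟨⟨hyB, hyW⟩, hy⟩ hyc
      by_contra hyS
      have := (hfr y hyB hyW).1 ⟨hyc, hyS⟩
      rw [Set.mem_ofPred_eq, this, mul_zero] at hy
      exact lt_irrefl _ hy
    have hcov : (B ∩ W) ∩ {y : E3 | 0 < σ * inner ℝ n (y - x)} ⊆ U ∪ (closure S)ᶜ := by
      intro y hy
      by_cases hyc : y ∈ closure S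
      · left
        have := hmem y hy hyc
        rw [hS] at this
        exact this.1
      · exact Or.inr hyc
    have hdis : (B ∩ W) ∩ {y : E3 | 0 < σ * inner ℝ n (y - x)} ∩ (U ∩ (closure S)ᶜ) = ∅ := by
      ext y
      simp only [Set.mem_inter_iff, Set.mem_compl_iff, Set.mem_empty_iff_false, iff_false]
      rintro ⟨⟨⟨-, hyW⟩, -⟩, hyU, hyc⟩
      exact hyc (subset_closure (by rw [hS]; exact ⟨hyU, hyW⟩))
    rcases isPreconnected_iff_subset_of_disjoint.1 hpre U (closure S)ᶜ hU
        isClosed_closure.isOpen_compl hcov hdis with h | h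
    · left
      intro y hyB hyW hy
      rw [hS]
      exact ⟨h ⟨⟨hyB, hyW⟩, hy⟩, hyW⟩
    · right
      intro y hyB hyW hy
      exact h ⟨⟨hyB, hyW⟩, hy⟩
  have hzero : ∀ y ∈ B, y ∈ W → y ∈ S → inner ℝ n (y - x) ≠ 0 := fun y hyB hyW hyS h =>
    ((hfr y hyB hyW).2 h).2 hyS
  rcases key 1 with h1 | h1 <;> rcases key (-1) with h2 | h2
  · exfalso
    have h3 : B ∩ W ⊆ closure S := by
      rintro y ⟨hyB, hyW⟩
      rcases lt_trichotomy (inner ℝ n (y - x)) 0 with h | h | h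
      · exact subset_closure (h2 y hyB hyW (by linarith))
      · exact ((hfr y hyB hyW).2 h).1
      · exact subset_closure (h1 y hyB hyW (by linarith))
    exact hzero x hx hxW (hreg h3 ⟨hx, hxW⟩) (by simp)
  · left
    intro y hyB hyW
    refine ⟨fun hyS => ?_, fun h => h1 y hyB hyW (by linarith)⟩
    rcases lt_or_gt_of_ne (hzero y hyB hyW hyS) with h | h
    · exact absurd (subset_closure hyS) (h2 y hyB hyW (by linarith))
    · exact h
  · right
    intro y hyB hyW
    refine ⟨fun hyS => ?_, fun h => h2 y hyB hyW (by linarith)⟩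
    rcases lt_or_gt_of_ne (hzero y hyB hyW hyS) with h | h
    · exact h
    · exact absurd (subset_closure hyS) (h1 y hyB hyW (by linarith))
  · exfalso
    obtain ⟨y, hyB, hyS⟩ := mem_closure_iff.1 hxS B hBo hx
    have hyW : y ∈ W := by
      rw [hS] at hyS
      exact hyS.2
    rcases lt_or_gt_of_ne (hzero y hyB hyW hyS) with h | h
    · exact absurd (subset_closure hyS) (h2 y hyB hyW (by linarith))
    · exact absurd (subset_closure hyS) (h1 y hyB hyW (by linarith))

open Classical in
/-- The side on which `S` lies does not change along the connected piece `A` of its boundary. -/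
lemma exists_side {A W S : Set E3} {n : E3} (hA : IsPreconnected A) (hn : ‖n‖ = 1)
    (hAn : ∀ x ∈ A, ∀ y ∈ A, inner ℝ n (y - x) = 0) (hWn : ∀ x ∈ A, ∀ ε : ℝ, x - ε • n ∈ W)
    (hloc : ∀ x ∈ A, ∃ δ > 0,
      (∀ y ∈ Metric.ball x δ, y ∈ W → (y ∈ S ↔ 0 < inner ℝ n (y - x))) ∨
      (∀ y ∈ Metric.ball x δ, y ∈ W → (y ∈ S ↔ inner ℝ n (y - x) < 0)))
    {ω : ℝ} (hω : ω = if ∀ x ∈ A, ∀ᶠ ε : ℝ in 𝓝[>] 0, x - ε • n ∈ S then 1 else -1) :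
    ∀ x ∈ A, ∃ δ > 0, ∀ y ∈ Metric.ball x δ, y ∈ W → (y ∈ S ↔ 0 < -ω * inner ℝ n (y - x)) := by
  -- Pointwise form of the condition defining ω. Being locally constant on the connected set A, it
  -- holds everywhere or nowhere, so a single sign describes all of A.
  let Q : E3 → Prop := fun x => ∀ᶠ ε : ℝ in 𝓝[>] 0, x - ε • n ∈ S
  have hnn : inner ℝ n n = 1 := by rw [real_inner_self_eq_norm_sq, hn, one_pow]
  have hball : ∀ x : E3, ∀ δ > 0, ∀ᶠ ε : ℝ in 𝓝[>] 0, x - ε • n ∈ Metric.ball x δ := by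
    intro x δ hδ
    filter_upwards [Ioo_mem_nhdsGT hδ] with ε hε
    rw [Metric.mem_ball, dist_eq_norm, sub_sub_cancel_left, norm_neg, norm_smul, hn, mul_one,
      Real.norm_of_nonneg hε.1.le]
    exact hε.2
  have hneg : ∀ x ∈ A, ∀ δ > 0,
      (∀ y ∈ Metric.ball x δ, y ∈ W → (y ∈ S ↔ inner ℝ n (y - x) < 0)) → Q x := by
    intro x hx δ hδ h
    filter_upwards [hball x δ hδ, self_mem_nhdsWithin] with ε h1 h2
    rw [h _ h1 (hWn x hx ε), sub_sub_cancel_left, inner_neg_right, inner_smul_right, hnn]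
    simpa using h2
  have hpos : ∀ x ∈ A, ∀ δ > 0,
      (∀ y ∈ Metric.ball x δ, y ∈ W → (y ∈ S ↔ 0 < inner ℝ n (y - x))) → ¬ Q x := by
    intro x hx δ hδ h hQ
    obtain ⟨ε, ⟨h1, h2⟩, h3⟩ := ((hQ.and (hball x δ hδ)).and self_mem_nhdsWithin).exists
    rw [h _ h2 (hWn x hx ε), sub_sub_cancel_left, inner_neg_right, inner_smul_right, hnn] at h1
    have : 0 < ε := h3
    linarith
  have hsub : ∀ x ∈ A, ∀ δ, ∀ y ∈ A, y ∈ Metric.ball x δ →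
      ∃ δ' > 0, Metric.ball y δ' ⊆ Metric.ball x δ ∧
        ∀ z, inner ℝ n (z - y) = inner ℝ n (z - x) := by
    intro x hx δ y hy hyb
    obtain ⟨δ', h1, h2⟩ := Metric.isOpen_iff.1 Metric.isOpen_ball y hyb
    refine ⟨δ', h1, h2, fun z => ?_⟩
    have := hAn x hx y hy
    rw [← sub_add_sub_cancel z y x, inner_add_right, this, add_zero]
  have hconst : ∀ x ∈ A, ∀ y ∈ A, Q x → Q y := by
    intro x hx y hy
    refine (hA.induction₂ (fun x y => Q x ↔ Q y) (fun x hx => ?_)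
      (fun _ _ _ _ _ _ h1 h2 => h1.trans h2) (fun _ _ _ _ h => h.symm) hx hy).1
    obtain ⟨δ, hδ, h⟩ := hloc x hx
    filter_upwards [nhdsWithin_le_nhds (Metric.ball_mem_nhds x hδ), self_mem_nhdsWithin]
      with y hyb hyA
    obtain ⟨δ', hδ', h1, h2⟩ := hsub x hx δ y hyA hyb
    rcases h with h | h
    · have hx' := hpos x hx δ hδ h
      have hy' := hpos y hyA δ' hδ' fun z hz hzW => by rw [h2]; exact h z (h1 hz) hzW
      tauto
    · have hx' := hneg x hx δ hδ h
      have hy' := hneg y hyA δ' hδ' fun z hz hzW => by rw [h2]; exact h z (h1 hz) hzW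
      tauto
  intro x hx
  obtain ⟨δ, hδ, h⟩ := hloc x hx
  refine ⟨δ, hδ, fun y hyb hyW => ?_⟩
  split_ifs at hω with hall
  · rcases h with h | h
    · exact absurd (hall x hx) (hpos x hx δ hδ h)
    · rw [h y hyb hyW, hω]
      constructor <;> intro <;> linarith
  · simp only [not_forall] at hall
    obtain ⟨z, hz, hzQ⟩ := hall
    rcases h with h | h
    · rw [h y hyb hyW, hω]
      constructor <;> intro <;> linarith
    · exact absurd (hconst x hx z hz (hneg x hx δ hδ h)) hzQ


/-! ## Orthonormal frames -/

/-- The cross product of two vectors of `E3`. -/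
noncomputable def cr (a b : E3) : E3 := WithLp.toLp 2 ((a : Fin 3 → ℝ) ⨯₃ (b : Fin 3 → ℝ))

lemma cr_zero (a b : E3) : cr a b 0 = a 1 * b 2 - a 2 * b 1 := by simp [cr, cross_apply]
lemma cr_one (a b : E3) : cr a b 1 = a 2 * b 0 - a 0 * b 2 := by simp [cr, cross_apply]
lemma cr_two (a b : E3) : cr a b 2 = a 0 * b 1 - a 1 * b 0 := by simp [cr, cross_apply]

lemma E3_ext {a b : E3} (h0 : a 0 = b 0) (h1 : a 1 = b 1) (h2 : a 2 = b 2) : a = b := by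
  refine PiLp.ext fun i => ?_
  fin_cases i
  exacts [h0, h1, h2]

lemma inner_cr_left (a b : E3) : inner ℝ a (cr a b) = 0 := by
  rw [inner_three, cr_zero, cr_one, cr_two]
  ring

lemma inner_cr_right (a b : E3) : inner ℝ b (cr a b) = 0 := by
  rw [inner_three, cr_zero, cr_one, cr_two]
  ring

lemma inner_cr_self {n t : E3} (hn : ‖n‖ = 1) (ht : ‖t‖ = 1) (hnt : inner ℝ n t = 0) :
    inner ℝ (cr n t) (cr n t) = 1 := by
  have h1 := sq_sum_eq_one hn
  have h2 := sq_sum_eq_one ht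
  rw [inner_three] at hnt
  rw [inner_three, cr_zero, cr_one, cr_two]
  linear_combination (t 0 * t 0 + t 1 * t 1 + t 2 * t 2) * h1 + h2
    - (n 0 * t 0 + n 1 * t 1 + n 2 * t 2) * hnt

lemma cr_cr {n t : E3} (ht : ‖t‖ = 1) (hnt : inner ℝ n t = 0) : cr t (cr n t) = n := by
  have h2 := sq_sum_eq_one ht
  rw [inner_three] at hnt
  refine E3_ext ?_ ?_ ?_ <;> simp only [cr_zero, cr_one, cr_two]
  · linear_combination n 0 * h2 - t 0 * hnt
  · linear_combination n 1 * h2 - t 1 * hnt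
  · linear_combination n 2 * h2 - t 2 * hnt

lemma frame_decomp {n t : E3} (hn : ‖n‖ = 1) (ht : ‖t‖ = 1) (hnt : inner ℝ n t = 0) (z : E3) :
    z = inner ℝ t z • t + inner ℝ (cr n t) z • cr n t + inner ℝ n z • n := by
  set m := cr n t with hm
  have h1 := sq_sum_eq_one hn
  have h2 := sq_sum_eq_one ht
  have h3 := inner_cr_self hn ht hnt
  have h4 := inner_cr_left n t
  have h5 := inner_cr_right n t
  rw [← hm, inner_three] at h3 h4 h5
  rw [inner_three] at hnt
  let A : Matrix (Fin 3) (Fin 3) ℝ := !![t 0, t 1, t 2; m 0, m 1, m 2; n 0, n 1, n 2]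
  have hA : A * Aᵀ = 1 := by
    ext i j
    fin_cases i <;> fin_cases j <;>
      simp [A, Matrix.mul_apply, Fin.sum_univ_three] <;> linarith
  -- The rows t, m, n are orthonormal, hence so are the columns, and their relations give the
  -- expansion of z.
  have hA' : Aᵀ * A = 1 := mul_eq_one_comm.1 hA
  have hij : ∀ i j, t i * t j + m i * m j + n i * n j = (1 : Matrix (Fin 3) (Fin 3) ℝ) i j := by
    intro i j
    rw [← hA']
    fin_cases i <;> fin_cases j <;> simp [A, Matrix.mul_apply, Fin.sum_univ_three]
  have hz : ∀ i, z i = (t 0 * z 0 + t 1 * z 1 + t 2 * z 2) * t i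
      + (m 0 * z 0 + m 1 * z 1 + m 2 * z 2) * m i + (n 0 * z 0 + n 1 * z 1 + n 2 * z 2) * n i := by
    intro i
    have h6 : ∑ j, (1 : Matrix (Fin 3) (Fin 3) ℝ) i j * z j = z i := by
      simp [Matrix.one_apply]
    rw [Fin.sum_univ_three, ← hij, ← hij, ← hij] at h6
    linear_combination -h6
  refine PiLp.ext fun i => ?_
  simp only [PiLp.add_apply, PiLp.smul_apply, smul_eq_mul, inner_three]
  exact hz i

/-! ### Local geometry of the mesh: elements along faces, faces along edges. -/

namespace PolyhedralMesh

variable {Ω : Set E3} {𝒯 ℱ ℰ 𝒱 : Type*} [Fintype 𝒯] [Fintype ℱ] [Fintype ℰ] [Fintype 𝒱]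
variable (M : PolyhedralMesh Ω 𝒯 ℱ ℰ 𝒱)

/-- The plane of a face. -/
def planeF (F : ℱ) : Set E3 := plane (M.normal F) (M.centerF F)

variable {M}

lemma mem_facesOf {T : 𝒯} {F : ℱ} : F ∈ M.facesOf T ↔ M.face F ⊆ frontier (M.elem T) := by
  simp [facesOf]

lemma mem_edgesOf {F : ℱ} {E : ℰ} :
    E ∈ M.edgesOf F ↔ M.edge E ⊆ closure (M.face F) \ M.face F := by
  simp [edgesOf]

variable (M)

lemma face_eq (F : ℱ) : ∃ U, IsOpen U ∧ M.centerF F ∈ U ∧ M.face F = U ∩ M.planeF F := by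
  obtain ⟨U, hU, h⟩ := M.face_open F
  have := M.centerF_mem F
  rw [h] at this
  exact ⟨U, hU, this.1, h⟩

lemma isClosed_planeF (F : ℱ) : IsClosed (M.planeF F) :=
  isClosed_eq (by fun_prop) continuous_const

lemma closure_face_subset (F : ℱ) : closure (M.face F) ⊆ M.planeF F :=
  (M.isClosed_planeF F).closure_subset_iff.2 (M.face_planar F)

lemma src_ne_tgt (E : ℰ) : M.vert (M.src E) ≠ M.vert (M.tgt E) :=
  fun h => M.edge_nondegenerate E (M.vert_injective h)

lemma norm_tangent (E : ℰ) : ‖M.tangent E‖ = 1 := tangent_unit (M.src_ne_tgt E)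

lemma starIn_face (F : ℱ) : StarIn (M.face F) (M.planeF F) (M.centerF F) := by
  obtain ⟨U, hU, hc, h⟩ := M.face_eq F
  rw [h]
  exact starIn_plane hU hc

lemma good_elem (T : 𝒯) : Good 3 (M.elem T) := good_of_isOpen (M.elem_open T) (M.elem_bounded T)

lemma good_face (F : ℱ) : Good 2 (M.face F) := by
  obtain ⟨U, hU, -, h⟩ := M.face_eq F
  have hb := M.face_bounded F
  rw [h] at hb ⊢
  exact good_of_plane (M.normal_norm F) hU hb

lemma good_edge (E : ℰ) : Good 1 (M.edge E) := good_openSegment (M.src_ne_tgt E)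

lemma edge_eq (E : ℰ) : M.edge E = lineMap (M.vert (M.src E)) (M.vert (M.tgt E)) ''
    Set.Ioo 0 ‖M.vert (M.tgt E) - M.vert (M.src E)‖ := openSegment_eq_lineMap (M.src_ne_tgt E)

lemma lineMap_eq (E : ℰ) (s : ℝ) : lineMap (M.vert (M.src E)) (M.vert (M.tgt E)) s
    = M.vert (M.src E) + s • M.tangent E := rfl

lemma segment_cases {E : ℰ} {x : E3}
    (hx : x ∈ segment ℝ (M.vert (M.src E)) (M.vert (M.tgt E))) :
    x ∈ M.edge E ∨ ∃ V, x = M.vert V := by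
  rw [← insert_endpoints_openSegment] at hx
  rcases hx with h | h | h
  exacts [Or.inr ⟨_, h⟩, Or.inr ⟨_, h⟩, Or.inl h]

lemma segment_subset_of_mem {F : ℱ} {E : ℰ} (h : E ∈ M.edgesOf F) :
    segment ℝ (M.vert (M.src E)) (M.vert (M.tgt E)) ⊆ closure (M.face F) \ M.face F := by
  rw [M.face_frontier F]
  exact Set.subset_biUnion_of_mem (u := fun E => segment ℝ (M.vert (M.src E)) (M.vert (M.tgt E)))
    (mem_edgesOf.1 h)

lemma edge_subset_segment (E : ℰ) :
    M.edge E ⊆ segment ℝ (M.vert (M.src E)) (M.vert (M.tgt E)) := openSegment_subset_segment _ _ _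

lemma exists_segment_of_mem {F : ℱ} {x : E3} (hx : x ∈ closure (M.face F) \ M.face F) :
    ∃ E ∈ M.edgesOf F, x ∈ segment ℝ (M.vert (M.src E)) (M.vert (M.tgt E)) := by
  rw [M.face_frontier F] at hx
  simp only [Set.mem_iUnion] at hx
  obtain ⟨E, hE, hx⟩ := hx
  exact ⟨E, mem_edgesOf.2 hE, hx⟩

lemma segment_subset_planeF {F : ℱ} {E : ℰ} (h : E ∈ M.edgesOf F) :
    segment ℝ (M.vert (M.src E)) (M.vert (M.tgt E)) ⊆ M.planeF F := fun _ hx =>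
  M.closure_face_subset F (M.segment_subset_of_mem h hx).1

lemma src_mem_planeF {F : ℱ} {E : ℰ} (h : E ∈ M.edgesOf F) : M.vert (M.src E) ∈ M.planeF F :=
  M.segment_subset_planeF h (left_mem_segment _ _ _)

lemma tgt_mem_planeF {F : ℱ} {E : ℰ} (h : E ∈ M.edgesOf F) : M.vert (M.tgt E) ∈ M.planeF F :=
  M.segment_subset_planeF h (right_mem_segment _ _ _)

lemma edge_subset_planeF {F : ℱ} {E : ℰ} (h : E ∈ M.edgesOf F) : M.edge E ⊆ M.planeF F :=
  (M.edge_subset_segment E).trans (M.segment_subset_planeF h)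

lemma inner_normal_of_mem {F : ℱ} {x y : E3} (hx : x ∈ M.planeF F) (hy : y ∈ M.planeF F) :
    inner ℝ (M.normal F) (y - x) = 0 := by
  have hx : inner ℝ (M.normal F) (x - M.centerF F) = 0 := hx
  have hy : inner ℝ (M.normal F) (y - M.centerF F) = 0 := hy
  rw [← sub_sub_sub_cancel_right y x (M.centerF F), inner_sub_right, hx, hy, sub_zero]

lemma mem_planeF_of_inner {F : ℱ} {x y : E3} (hx : x ∈ M.planeF F)
    (h : inner ℝ (M.normal F) (y - x) = 0) : y ∈ M.planeF F := by
  have hx : inner ℝ (M.normal F) (x - M.centerF F) = 0 := hx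
  change inner ℝ (M.normal F) (y - M.centerF F) = 0
  rw [← sub_add_sub_cancel y x (M.centerF F), inner_add_right, hx, h, zero_add]

lemma inner_normal_tangent {F : ℱ} {E : ℰ} (h : E ∈ M.edgesOf F) :
    inner ℝ (M.normal F) (M.tangent E) = 0 := by
  rw [tangent, inner_smul_right, M.inner_normal_of_mem (M.src_mem_planeF h) (M.tgt_mem_planeF h),
    mul_zero]

lemma normalFE_eq (F : ℱ) (E : ℰ) : M.normalFE F E = cr (M.normal F) (M.tangent E) := rfl

lemma norm_normalFE {F : ℱ} {E : ℰ} (h : E ∈ M.edgesOf F) : ‖M.normalFE F E‖ = 1 := by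
  have := inner_cr_self (M.normal_norm F) (M.norm_tangent E) (M.inner_normal_tangent h)
  rw [real_inner_self_eq_norm_sq] at this
  exact (pow_eq_one_iff_of_nonneg (norm_nonneg _) two_ne_zero).1 this

lemma sub_mem_of_segment {E : ℰ} {x y : E3}
    (hx : x ∈ segment ℝ (M.vert (M.src E)) (M.vert (M.tgt E)))
    (hy : y ∈ segment ℝ (M.vert (M.src E)) (M.vert (M.tgt E))) :
    ∃ s : ℝ, y - x = s • M.tangent E := by
  rw [segment_eq_image'] at hx hy
  obtain ⟨θ, -, rfl⟩ := hx
  obtain ⟨η, -, rfl⟩ := hy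
  refine ⟨(η - θ) * ‖M.vert (M.tgt E) - M.vert (M.src E)‖, ?_⟩
  rw [tangent, smul_smul, mul_assoc, mul_inv_cancel₀
    (norm_ne_zero_iff.2 (sub_ne_zero.2 (M.src_ne_tgt E).symm)), mul_one, sub_smul,
    add_sub_add_left_eq_sub]

/-- A point of F has a neighbourhood in which the boundary of T is just the plane of F, so
`one_sided` applies. -/
lemma elem_local {T : 𝒯} {F : ℱ} (h : F ∈ M.facesOf T) {x : E3} (hx : x ∈ M.face F) :
    ∃ δ > 0, (∀ y ∈ Metric.ball x δ, y ∈ Set.univ →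
        (y ∈ M.elem T ↔ 0 < inner ℝ (M.normal F) (y - x))) ∨
      (∀ y ∈ Metric.ball x δ, y ∈ Set.univ →
        (y ∈ M.elem T ↔ inner ℝ (M.normal F) (y - x) < 0)) := by
  obtain ⟨U, hU, -, hF⟩ := M.face_eq F
  -- The closures of the other faces add only edges and vertices to those faces, and all of these
  -- are disjoint from F.
  have hclosed : IsClosed (⋃ F' : {F' // F' ≠ F}, closure (M.face F')) :=
    isClosed_iUnion_of_finite fun _ => isClosed_closure
  have hxK : x ∉ ⋃ F' : {F' // F' ≠ F}, closure (M.face F') := by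
    rw [Set.mem_iUnion]
    rintro ⟨⟨F', hF'⟩, hx'⟩
    have hxF' : x ∉ M.face F' := Set.disjoint_left.1 (M.face_disjoint hF'.symm) hx
    obtain ⟨E, -, hE⟩ := M.exists_segment_of_mem ⟨hx', hxF'⟩
    rcases M.segment_cases hE with h1 | ⟨V, h1⟩
    · exact Set.disjoint_left.1 (M.face_edge_disjoint F E) hx h1
    · exact M.vert_notMem_face V F (h1 ▸ hx)
  have hxF := hx
  rw [hF] at hxF
  obtain ⟨δ, hδ, hb⟩ := Metric.isOpen_iff.1 (hU.inter hclosed.isOpen_compl) x ⟨hxF.1, hxK⟩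
  have hfront : frontier (M.elem T) = closure (M.elem T) \ M.elem T := by
    rw [frontier, (M.elem_open T).interior_eq]
  refine ⟨δ, hδ, one_sided (M.elem_open T) (Set.inter_univ _).symm convex_univ
    Metric.isOpen_ball (convex_ball x δ) (Metric.mem_ball_self hδ)
    (frontier_subset_closure (mem_facesOf.1 h hx)) (fun y hy _ => ?_) (fun hsub => ?_) trivial⟩
  · rw [← hfront]
    constructor
    · intro hyT
      rw [M.elem_frontier T] at hyT
      simp only [Set.mem_iUnion] at hyT
      obtain ⟨F', -, hyF'⟩ := hyT
      by_cases hFF : F' = F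
      · subst hFF
        exact M.inner_normal_of_mem hxF.2 (M.closure_face_subset F' hyF')
      · exact absurd (Set.mem_iUnion.2 ⟨⟨F', hFF⟩, hyF'⟩) (hb hy).2
    · intro hy0
      refine mem_facesOf.1 h ?_
      rw [hF]
      exact ⟨(hb hy).1, M.mem_planeF_of_inner hxF.2 hy0⟩
  · rw [Set.inter_univ] at hsub ⊢
    rw [← M.elem_regular T]
    exact interior_maximal hsub Metric.isOpen_ball

lemma face_local {F : ℱ} {E : ℰ} (h : E ∈ M.edgesOf F) {x : E3} (hx : x ∈ M.edge E) :
    ∃ δ > 0, (∀ y ∈ Metric.ball x δ, y ∈ M.planeF F →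
        (y ∈ M.face F ↔ 0 < inner ℝ (M.normalFE F E) (y - x))) ∨
      (∀ y ∈ Metric.ball x δ, y ∈ M.planeF F →
        (y ∈ M.face F ↔ inner ℝ (M.normalFE F E) (y - x) < 0)) := by
  obtain ⟨U, hU, -, hF⟩ := M.face_eq F
  have hclosed : IsClosed (⋃ E' : {E' // E' ≠ E},
      segment ℝ (M.vert (M.src E')) (M.vert (M.tgt E'))) :=
    isClosed_iUnion_of_finite fun E' => by
      rw [← closure_openSegment]
      exact isClosed_closure
  have hxK : x ∉ ⋃ E' : {E' // E' ≠ E}, segment ℝ (M.vert (M.src E')) (M.vert (M.tgt E')) := by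
    rw [Set.mem_iUnion]
    rintro ⟨⟨E', hE'⟩, hx'⟩
    rcases M.segment_cases hx' with h1 | ⟨V, h1⟩
    · exact Set.disjoint_left.1 (M.edge_disjoint hE'.symm) hx h1
    · exact M.vert_notMem_edge V E (h1 ▸ hx)
  obtain ⟨δ₁, hδ₁, hb⟩ := Metric.isOpen_iff.1 hclosed.isOpen_compl x hxK
  have hxs := M.edge_subset_segment E hx
  have hxp := M.segment_subset_planeF h hxs
  have hxe := hx
  rw [M.edge_eq] at hxe
  obtain ⟨s, ⟨hs0, hs1⟩, hsx⟩ := hxe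
  set L := ‖M.vert (M.tgt E) - M.vert (M.src E)‖ with hL
  -- The distances s and L - s to the two vertices bound the radius, so that points of the ball on
  -- the line of E belong to E.
  have hδ : 0 < min δ₁ (min s (L - s)) := lt_min hδ₁ (lt_min hs0 (by linarith))
  refine ⟨_, hδ, one_sided hU hF ?_ Metric.isOpen_ball (convex_ball x _) (Metric.mem_ball_self hδ)
    (M.segment_subset_of_mem h hxs).1 (fun y hy hyW => ?_) (fun hsub => ?_) hxp⟩
  · intro a ha b hb c d _ _ hcd
    refine M.mem_planeF_of_inner ha ?_
    have : c • a + d • b - a = d • (b - a) := by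
      rw [show c = 1 - d by linarith, sub_smul, smul_sub, one_smul]
      abel
    rw [this, inner_smul_right, M.inner_normal_of_mem ha hb, mul_zero]
  · constructor
    · intro hyF
      obtain ⟨E', hE', hyE'⟩ := M.exists_segment_of_mem hyF
      by_cases hEE : E' = E
      · subst hEE
        obtain ⟨s, hs⟩ := M.sub_mem_of_segment hxs hyE'
        rw [hs, inner_smul_right, normalFE_eq, real_inner_comm, inner_cr_right, mul_zero]
      · exact absurd (Set.mem_iUnion.2 ⟨⟨E', hEE⟩, hyE'⟩)
          (hb (Metric.ball_subset_ball (min_le_left _ _) hy))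
    · intro hy0
      have hdec := frame_decomp (M.normal_norm F) (M.norm_tangent E) (M.inner_normal_tangent h)
        (y - x)
      rw [← normalFE_eq, hy0, M.inner_normal_of_mem hxp hyW, zero_smul, zero_smul, add_zero,
        add_zero] at hdec
      set r := inner ℝ (M.tangent E) (y - x) with hr
      have hrn : |r| < min s (L - s) := by
        have h1 : |r| ≤ ‖M.tangent E‖ * ‖y - x‖ := abs_real_inner_le_norm _ _
        rw [M.norm_tangent, one_mul, ← dist_eq_norm] at h1
        exact h1.trans_lt (lt_of_lt_of_le hy (min_le_right _ _))
      have hr1 := lt_of_lt_of_le hrn (min_le_left _ _)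
      have hr2 := lt_of_lt_of_le hrn (min_le_right _ _)
      rw [abs_lt] at hr1 hr2
      refine mem_edgesOf.1 h ?_
      rw [M.edge_eq]
      refine ⟨s + r, ⟨by linarith, by linarith⟩, ?_⟩
      rw [lineMap_eq, add_smul, ← add_assoc, ← lineMap_eq, hsx, ← hdec, add_sub_cancel]
  · exact M.face_regular F _ Metric.isOpen_ball hsub

/-- Makes the sign usable locally: near a point of F the element is the half ball towards -ω_TF n_F.
-/
lemma elem_side {T : 𝒯} {F : ℱ} (h : F ∈ M.facesOf T) {x : E3} (hx : x ∈ M.face F) :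
    ∃ δ > 0, ∀ y ∈ Metric.ball x δ,
      (y ∈ M.elem T ↔ 0 < -M.ωTF T F * inner ℝ (M.normal F) (y - x)) := by
  have hp := M.face_planar F
  obtain ⟨δ, hδ, h⟩ := exists_side (M.face_connected F).isPreconnected (M.normal_norm F)
    (fun x hx y hy => M.inner_normal_of_mem (hp hx) (hp hy)) (fun _ _ _ => Set.mem_univ _)
    (fun x hx => M.elem_local h hx) (ω := M.ωTF T F) rfl x hx
  exact ⟨δ, hδ, fun y hy => h y hy trivial⟩

lemma face_side {F : ℱ} {E : ℰ} (h : E ∈ M.edgesOf F) {x : E3} (hx : x ∈ M.edge E) :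
    ∃ δ > 0, ∀ y ∈ Metric.ball x δ, y ∈ M.planeF F →
      (y ∈ M.face F ↔ 0 < -M.ωFE F E * inner ℝ (M.normalFE F E) (y - x)) := by
  refine exists_side (convex_openSegment _ _).isPreconnected (M.norm_normalFE h)
    (fun x hx y hy => ?_) (fun x hx ε => ?_) (fun x hx => M.face_local h hx) rfl x hx
  · obtain ⟨s, hs⟩ := M.sub_mem_of_segment (M.edge_subset_segment E hx)
      (M.edge_subset_segment E hy)
    rw [hs, inner_smul_right, normalFE_eq, real_inner_comm, inner_cr_right, mul_zero]
  · refine M.mem_planeF_of_inner (M.edge_subset_planeF h hx) ?_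
    rw [sub_sub_cancel_left, inner_neg_right, inner_smul_right, normalFE_eq, inner_cr_left,
      mul_zero, neg_zero]

lemma ωTF_mul_self (T : 𝒯) (F : ℱ) : M.ωTF T F * M.ωTF T F = 1 := by
  unfold ωTF
  split_ifs <;> norm_num

lemma ωFE_mul_self (F : ℱ) (E : ℰ) : M.ωFE F E * M.ωFE F E = 1 := by
  unfold ωFE
  split_ifs <;> norm_num

end PolyhedralMesh


/-! ### Cancellation of orientations around an edge. -/

lemma exists_angle {c s : ℝ} (h : c * c + s * s = 1) :
    ∃ φ ∈ Set.Ioc (-Real.pi) Real.pi, Real.cos φ = c ∧ Real.sin φ = s := by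
  have hn : ‖(⟨c, s⟩ : ℂ)‖ = 1 := by
    rw [← pow_eq_one_iff_of_nonneg (norm_nonneg _) two_ne_zero, ← Complex.normSq_eq_norm_sq,
      Complex.normSq_mk, h]
  refine ⟨Complex.arg ⟨c, s⟩, Complex.arg_mem_Ioc _, ?_, ?_⟩
  · have := Complex.norm_mul_cos_arg ⟨c, s⟩
    rwa [hn, one_mul] at this
  · have := Complex.norm_mul_sin_arg ⟨c, s⟩
    rwa [hn, one_mul] at this

/-- Finitely many angles, chosen in an interval of length `2π` with an endpoint different from all
of them. -/
lemma exists_angles {ι : Type*} (S : Finset ι) (c s : ι → ℝ)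
    (h : ∀ i ∈ S, c i * c i + s i * s i = 1) :
    ∃ a : ℝ, ∃ θ : ι → ℝ, ∀ i ∈ S, a < θ i ∧ θ i < a + 2 * Real.pi ∧
      Real.cos (θ i) = c i ∧ Real.sin (θ i) = s i := by
  have h1 : ∀ i, ∃ φ, i ∈ S → φ ∈ Set.Ioc (-Real.pi) Real.pi ∧ Real.cos φ = c i ∧
      Real.sin φ = s i := fun i => by
    by_cases hi : i ∈ S
    · obtain ⟨φ, h1, h2⟩ := exists_angle (h i hi)
      exact ⟨φ, fun _ => ⟨h1, h2⟩⟩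
    · exact ⟨0, fun h => absurd h hi⟩
  choose φ hφ using h1
  obtain ⟨a, ⟨ha1, ha2⟩, ha3⟩ := ((Set.Ioo_infinite (show -Real.pi < Real.pi by
    linarith [Real.pi_pos])).sdiff (S.finite_toSet.image φ)).nonempty
  refine ⟨a, fun i => if a < φ i then φ i else φ i + 2 * Real.pi, fun i hi => ?_⟩
  obtain ⟨⟨h1, h2⟩, h3, h4⟩ := hφ i hi
  have hne : φ i ≠ a := fun h => ha3 ⟨i, hi, h⟩
  dsimp only
  split_ifs with hlt
  · exact ⟨hlt, by linarith, h3, h4⟩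
  · have : φ i < a := lt_of_le_of_ne (not_lt.1 hlt) hne
    exact ⟨by linarith, by linarith, by rw [Real.cos_add_two_pi, h3],
      by rw [Real.sin_add_two_pi, h4]⟩

namespace PolyhedralMesh

variable {Ω : Set E3} {𝒯 ℱ ℰ 𝒱 : Type*} [Fintype 𝒯] [Fintype ℱ] [Fintype ℰ] [Fintype 𝒱]
variable (M : PolyhedralMesh Ω 𝒯 ℱ ℰ 𝒱)

/-- Local structure of the boundary of an element near a point of an edge. -/
lemma exists_ball_edge (T : 𝒯) {E : ℰ} {x : E3} (hx : x ∈ M.edge E) : ∃ δ > 0,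
    ∀ y ∈ Metric.ball x δ, ∀ F ∈ M.facesOf T,
      (E ∉ M.edgesOf F → y ∉ closure (M.face F)) ∧
      (E ∈ M.edgesOf F → (y ∈ M.planeF F →
        (y ∈ M.face F ↔ 0 < -M.ωFE F E * inner ℝ (M.normalFE F E) (y - x))) ∧
        (y ∈ closure (M.face F) → 0 ≤ -M.ωFE F E * inner ℝ (M.normalFE F E) (y - x))) := by
  suffices h : ∀ F ∈ M.facesOf T, ∀ᶠ y in 𝓝 x,
      (E ∉ M.edgesOf F → y ∉ closure (M.face F)) ∧
      (E ∈ M.edgesOf F → (y ∈ M.planeF F →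
        (y ∈ M.face F ↔ 0 < -M.ωFE F E * inner ℝ (M.normalFE F E) (y - x))) ∧
        (y ∈ closure (M.face F) → 0 ≤ -M.ωFE F E * inner ℝ (M.normalFE F E) (y - x))) by
    exact Metric.eventually_nhds_iff_ball.1 ((Filter.eventually_all_finset _).2 h)
  intro F _
  by_cases hE : E ∈ M.edgesOf F
  · obtain ⟨δ, hδ, h⟩ := M.face_side hE hx
    filter_upwards [Metric.ball_mem_nhds x hδ] with y hy
    refine ⟨fun h => absurd hE h, fun _ => ⟨h y hy, fun hyc => ?_⟩⟩
    -- Otherwise an open neighbourhood of y on the wrong side of E would meet the face.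
    by_contra hlt
    have hopen : IsOpen (Metric.ball x δ ∩
        {z | -M.ωFE F E * inner ℝ (M.normalFE F E) (z - x) < 0}) :=
      Metric.isOpen_ball.inter (isOpen_lt (by fun_prop) continuous_const)
    obtain ⟨z, ⟨hz1, hz2⟩, hz3⟩ := mem_closure_iff.1 hyc _ hopen ⟨hy, not_le.1 hlt⟩
    have := (h z hz1 (M.face_planar F hz3)).1 hz3
    exact lt_asymm this hz2
  · have hxc : x ∉ closure (M.face F) := by
      intro hxc
      have hxF : x ∉ M.face F := fun h => Set.disjoint_left.1 (M.face_edge_disjoint F E) h hx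
      obtain ⟨E', hE', hxE'⟩ := M.exists_segment_of_mem ⟨hxc, hxF⟩
      rcases M.segment_cases hxE' with h1 | ⟨V, h1⟩
      · by_cases hEE : E' = E
        · exact hE (hEE ▸ hE')
        · exact Set.disjoint_left.1 (M.edge_disjoint hEE) h1 hx
      · exact M.vert_notMem_edge V E (h1 ▸ hx)
    filter_upwards [isClosed_closure.isOpen_compl.mem_nhds hxc] with y hy
    exact ⟨fun _ => hy, fun h => absurd h hE⟩

/-- The boundary of the boundary of an element vanishes. -/
lemma sum_ωTF_mul_ωFE (T : 𝒯) (E : ℰ) [DecidablePred fun F => E ∈ M.edgesOf F] :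
    ∑ F ∈ M.facesOf T with E ∈ M.edgesOf F, M.ωTF T F * M.ωFE F E = 0 := by
  classical
  set S := (M.facesOf T).filter (fun F => E ∈ M.edgesOf F) with hS
  rcases S.eq_empty_or_nonempty with h0 | ⟨F₀, hF₀⟩
  · rw [h0, Finset.sum_empty]
  have hmem : ∀ {F}, F ∈ S → F ∈ M.facesOf T ∧ E ∈ M.edgesOf F := fun h => Finset.mem_filter.1 h
  set t := M.tangent E with ht
  have ht1 : ‖t‖ = 1 := M.norm_tangent E
  have htt : inner ℝ t t = 1 := by rw [real_inner_self_eq_norm_sq, ht1, one_pow]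
  set e₁ := M.normalFE F₀ E with he₁
  set e₂ := M.normal F₀ with he₂
  have h2n : ‖e₂‖ = 1 := M.normal_norm F₀
  have h2t : inner ℝ e₂ t = 0 := M.inner_normal_tangent (hmem hF₀).2
  have h11 : inner ℝ e₁ e₁ = 1 := inner_cr_self h2n ht1 h2t
  have h22 : inner ℝ e₂ e₂ = 1 := by rw [real_inner_self_eq_norm_sq, h2n, one_pow]
  have h12 : inner ℝ e₁ e₂ = 0 := by rw [real_inner_comm]; exact inner_cr_left _ _
  have h21 : inner ℝ e₂ e₁ = 0 := inner_cr_left _ _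
  have ht1' : inner ℝ t e₁ = 0 := inner_cr_right _ _
  have ht2' : inner ℝ t e₂ = 0 := by rw [real_inner_comm]; exact h2t
  have hcr1 : cr t e₁ = e₂ := cr_cr ht1 h2t
  have hcr2 : cr t e₂ = -e₁ := by
    rw [he₁, normalFE_eq]
    exact E3_ext (by simp [cr_zero]; ring) (by simp [cr_one]; ring) (by simp [cr_two]; ring)
  -- the point and the circle
  obtain ⟨x, hx⟩ : (M.edge E).Nonempty := ⟨midpoint ℝ (M.vert (M.src E)) (M.vert (M.tgt E)),
    midpoint_mem_openSegment _ _⟩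
  obtain ⟨δ, hδ, hball⟩ := M.exists_ball_edge T hx
  -- Unit directions orthogonal to the edge. The radius δ/2 keeps the circle in the ball where faces
  -- containing E are half planes and the other faces of T are absent.
  let u : ℝ → E3 := fun θ => Real.cos θ • e₁ + Real.sin θ • e₂
  let y : ℝ → E3 := fun θ => x + (δ / 2) • u θ
  have hucont : Continuous u := by fun_prop
  have hycont : Continuous y := by fun_prop
  have huu : ∀ θ η, inner ℝ (u θ) (u η) = Real.cos (η - θ) := fun θ η => by
    simp only [u, inner_add_left, inner_add_right, inner_smul_left, inner_smul_right, h11, h22,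
      h12, h21, Real.cos_sub]
    simp
  have htu : ∀ θ, inner ℝ t (u θ) = 0 := fun θ => by
    simp only [u, inner_add_right, inner_smul_right, ht1', ht2']
    ring
  have hun : ∀ θ, ‖u θ‖ = 1 := fun θ => by
    have := huu θ θ
    rw [sub_self, Real.cos_zero, real_inner_self_eq_norm_sq] at this
    exact (pow_eq_one_iff_of_nonneg (norm_nonneg _) two_ne_zero).1 this
  have hyx : ∀ θ, y θ - x = (δ / 2) • u θ := fun θ => by simp only [y, add_sub_cancel_left]
  have hyb : ∀ θ, y θ ∈ Metric.ball x δ := fun θ => by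
    rw [Metric.mem_ball, dist_eq_norm, hyx, norm_smul, hun, mul_one, Real.norm_of_nonneg (by linarith)]
    linarith
  -- The direction, in the plane of F and orthogonal to E, that points into F.
  let uF : ℱ → E3 := fun F => (-M.ωFE F E) • M.normalFE F E
  have hxF : ∀ {F}, F ∈ S → x ∈ M.planeF F := fun h => M.edge_subset_planeF (hmem h).2 hx
  have hnt : ∀ {F}, F ∈ S → inner ℝ (M.normal F) t = 0 := fun h =>
    M.inner_normal_tangent (hmem h).2
  have hmm : ∀ {F}, F ∈ S → inner ℝ (M.normalFE F E) (M.normalFE F E) = 1 := fun {F} h =>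
    inner_cr_self (M.normal_norm F) ht1 (hnt h)
  have huF : ∀ {F}, F ∈ S → inner ℝ (uF F) (uF F) = 1 := fun {F} h => by
    simp only [uF, inner_smul_left, inner_smul_right, hmm h]
    simpa using M.ωFE_mul_self F E
  -- the circle meets the boundary of the element in the points of directions `uF`
  have hA : ∀ F ∈ S, ∀ θ, u θ = uF F → y θ ∈ M.face F := by
    intro F hF θ hθ
    have h1 := ((hball (y θ) (hyb θ) F (hmem hF).1).2 (hmem hF).2).1
    have h2 : y θ ∈ M.planeF F := M.mem_planeF_of_inner (hxF hF) (by
      rw [hyx, hθ, inner_smul_right, inner_smul_right, normalFE_eq, inner_cr_left]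
      ring)
    rw [h1 h2, hyx, hθ, inner_smul_right, inner_smul_right, hmm hF]
    have := M.ωFE_mul_self F E
    nlinarith
  have hB : ∀ F ∈ S, ∀ θ, y θ ∈ closure (M.face F) → u θ = uF F := by
    intro F hF θ hθ
    have h1 := ((hball (y θ) (hyb θ) F (hmem hF).1).2 (hmem hF).2).2 hθ
    have h2 : inner ℝ (M.normal F) (u θ) = 0 := by
      have := M.inner_normal_of_mem (hxF hF) (M.closure_face_subset F hθ)
      rw [hyx, inner_smul_right] at this
      exact (mul_eq_zero.1 this).resolve_left (by linarith)
    have h3 := frame_decomp (M.normal_norm F) ht1 (hnt hF) (u θ)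
    rw [← normalFE_eq, htu, h2, zero_smul, zero_smul, zero_add, add_zero] at h3
    rw [hyx, inner_smul_right] at h1
    set c := inner ℝ (M.normalFE F E) (u θ) with hc
    have h4 := huu θ θ
    rw [sub_self, Real.cos_zero, h3, inner_smul_left, inner_smul_right, hmm hF] at h4
    simp only [conj_trivial, mul_one] at h4
    have h5 := M.ωFE_mul_self F E
    have h6 : 0 ≤ -M.ωFE F E * c := by
      have : -M.ωFE F E * (δ / 2 * c) = (δ / 2) * (-M.ωFE F E * c) := by ring
      rw [this] at h1
      exact nonneg_of_mul_nonneg_right h1 (by linarith)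
    have h7 : (-M.ωFE F E * c) * (-M.ωFE F E * c) = 1 := by
      linear_combination h4 + c * c * h5
    have h8 : -M.ωFE F E * c = 1 := by nlinarith
    have h9 : c = -M.ωFE F E := by linear_combination -M.ωFE F E * h8 - c * h5
    rw [h3, h9]
  have hC : ∀ θ, (∀ F ∈ S, u θ ≠ uF F) → y θ ∉ frontier (M.elem T) := by
    intro θ hθ h
    rw [M.elem_frontier T] at h
    simp only [Set.mem_iUnion] at h
    obtain ⟨F, hF, hyF⟩ := h
    have hF' : F ∈ M.facesOf T := mem_facesOf.2 hF
    by_cases hE : E ∈ M.edgesOf F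
    · have hFS : F ∈ S := Finset.mem_filter.2 ⟨hF', hE⟩
      exact hθ F hFS (hB F hFS θ hyF)
    · exact (hball (y θ) (hyb θ) F hF').1 hE hyF
  -- angles
  have hdec : ∀ F ∈ S, uF F = inner ℝ e₁ (uF F) • e₁ + inner ℝ e₂ (uF F) • e₂ := fun F hF => by
    have h1 := frame_decomp h2n ht1 h2t (uF F)
    have h2 : inner ℝ t (uF F) = 0 := by
      rw [inner_smul_right, normalFE_eq, inner_cr_right, mul_zero]
    rwa [h2, zero_smul, zero_add] at h1
  obtain ⟨a, θ, hθ⟩ := exists_angles S (fun F => inner ℝ e₁ (uF F)) (fun F => inner ℝ e₂ (uF F))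
    (fun F hF => by
      have h1 := huF hF
      rw [hdec F hF] at h1
      simp only [inner_add_left, inner_add_right, inner_smul_left, inner_smul_right, h11, h22,
        h12, h21, conj_trivial] at h1
      linarith)
  have hθu : ∀ F ∈ S, u (θ F) = uF F := fun F hF => by
    rw [hdec F hF, ← (hθ F hF).2.2.1, ← (hθ F hF).2.2.2]
  -- Since θ_F is interior to the window of length 2π, equality of directions forces equality of
  -- angles even at the endpoints.
  have huniq : ∀ η ∈ Set.Icc a (a + 2 * Real.pi), ∀ F ∈ S, u η = u (θ F) → η = θ F := by
    intro η hη F hF h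
    have h1 := huu η (θ F)
    rw [h, huu, sub_self, Real.cos_zero] at h1
    have h2 := (Real.cos_eq_one_iff_of_lt_of_lt (by linarith [hη.2, (hθ F hF).1])
      (by linarith [hη.1, (hθ F hF).2.1])).1 h1.symm
    linarith
  -- The sum of the jumps of this indicator function over one turn is zero by periodicity.
  let χ : ℝ → ℝ := fun η => if y η ∈ M.elem T then 1 else 0
  have hper : χ (a + 2 * Real.pi) = χ a := by
    simp only [χ, y, u, Real.cos_add_two_pi, Real.sin_add_two_pi]
  rw [sum_jumps S θ (fun F => M.ωTF T F * M.ωFE F E) (a := a) (b := a + 2 * Real.pi)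
    (by linarith [Real.pi_pos]) ?_ (fun F hF => ⟨(hθ F hF).1, (hθ F hF).2.1⟩) χ ?_ ?_, hper,
    sub_self]
  · intro F hF F' hF' h
    by_contra hne
    have h1 := hA F hF _ (hθu F hF)
    have h2 := hA F' hF' _ (hθu F' hF')
    rw [h] at h1
    exact Set.disjoint_left.1 (M.face_disjoint hne) h1 h2
  · intro η hη hne
    have h1 := hC η fun F hF h => hne F hF (huniq η hη F hF (h.trans (hθu F hF).symm))
    by_cases hT : y η ∈ M.elem T
    · filter_upwards [hycont.continuousAt.eventually_mem ((M.elem_open T).mem_nhds hT)] with z hz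
      simp only [χ, hT, hz]
    · have hT' : y η ∉ closure (M.elem T) := fun h => h1 (by
        rw [frontier, (M.elem_open T).interior_eq]
        exact ⟨h, hT⟩)
      filter_upwards [hycont.continuousAt.eventually_mem
        (isClosed_closure.isOpen_compl.mem_nhds hT')] with z hz
      have hz' : y z ∉ M.elem T := fun h => hz (subset_closure h)
      simp only [χ, hT, hz']
  · intro F hF
    obtain ⟨δ', hδ', hside⟩ := M.elem_side (hmem hF).1 (hA F hF _ (hθu F hF))
    set J := M.ωTF T F * M.ωFE F E with hJ
    have hJJ : J * J = 1 := by
      have h1 := M.ωTF_mul_self T F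
      have h2 := M.ωFE_mul_self F E
      rw [hJ]
      linear_combination M.ωFE F E * M.ωFE F E * h1 + h2
    -- At the angle of F the circle moves in the direction t × uF = -ω_FE n_F, while T lies towards
    -- -ω_TF n_F. So the circle enters T if ω_TF ω_FE = 1 and leaves it otherwise.
    have hn : M.normal F = (-M.ωFE F E) • (-Real.sin (θ F) • e₁ + Real.cos (θ F) • e₂) := by
      have h1 : cr t (uF F) = (-M.ωFE F E) • M.normal F := by
        have h0 := cr_cr ht1 (hnt hF)
        rw [← normalFE_eq] at h0
        conv_rhs => rw [← h0]
        refine E3_ext ?_ ?_ ?_ <;> simp [uF, cr_zero, cr_one, cr_two] <;> ring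
      have h2 : cr t (uF F) = -Real.sin (θ F) • e₁ + Real.cos (θ F) • e₂ := by
        have h3 : cr t (u (θ F)) = Real.cos (θ F) • cr t e₁ + Real.sin (θ F) • cr t e₂ := by
          refine E3_ext ?_ ?_ ?_ <;> simp [u, cr_zero, cr_one, cr_two] <;> ring
        rw [← hθu F hF, h3, hcr1, hcr2]
        module
      rw [← h2, h1, smul_smul, neg_mul_neg, M.ωFE_mul_self, one_smul]
    have hin : ∀ η, inner ℝ (M.normal F) (y η - y (θ F))
        = -M.ωFE F E * (δ / 2) * Real.sin (η - θ F) := by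
      intro η
      have h1 : y η - y (θ F) = (δ / 2) • (u η - u (θ F)) := by
        simp only [y, smul_sub]
        abel
      rw [h1, hn]
      simp only [u, inner_add_left, inner_add_right, inner_sub_right, inner_smul_left,
        inner_smul_right, h11, h22, h12, h21, conj_trivial, Real.sin_sub]
      ring
    have hev : ∀ᶠ η in 𝓝 (θ F), (y η ∈ M.elem T ↔ 0 < J * Real.sin (η - θ F)) := by
      filter_upwards [hycont.continuousAt.eventually_mem (Metric.ball_mem_nhds _ hδ')] with η hη
      rw [hside _ hη, hin]
      have : -M.ωTF T F * (-M.ωFE F E * (δ / 2) * Real.sin (η - θ F))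
          = (δ / 2) * (J * Real.sin (η - θ F)) := by rw [hJ]; ring
      rw [this]
      exact mul_pos_iff_of_pos_left (by linarith)
    have hgt : ∀ᶠ η in 𝓝[>] (θ F), 0 < Real.sin (η - θ F) := by
      filter_upwards [Ioo_mem_nhdsGT (show θ F < θ F + Real.pi by linarith [Real.pi_pos])]
        with η hη
      exact Real.sin_pos_of_pos_of_lt_pi (by linarith [hη.1]) (by linarith [hη.2])
    have hlt : ∀ᶠ η in 𝓝[<] (θ F), Real.sin (η - θ F) < 0 := by
      filter_upwards [Ioo_mem_nhdsLT (show θ F - Real.pi < θ F by linarith [Real.pi_pos])]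
        with η hη
      exact Real.sin_neg_of_neg_of_neg_pi_lt (by linarith [hη.2]) (by linarith [hη.1])
    have hJ' : J = 1 ∨ J = -1 := mul_self_eq_one_iff.1 hJJ
    rcases hJ' with hJ1 | hJ1
    · refine ⟨0, ?_, ?_⟩
      · filter_upwards [hlt, nhdsWithin_le_nhds hev] with η h1 h2
        rw [hJ1] at h2
        exact if_neg fun h => by linarith [h2.1 h]
      · filter_upwards [hgt, nhdsWithin_le_nhds hev] with η h1 h2
        rw [hJ1] at h2 ⊢
        rw [zero_add]
        exact if_pos (h2.2 (by linarith))
    · refine ⟨1, ?_, ?_⟩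
      · filter_upwards [hlt, nhdsWithin_le_nhds hev] with η h1 h2
        rw [hJ1] at h2
        exact if_pos (h2.2 (by linarith))
      · filter_upwards [hgt, nhdsWithin_le_nhds hev] with η h1 h2
        rw [hJ1] at h2 ⊢
        rw [add_neg_cancel]
        exact if_neg fun h => by linarith [h2.1 h]

/-- Exchanging the sums leaves, for each edge, the cancellation around that edge. -/
lemma sum_boundary_boundary (T : 𝒯) (f : ℰ → ℝ) :
    ∑ F ∈ M.facesOf T, M.ωTF T F * ∑ E ∈ M.edgesOf F, M.ωFE F E * f E = 0 := by
  classical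
  have h1 : ∀ F, M.ωTF T F * ∑ E ∈ M.edgesOf F, M.ωFE F E * f E
      = ∑ E, if E ∈ M.edgesOf F then M.ωTF T F * M.ωFE F E * f E else 0 := fun F => by
    rw [Finset.mul_sum, ← Finset.sum_filter]
    refine Finset.sum_congr (by ext; simp) fun E _ => by ring
  simp only [h1]
  rw [Finset.sum_comm]
  refine Finset.sum_eq_zero fun E _ => ?_
  rw [← Finset.sum_filter, ← Finset.sum_mul, M.sum_ωTF_mul_ωFE T E, zero_mul]

end PolyhedralMesh


/-! ## Linearity of the functionals -/

section isLinear

variable {V : Type*} [AddCommGroup V] [Module ℝ V]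

lemma isLin_add {L L' : V → ℝ} (h : IsLinearMap ℝ L) (h' : IsLinearMap ℝ L') :
    IsLinearMap ℝ fun v => L v + L' v := (h.mk' L + h'.mk' L').isLinear

lemma isLin_neg {L : V → ℝ} (h : IsLinearMap ℝ L) : IsLinearMap ℝ fun v => -L v :=
  (-h.mk' L).isLinear

lemma isLin_sub {L L' : V → ℝ} (h : IsLinearMap ℝ L) (h' : IsLinearMap ℝ L') :
    IsLinearMap ℝ fun v => L v - L' v := (h.mk' L - h'.mk' L').isLinear

lemma isLin_mul {L : V → ℝ} (h : IsLinearMap ℝ L) (c : ℝ) : IsLinearMap ℝ fun v => c * L v :=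
  (c • h.mk' L).isLinear

lemma isLin_comp {W : Type*} [AddCommGroup W] [Module ℝ W] {L : V → ℝ} (h : IsLinearMap ℝ L)
    (A : W →ₗ[ℝ] V) : IsLinearMap ℝ fun w => L (A w) := (h.mk' L ∘ₗ A).isLinear

lemma isLin_sum {ι : Type*} (s : Finset ι) {L : ι → V → ℝ} (h : ∀ i, IsLinearMap ℝ (L i)) :
    IsLinearMap ℝ fun v => ∑ i ∈ s, L i v := by
  convert (∑ i ∈ s, (h i).mk' (L i)).isLinear using 1
  funext v
  simp

variable {d : ℕ} {P : Set E3}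

lemma Good.isLin_restr (hP : Good d P) {f : P → ℝ} (hf : f ∈ BC P ℝ) :
    IsLinearMap ℝ fun r : P3 => ip d f (restr P r) where
  map_add r s := by
    rw [map_add]
    exact hP.ip_add_right hf (restr_mem_BC hP.bounded _) (restr_mem_BC hP.bounded _)
  map_smul c r := by
    rw [map_smul]
    exact ip_smul_right _ _ _

lemma Good.isLin_restrV (hP : Good d P) {f : P → E3} (hf : f ∈ BC P E3) :
    IsLinearMap ℝ fun r : V3 => ip d f (restrV P r) where
  map_add r s := by
    rw [map_add]
    exact hP.ip_add_right hf (restrV_mem_BC hP.bounded _) (restrV_mem_BC hP.bounded _)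
  map_smul c r := by
    rw [map_smul]
    exact ip_smul_right _ _ _

lemma Good.exists_rep' {H : Type*} [NormedAddCommGroup H] [InnerProductSpace ℝ H] (hP : Good d P)
    {S : Submodule ℝ (P → H)} [FiniteDimensional ℝ S]
    (hS : S ≤ BC P H) (T : Submodule ℝ V)
    (A : V →ₗ[ℝ] (P → H)) {L : V → ℝ} (h : IsLinearMap ℝ L) (hA : ∀ v ∈ T, A v ∈ S)
    (hL : ∀ v ∈ T, A v = 0 → L v = 0) : ∃ g : S, ∀ v ∈ T, ip d (g : P → H) (A v) = L v :=
  hP.exists_rep hS T A (h.mk' L) hA hL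

end isLinear

namespace PolyhedralMesh

variable {Ω : Set E3} {𝒯 ℱ ℰ 𝒱 : Type*} [Fintype 𝒯] [Fintype ℱ] [Fintype ℰ] [Fintype 𝒱]
variable (M : PolyhedralMesh Ω 𝒯 ℱ ℰ 𝒱)

lemma bcE {E : ℰ} {l : ℤ} (f : PolyOn l (M.edge E)) : (f : M.edge E → ℝ) ∈ BC (M.edge E) ℝ :=
  (M.good_edge E).PolyOn_le l f.2

lemma bcF {F : ℱ} {l : ℤ} (f : PolyOn l (M.face F)) : (f : M.face F → ℝ) ∈ BC (M.face F) ℝ :=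
  (M.good_face F).PolyOn_le l f.2

lemma bcT {T : 𝒯} {l : ℤ} (f : PolyOn l (M.elem T)) : (f : M.elem T → ℝ) ∈ BC (M.elem T) ℝ :=
  (M.good_elem T).PolyOn_le l f.2

lemma bcVF {F : ℱ} {S : Submodule ℝ V3} (f : VOn S (M.face F)) :
    (f : M.face F → E3) ∈ BC (M.face F) E3 := (M.good_face F).VOn_le S f.2

lemma bcVT {T : 𝒯} {S : Submodule ℝ V3} (f : VOn S (M.elem T)) :
    (f : M.elem T → E3) ∈ BC (M.elem T) E3 := (M.good_elem T).VOn_le S f.2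

/-! ## Vanishing on faces and edges -/

variable {M}

lemma ev_eq_zero_of_face {F : ℱ} {p : P3} (h : restr (M.face F) p = 0) {x : E3}
    (hx : x ∈ M.planeF F) : ev x p = 0 := (M.starIn_face F).ev_eq_zero h hx

lemma ev_eq_zero_of_faceV {F : ℱ} {v : V3} (h : restrV (M.face F) v = 0) {x : E3}
    (hx : x ∈ M.planeF F) (i : Fin 3) : ev x (v i) = 0 :=
  ev_eq_zero_of_face (restr_eq_zero.2 fun y hy => restrV_eq_zero.1 h y hy i) hx

lemma face_subset (M : PolyhedralMesh Ω 𝒯 ℱ ℰ 𝒱) (F : ℱ) : M.face F ⊆ M.planeF F := M.face_planar F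

lemma line_eq_zero_of_edge {E : ℰ} {p : P3} (h : restr (M.edge E) p = 0) :
    line (M.vert (M.src E)) (M.tangent E) p = 0 := by
  have hL : 0 < ‖M.vert (M.tgt E) - M.vert (M.src E)‖ :=
    norm_pos_iff.2 (sub_ne_zero.2 (M.src_ne_tgt E).symm)
  refine Polynomial.eq_zero_of_infinite_isRoot _ ((Set.Ioo_infinite hL).mono fun s hs => ?_)
  rw [Set.mem_ofPred_eq, Polynomial.IsRoot.def, eval_line]
  refine restr_eq_zero.1 h _ ?_
  rw [M.edge_eq]
  exact ⟨s, hs, rfl⟩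

lemma exists_of_mem_edge {E : ℰ} {x : E3} (hx : x ∈ M.edge E) :
    ∃ s : ℝ, x = M.vert (M.src E) + s • M.tangent E := by
  rw [M.edge_eq] at hx
  obtain ⟨s, -, rfl⟩ := hx
  exact ⟨s, rfl⟩

lemma restr_edge_of_line {E : ℰ} {p : P3} (h : line (M.vert (M.src E)) (M.tangent E) p = 0) :
    restr (M.edge E) p = 0 := by
  rw [restr_eq_zero]
  intro x hx
  obtain ⟨s, rfl⟩ := exists_of_mem_edge hx
  rw [← eval_line, h, Polynomial.eval_zero]

lemma tgt_eq (E : ℰ) : M.vert (M.tgt E) = M.vert (M.src E)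
    + ‖M.vert (M.tgt E) - M.vert (M.src E)‖ • M.tangent E :=
  (lineMap_length (M.src_ne_tgt E)).symm

lemma ev_src_of_edge {E : ℰ} {p : P3} (h : restr (M.edge E) p = 0) :
    ev (M.vert (M.src E)) p = 0 := by
  have := eval_line (M.vert (M.src E)) (M.tangent E) p 0
  rw [line_eq_zero_of_edge h, Polynomial.eval_zero] at this
  simpa using this.symm

lemma ev_tgt_of_edge {E : ℰ} {p : P3} (h : restr (M.edge E) p = 0) :
    ev (M.vert (M.tgt E)) p = 0 := by
  have := eval_line (M.vert (M.src E)) (M.tangent E) p ‖M.vert (M.tgt E) - M.vert (M.src E)‖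
  rw [line_eq_zero_of_edge h, Polynomial.eval_zero, ← tgt_eq] at this
  exact this.symm

lemma dirDeriv_of_edge {E : ℰ} {p : P3} (h : restr (M.edge E) p = 0) :
    restr (M.edge E) (dirDeriv (M.tangent E) p) = 0 := by
  apply restr_edge_of_line
  rw [← derivative_line, line_eq_zero_of_edge h, map_zero]

lemma exists_ev_eq_of_dirDeriv {E : ℰ} {p : P3}
    (h : restr (M.edge E) (dirDeriv (M.tangent E) p) = 0) :
    restr (M.edge E) (p - MvPolynomial.C (ev (M.vert (M.src E)) p)) = 0 := by
  have h1 := line_eq_zero_of_edge h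
  rw [← derivative_line] at h1
  have h2 := Polynomial.eq_C_of_derivative_eq_zero h1
  have h3 := eval_line (M.vert (M.src E)) (M.tangent E) p 0
  rw [h2, Polynomial.eval_C, zero_smul, add_zero] at h3
  apply restr_edge_of_line
  rw [map_sub, h2, ← h3]
  simp [line]

variable (M)

/-! ## The discrete gradient -/

lemma γE_spec (k : ℕ) (q : M.XgradE k) (E : ℰ) : ∃ p ∈ Pol ((k : ℤ) + 1),
    restr (M.edge E) p = M.γE k q E ∧ ev (M.vert (M.src E)) p = q.2 (M.src E) ∧
    ev (M.vert (M.tgt E)) p = q.2 (M.tgt E) ∧ ∀ r ∈ Pol ((k : ℤ) - 1),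
      ip 1 (M.γE k q E : M.edge E → ℝ) (restr (M.edge E) r)
        = ip 1 (q.1 E : M.edge E → ℝ) (restr (M.edge E) r) := by
  have hg := M.good_edge E
  have h : ∃ g : PolyOn ((k : ℤ) + 1) (M.edge E),
      (∃ p ∈ Pol ((k : ℤ) + 1), restr (M.edge E) p = g ∧
      MvPolynomial.eval (fun i => M.vert (M.src E) i) p = q.2 (M.src E) ∧
      MvPolynomial.eval (fun i => M.vert (M.tgt E) i) p = q.2 (M.tgt E)) ∧
      proj 1 (PolyOn ((k : ℤ) - 1) (M.edge E)) g = q.1 E := by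
    obtain ⟨p, hp, h1, h2, h3⟩ := exists_edge_trace (M.src_ne_tgt E) k (q.1 E) (q.2 (M.src E))
      (q.2 (M.tgt E))
    refine ⟨⟨restr (M.edge E) p, p, hp, rfl⟩, ⟨p, hp, rfl, ?_, ?_⟩, ?_⟩
    · rw [eval_eq_ev, h1]
    · rw [eval_eq_ev, h2]
    · refine hg.proj_eq (hg.PolyOn_le _) (restr_mem_BC hg.bounded _) _ ?_
      rintro _ ⟨r, hr, rfl⟩
      exact h3 r hr
  obtain ⟨⟨p, hp, h1, h2, h3⟩, h4⟩ := the_spec h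
  rw [eval_eq_ev] at h2 h3
  refine ⟨p, hp, h1, h2, h3, fun r hr => ?_⟩
  rw [← h4]
  exact (hg.ip_proj (hg.PolyOn_le _) (M.bcE _) ⟨r, hr, rfl⟩).symm

lemma gE_spec (k : ℕ) (q : M.XgradE k) (E : ℰ) {r : P3} (hr : r ∈ Pol k) :
    ip 1 (M.gE k q E : M.edge E → ℝ) (restr (M.edge E) r)
      = - ip 1 (q.1 E : M.edge E → ℝ) (restr (M.edge E) (dirDeriv (M.tangent E) r))
        + q.2 (M.tgt E) * ev (M.vert (M.tgt E)) r - q.2 (M.src E) * ev (M.vert (M.src E)) r := by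
  have hg := M.good_edge E
  have := the_spec (S := PolyOn k (M.edge E)) (p := fun g => ∀ r ∈ Pol k,
    ip 1 (g : M.edge E → ℝ) (restr (M.edge E) r)
      = - ip 1 (q.1 E : M.edge E → ℝ) (restr (M.edge E) (dirDeriv (M.tangent E) r))
        + q.2 (M.tgt E) * MvPolynomial.eval (fun i => M.vert (M.tgt E) i) r
        - q.2 (M.src E) * MvPolynomial.eval (fun i => M.vert (M.src E) i) r) ?_ r hr
  · rw [eval_eq_ev, eval_eq_ev] at this
    exact this
  · simp only [eval_eq_ev]
    refine hg.exists_rep' (hg.PolyOn_le _) (Pol k) (restr (M.edge E))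
      (isLin_sub (isLin_add (isLin_neg (isLin_comp (hg.isLin_restr (M.bcE _))
        (dirDerivL (M.tangent E)))) (isLin_mul (evL _).isLinear _))
        (isLin_mul (evL _).isLinear _)) (fun r hr => ⟨r, hr, rfl⟩) fun r _ h => ?_
    rw [dirDeriv_of_edge h, ev_src_of_edge h, ev_tgt_of_edge h]
    simp

/-- Derivatives of test functions of degree k have degree at most k - 1, and for these q_E and the
edge trace have the same moments. Integration by parts then identifies the edge gradient with the
derivative of the trace. -/
lemma gE_eq_dirDeriv (k : ℕ) (q : M.XgradE k) (E : ℰ) : ∃ p : P3,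
    restr (M.edge E) p = M.γE k q E ∧ ev (M.vert (M.src E)) p = q.2 (M.src E) ∧
    ev (M.vert (M.tgt E)) p = q.2 (M.tgt E) ∧
    (M.gE k q E : M.edge E → ℝ) = restr (M.edge E) (dirDeriv (M.tangent E) p) := by
  have hg := M.good_edge E
  obtain ⟨p, hp, h1, h2, h3, h4⟩ := M.γE_spec k q E
  refine ⟨p, h1, h2, h3, ?_⟩
  have hm := dirDeriv_mem (t := M.tangent E) hp
  rw [add_sub_cancel_right] at hm
  refine hg.ext (hg.PolyOn_le k) (M.gE k q E).2 ⟨_, hm, rfl⟩ ?_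
  rintro _ ⟨r, hr, rfl⟩
  have h5 := ip_dirDeriv (M.src_ne_tgt E) p r
  change ip 1 (restr (M.edge E) (dirDeriv (M.tangent E) p)) (restr (M.edge E) r)
    = -ip 1 (restr (M.edge E) p) (restr (M.edge E) (dirDeriv (M.tangent E) r)) + _ - _ at h5
  rw [M.gE_spec k q E hr, h5, h2, h3, h1, h4 _ (dirDeriv_mem hr)]

/-- With the full trace instead of q_E there is no restriction on the degree of r; degree k + 1 is
needed for rotations on faces. -/
lemma gE_green (k : ℕ) (q : M.XgradE k) (E : ℰ) (r : P3) :
    ip 1 (M.gE k q E : M.edge E → ℝ) (restr (M.edge E) r)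
      = - ip 1 (M.γE k q E : M.edge E → ℝ) (restr (M.edge E) (dirDeriv (M.tangent E) r))
        + q.2 (M.tgt E) * ev (M.vert (M.tgt E)) r - q.2 (M.src E) * ev (M.vert (M.src E)) r := by
  obtain ⟨p, h1, h2, h3, h4⟩ := M.gE_eq_dirDeriv k q E
  have h5 := ip_dirDeriv (M.src_ne_tgt E) p r
  change ip 1 (restr (M.edge E) (dirDeriv (M.tangent E) p)) (restr (M.edge E) r)
    = -ip 1 (restr (M.edge E) p) (restr (M.edge E) (dirDeriv (M.tangent E) r)) + _ - _ at h5
  rw [h4, h5, h1, h2, h3]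

/-- The edge trace is constant where the edge gradient vanishes. -/
lemma γE_of_gE_eq_zero {k : ℕ} {q : M.XgradE k} {E : ℰ} (h : (M.gE k q E : M.edge E → ℝ) = 0) :
    (M.γE k q E : M.edge E → ℝ) = restr (M.edge E) (MvPolynomial.C (q.2 (M.src E))) := by
  obtain ⟨p, h1, h2, -, h4⟩ := M.gE_eq_dirDeriv k q E
  have h5 := exists_ev_eq_of_dirDeriv (h4.symm.trans h)
  rw [h2, map_sub, sub_eq_zero, h1] at h5
  exact h5

lemma bdryGradF_isLinear (k : ℕ) (q : M.XgradE k) (F : ℱ) :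
    IsLinearMap ℝ (M.bdryGradF k q F) :=
  isLin_sum _ fun E => isLin_mul (isLin_comp ((M.good_edge E).isLin_restr (M.bcE _))
    (dotCst (M.normalFE F E))) _

lemma ev_dotProduct_congr {v w : V3} {x : E3} (h : ∀ i, ev x (v i) = ev x (w i)) (a : V3) :
    ev x (v ⬝ᵥ a) = ev x (w ⬝ᵥ a) := by
  simp only [dotProduct_three, map_add, map_mul, h]

lemma bdryGradF_congr (k : ℕ) (q : M.XgradE k) {F : ℱ} {v w : V3}
    (h : ∀ x ∈ M.planeF F, ∀ i, ev x (v i) = ev x (w i)) :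
    M.bdryGradF k q F v = M.bdryGradF k q F w := by
  refine Finset.sum_congr rfl fun E hE => ?_
  rw [restr_congr.2 fun x hx => ev_dotProduct_congr (h x (M.edge_subset_planeF hE hx)) _]

lemma bdryGradF_eq_zero (k : ℕ) (q : M.XgradE k) {F : ℱ} {v : V3}
    (h : ∀ x ∈ M.planeF F, ∀ i, ev x (v i) = 0) : M.bdryGradF k q F v = 0 := by
  rw [M.bdryGradF_congr k q (w := 0) fun x hx i => by rw [h x hx, Pi.zero_apply, map_zero]]
  exact (M.bdryGradF_isLinear k q F).map_zero

lemma divTan_congr {F : ℱ} {v w : V3} (h : ∀ x ∈ M.planeF F, ∀ i, ev x (v i) = ev x (w i)) :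
    restr (M.face F) (divTan (M.normal F) v) = restr (M.face F) (divTan (M.normal F) w) := by
  rw [restr_congr]
  intro x hx
  rw [← sub_eq_zero, ← map_sub]
  have : divTan (M.normal F) v - divTan (M.normal F) w = divTan (M.normal F) (v - w) :=
    ((divTanL (M.normal F)).map_sub v w).symm
  rw [this]
  refine ev_divTan_eq_zero (M.normal_norm F) (fun y hy i => ?_) (M.face_subset F hx)
  rw [Pi.sub_apply, map_sub, h y hy, sub_self]

lemma divTan_eq_zero {F : ℱ} {v : V3} (h : ∀ x ∈ M.planeF F, ∀ i, ev x (v i) = 0) :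
    restr (M.face F) (divTan (M.normal F) v) = 0 :=
  restr_eq_zero.2 fun _ hx => ev_divTan_eq_zero (M.normal_norm F) h (M.face_subset F hx)

/-- The defining identity of the face gradient, for test fields that are tangent to the face. -/
lemma gF_spec (k : ℕ) (q : M.XgradF k) (F : ℱ) {v : V3} (hv : v ∈ VPol k)
    (hvn : ∀ x ∈ M.planeF F, ev x (v ⬝ᵥ cst (M.normal F)) = 0) :
    ip 2 (M.gF k q F : M.face F → E3) (restrV (M.face F) v)
      = - ip 2 (q.1 F : M.face F → ℝ) (restr (M.face F) (divTan (M.normal F) v))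
        + M.bdryGradF k q.2 F v := by
  have hg := M.good_face F
  have hspec : ∀ v ∈ VPolTan (M.normal F) k,
      ip 2 (M.gF k q F : M.face F → E3) (restrV (M.face F) v)
      = - ip 2 (q.1 F : M.face F → ℝ) (restr (M.face F) (divTan (M.normal F) v))
        + M.bdryGradF k q.2 F v := by
    refine the_spec (S := M.VPolOnF F k) (p := fun g => ∀ v ∈ VPolTan (M.normal F) k,
      ip 2 (g : M.face F → E3) (restrV (M.face F) v)
      = - ip 2 (q.1 F : M.face F → ℝ) (restr (M.face F) (divTan (M.normal F) v))
        + M.bdryGradF k q.2 F v) ?_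
    refine hg.exists_rep' (hg.VOn_le _) (VPolTan (M.normal F) k) (restrV (M.face F))
      (isLin_add (isLin_neg (isLin_comp (hg.isLin_restr (M.bcF _)) (divTanL (M.normal F))))
        (M.bdryGradF_isLinear k q.2 F)) (fun v hv => ⟨v, hv, rfl⟩) fun v _ h => ?_
    rw [M.divTan_eq_zero fun x hx => ev_eq_zero_of_faceV h hx,
      M.bdryGradF_eq_zero k q.2 fun x hx => ev_eq_zero_of_faceV h hx]
    simp
  -- Fields (x - x_F)p are tangential on the plane but not off it. Replacing v by its tangential
  -- part changes no value on the plane, hence none of the terms.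
  have h1 : ∀ x ∈ M.planeF F, ∀ i, ev x (tang (M.normal F) v i) = ev x (v i) :=
    fun x hx i => ev_tang (hvn x hx) i
  rw [← M.bdryGradF_congr k q.2 h1, ← M.divTan_congr h1,
    ← restrV_congr.2 fun x hx => h1 x (M.face_subset F hx)]
  exact hspec _ (tang_mem (M.normal_norm F) hv)

lemma cRolF_le (F : ℱ) (l : ℤ) : M.cRolF F l ≤ VPol l := by
  rintro _ ⟨p, hp, rfl⟩
  have := posMul_mem hp (M.centerF F)
  rwa [sub_add_cancel] at this

lemma cRolT_le (T : 𝒯) (l : ℤ) : M.cRolT T l ≤ VPol l := by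
  rintro _ ⟨p, hp, rfl⟩
  have := posMul_mem hp (M.centerT T)
  rwa [sub_add_cancel] at this

lemma cGolT_le (T : 𝒯) (l : ℤ) : M.cGolT T l ≤ VPol l := by
  rintro _ ⟨p, hp, rfl⟩
  have := posCross_mem hp (M.centerT T)
  rwa [sub_add_cancel] at this

lemma cRolF_mono (F : ℱ) {l m : ℤ} (h : l ≤ m) : M.cRolF F l ≤ M.cRolF F m :=
  Submodule.map_mono (Pol_mono (by linarith))

lemma ev_cRolF_dotProduct {F : ℱ} {l : ℤ} {v : V3} (hv : v ∈ M.cRolF F l) {x : E3}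
    (hx : x ∈ M.planeF F) : ev x (v ⬝ᵥ cst (M.normal F)) = 0 := by
  obtain ⟨p, -, rfl⟩ := hv
  exact ev_posMul_dotProduct hx p

/-- `div_F` is injective on `(x - x_F) P(F)`. -/
lemma ev_eq_zero_of_divTan {F : ℱ} {l : ℤ} {v : V3} (hv : v ∈ M.cRolF F l)
    (h : restr (M.face F) (divTan (M.normal F) v) = 0) :
    ∀ x ∈ M.planeF F, ∀ i, ev x (v i) = 0 := by
  obtain ⟨p, -, rfl⟩ := hv
  intro x hx i
  have h1 := ev_eq_zero_of_divTan_posMul (M.normal_norm F)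
    (fun y hy => ev_eq_zero_of_face h hy) hx
  rw [posMul_apply, map_mul, h1, mul_zero]

/-- The right-hand side is determined by div_F v because div_F is injective on the Koszul
complement. -/
lemma γF_spec (k : ℕ) (q : M.XgradF k) (F : ℱ) {v : V3} (hv : v ∈ M.cRolF F ((k : ℤ) + 2)) :
    ip 2 (M.γF k q F : M.face F → ℝ) (restr (M.face F) (divTan (M.normal F) v))
      = - ip 2 (M.gF k q F : M.face F → E3) (restrV (M.face F) v) + M.bdryGradF k q.2 F v := by
  have hg := M.good_face F
  refine the_spec (S := PolyOn ((k : ℤ) + 1) (M.face F)) (p := fun g => ∀ v ∈ M.cRolF F ((k : ℤ) + 2),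
    ip 2 (g : M.face F → ℝ) (restr (M.face F) (divTan (M.normal F) v))
      = - ip 2 (M.gF k q F : M.face F → E3) (restrV (M.face F) v) + M.bdryGradF k q.2 F v) ?_ v hv
  refine hg.exists_rep' (hg.PolyOn_le _) (M.cRolF F ((k : ℤ) + 2))
    (restr (M.face F) ∘ₗ divTanL (M.normal F))
    (isLin_add (isLin_neg (hg.isLin_restrV (M.bcVF _))) (M.bdryGradF_isLinear k q.2 F))
    (fun v hv => ⟨divTan (M.normal F) v, ?_, rfl⟩) fun v hv h => ?_
  · have := divTan_mem (n := M.normal F) (M.cRolF_le F _ hv)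
    exact Pol_mono (by linarith) this
  · have h1 := M.ev_eq_zero_of_divTan hv h
    rw [M.bdryGradF_eq_zero k q.2 h1,
      restrV_eq_zero.2 fun x hx => h1 x (M.face_subset F hx)]
    simp

lemma bdryGradT_isLinear (k : ℕ) (q : M.XgradF k) (T : 𝒯) :
    IsLinearMap ℝ (M.bdryGradT k q T) :=
  isLin_sum _ fun F => isLin_mul (isLin_comp ((M.good_face F).isLin_restr (M.bcF _))
    (dotCst (M.normal F))) _

lemma eq_zero_of_elem {T : 𝒯} {p : P3} (h : restr (M.elem T) p = 0) : p = 0 :=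
  eq_zero_of_restr (M.elem_open T) (M.elem_connected T).nonempty h

lemma eq_zero_of_elemV {T : 𝒯} {v : V3} (h : restrV (M.elem T) v = 0) : v = 0 :=
  eq_zero_of_restrV (M.elem_open T) (M.elem_connected T).nonempty h

lemma gT_spec (k : ℕ) (q : M.Xgrad k) (T : 𝒯) {v : V3} (hv : v ∈ VPol k) :
    ip 3 (M.gT k q T : M.elem T → E3) (restrV (M.elem T) v)
      = - ip 3 (q.1 T : M.elem T → ℝ) (restr (M.elem T) (div v)) + M.bdryGradT k q.2 T v := by
  have hg := M.good_elem T
  refine the_spec (S := M.VPolOnT T k) (p := fun g => ∀ v ∈ VPol k,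
    ip 3 (g : M.elem T → E3) (restrV (M.elem T) v)
      = - ip 3 (q.1 T : M.elem T → ℝ) (restr (M.elem T) (div v)) + M.bdryGradT k q.2 T v) ?_ v hv
  have hlin : IsLinearMap ℝ fun v => - ip 3 (q.1 T : M.elem T → ℝ) (restr (M.elem T) (divL v))
      + M.bdryGradT k q.2 T v :=
    isLin_add (isLin_neg (isLin_comp (hg.isLin_restr (M.bcT _)) divL))
      (M.bdryGradT_isLinear k q.2 T)
  refine hg.exists_rep' (hg.VOn_le _) (VPol k) (restrV (M.elem T)) hlin
    (fun v hv => ⟨v, hv, rfl⟩) fun v _ h => ?_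
  rw [M.eq_zero_of_elemV h]
  exact hlin.map_zero

/-! ## Extension to the discrete gradient space -/

lemma EpolE_spec (k : ℕ) (q : M.XgradE 0) (E : ℰ) {r : P3} (hr : r ∈ Pol k) :
    ip 1 (M.EpolE k q E : M.edge E → ℝ) (restr (M.edge E) (dirDeriv (M.tangent E) r))
      = - ip 1 (M.gE 0 q E : M.edge E → ℝ) (restr (M.edge E) r)
        + q.2 (M.tgt E) * ev (M.vert (M.tgt E)) r - q.2 (M.src E) * ev (M.vert (M.src E)) r := by
  have hg := M.good_edge E
  have := the_spec (S := PolyOn ((k : ℤ) - 1) (M.edge E)) (p := fun g => ∀ r ∈ Pol k,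
    ip 1 (g : M.edge E → ℝ) (restr (M.edge E) (dirDeriv (M.tangent E) r))
      = - ip 1 (M.gE 0 q E : M.edge E → ℝ) (restr (M.edge E) r)
        + q.2 (M.tgt E) * MvPolynomial.eval (fun i => M.vert (M.tgt E) i) r
        - q.2 (M.src E) * MvPolynomial.eval (fun i => M.vert (M.src E) i) r) ?_ r hr
  · rw [eval_eq_ev, eval_eq_ev] at this
    exact this
  · simp only [eval_eq_ev]
    have hlin : IsLinearMap ℝ fun r => - ip 1 (M.gE 0 q E : M.edge E → ℝ) (restr (M.edge E) r)
        + q.2 (M.tgt E) * evL (M.vert (M.tgt E)) r - q.2 (M.src E) * evL (M.vert (M.src E)) r :=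
      isLin_sub (isLin_add (isLin_neg (hg.isLin_restr (M.bcE _)))
        (isLin_mul (evL _).isLinear _)) (isLin_mul (evL _).isLinear _)
    refine hg.exists_rep' (hg.PolyOn_le _) (Pol k)
      (restr (M.edge E) ∘ₗ dirDerivL (M.tangent E)) hlin
      (fun r hr => ⟨_, dirDeriv_mem hr, rfl⟩) fun r _ h => ?_
    have h1 := exists_ev_eq_of_dirDeriv h
    set c := ev (M.vert (M.src E)) r with hc
    have h2 : r = (r - MvPolynomial.C c) + MvPolynomial.C c := by ring
    -- Compatibility on constants, the kernel of the derivative: it is the identity defining the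
    -- edge gradient of degree 0.
    have h3 := M.gE_spec 0 q E (C_mem (l := ((0 : ℕ) : ℤ)) (by simp) c)
    rw [dirDeriv_C, map_zero, ip_zero_right, ev_C, ev_C] at h3
    have h4 : ev (M.vert (M.tgt E)) r = c := by
      have := ev_tgt_of_edge h1
      rwa [map_sub, ev_C, sub_eq_zero] at this
    have h5 : restr (M.edge E) r = restr (M.edge E) (MvPolynomial.C c) := by
      rwa [map_sub, sub_eq_zero] at h1
    change -ip 1 _ (restr _ r) + _ * ev _ r - _ * ev _ r = 0
    rw [h5, h3, h4, ← hc]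
    ring

lemma EpolF_spec (k : ℕ) (q : M.XgradF 0) (F : ℱ) {v : V3} (hv : v ∈ M.cRolF F k) :
    ip 2 (M.EpolF k q F : M.face F → ℝ) (restr (M.face F) (divTan (M.normal F) v))
      = - ip 2 (M.gF 0 q F : M.face F → E3) (restrV (M.face F) v)
        + M.bdryGradF k (M.EgradE k q.2) F v := by
  have hg := M.good_face F
  refine the_spec (S := PolyOn ((k : ℤ) - 1) (M.face F)) (p := fun g => ∀ v ∈ M.cRolF F k,
    ip 2 (g : M.face F → ℝ) (restr (M.face F) (divTan (M.normal F) v))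
      = - ip 2 (M.gF 0 q F : M.face F → E3) (restrV (M.face F) v)
        + M.bdryGradF k (M.EgradE k q.2) F v) ?_ v hv
  refine hg.exists_rep' (hg.PolyOn_le _) (M.cRolF F k)
    (restr (M.face F) ∘ₗ divTanL (M.normal F))
    (isLin_add (isLin_neg (hg.isLin_restrV (M.bcVF _))) (M.bdryGradF_isLinear k _ F))
    (fun v hv => ⟨_, divTan_mem (M.cRolF_le F _ hv), rfl⟩) fun v hv h => ?_
  have h1 := M.ev_eq_zero_of_divTan hv h
  rw [M.bdryGradF_eq_zero k _ h1, restrV_eq_zero.2 fun x hx => h1 x (M.face_subset F hx)]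
  simp

lemma EpolT_spec (k : ℕ) (q : M.Xgrad 0) (T : 𝒯) {v : V3} (hv : v ∈ M.cRolT T k) :
    ip 3 (M.EpolT k q T : M.elem T → ℝ) (restr (M.elem T) (div v))
      = - ip 3 (M.gT 0 q T : M.elem T → E3) (restrV (M.elem T) v)
        + M.bdryGradT k (M.EgradF k q.2) T v := by
  have hg := M.good_elem T
  refine the_spec (S := PolyOn ((k : ℤ) - 1) (M.elem T)) (p := fun g => ∀ v ∈ M.cRolT T k,
    ip 3 (g : M.elem T → ℝ) (restr (M.elem T) (div v))
      = - ip 3 (M.gT 0 q T : M.elem T → E3) (restrV (M.elem T) v)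
        + M.bdryGradT k (M.EgradF k q.2) T v) ?_ v hv
  have hlin := isLin_add (isLin_neg (hg.isLin_restrV (M.bcVT (M.gT 0 q T))))
    (M.bdryGradT_isLinear k (M.EgradF k q.2) T)
  refine hg.exists_rep' (hg.PolyOn_le _) (M.cRolT T k)
    (restr (M.elem T) ∘ₗ divL) hlin
    (fun v hv => ⟨_, div_mem (M.cRolT_le T _ hv), rfl⟩) fun v hv h => ?_
  obtain ⟨p, -, rfl⟩ := hv
  rw [eq_zero_of_div_posMul (M.eq_zero_of_elem h), map_zero]
  exact hlin.map_zero

end PolyhedralMesh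


lemma grad_C (c : ℝ) : grad (MvPolynomial.C c) = 0 := by
  funext i
  simp [grad_apply]

lemma rotTan_C (n : E3) (c : ℝ) : rotTan n (MvPolynomial.C c) = 0 := by
  rw [rotTan_eq, grad_C]
  simp

namespace PolyhedralMesh

variable {Ω : Set E3} {𝒯 ℱ ℰ 𝒱 : Type*} [Fintype 𝒯] [Fintype ℱ] [Fintype ℰ] [Fintype 𝒱]
variable (M : PolyhedralMesh Ω 𝒯 ℱ ℰ 𝒱)

/-! ## The discrete curl -/

lemma bdryCurlF_isLinear (k : ℕ) (v : ∀ E, PolyOn k (M.edge E)) (F : ℱ) :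
    IsLinearMap ℝ (M.bdryCurlF k v F) :=
  isLin_sum _ fun E => isLin_mul ((M.good_edge E).isLin_restr (M.bcE _)) _

lemma bdryCurlF_congr (k : ℕ) (v : ∀ E, PolyOn k (M.edge E)) {F : ℱ} {r s : P3}
    (h : ∀ x ∈ M.planeF F, ev x r = ev x s) : M.bdryCurlF k v F r = M.bdryCurlF k v F s := by
  refine Finset.sum_congr rfl fun E hE => ?_
  rw [restr_congr.2 fun x hx => h x (M.edge_subset_planeF hE hx)]

lemma bdryCurlF_eq_zero (k : ℕ) (v : ∀ E, PolyOn k (M.edge E)) {F : ℱ} {r : P3}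
    (h : ∀ x ∈ M.planeF F, ev x r = 0) : M.bdryCurlF k v F r = 0 := by
  rw [M.bdryCurlF_congr k v (s := 0) fun x hx => by rw [h x hx, map_zero]]
  exact (M.bdryCurlF_isLinear k v F).map_zero

lemma cF_spec (k : ℕ) (v : M.XcurlF k) (F : ℱ) {r : P3} (hr : r ∈ Pol k) :
    ip 2 (M.cF k v F : M.face F → ℝ) (restr (M.face F) r)
      = ip 2 ((v.1 F).1 : M.face F → E3) (restrV (M.face F) (rotTan (M.normal F) r))
        - M.bdryCurlF k v.2 F r := by
  have hg := M.good_face F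
  refine the_spec (S := PolyOn k (M.face F)) (p := fun c => ∀ r ∈ Pol k,
    ip 2 (c : M.face F → ℝ) (restr (M.face F) r)
      = ip 2 ((v.1 F).1 : M.face F → E3) (restrV (M.face F) (rotTan (M.normal F) r))
        - M.bdryCurlF k v.2 F r) ?_ r hr
  refine hg.exists_rep' (hg.PolyOn_le _) (Pol k) (restr (M.face F))
    (isLin_sub (isLin_comp (hg.isLin_restrV (M.bcVF _)) (rotTan (M.normal F)))
      (M.bdryCurlF_isLinear k v.2 F)) (fun r hr => ⟨r, hr, rfl⟩) fun r _ h => ?_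
  have h1 : ∀ x ∈ M.planeF F, ev x r = 0 := fun x hx => ev_eq_zero_of_face h hx
  rw [M.bdryCurlF_eq_zero k v.2 h1, restrV_eq_zero.2 fun x hx i =>
    ev_rotTan_eq_zero (M.normal_norm F) h1 (M.face_subset F hx) i]
  simp

/-- Only the circulation remains. This gives compatibility on constants and shows that reduction
preserves closedness. -/
lemma ip_cF_C (k : ℕ) (v : M.XcurlF k) (F : ℱ) (c : ℝ) :
    ip 2 (M.cF k v F : M.face F → ℝ) (restr (M.face F) (MvPolynomial.C c))
      = - M.bdryCurlF k v.2 F (MvPolynomial.C c) := by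
  rw [M.cF_spec k v F (C_mem (by simp) c), rotTan_C, map_zero, ip_zero_right, zero_sub]

/-- A polynomial with vanishing rotation on a face is constant there. -/
lemma ev_eq_of_restrV_rotTan {F : ℱ} {r : P3}
    (h : restrV (M.face F) (rotTan (M.normal F) r) = 0) :
    ∀ x ∈ M.planeF F, ev x r = ev x (MvPolynomial.C (ev (M.centerF F) r)) := by
  intro x hx
  rw [ev_C]
  exact ev_eq_of_rotTan (M.normal_norm F) (fun y hy i => ev_eq_zero_of_faceV h hy i) hx

/-- If rot_F r = 0 then r is constant on the face, where the two terms cancel. This is the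
solvability condition both for the tangential trace and for the extension in R. -/
lemma cF_kernel (k : ℕ) (v : M.XcurlF k) {F : ℱ} {r : P3}
    (h : restrV (M.face F) (rotTan (M.normal F) r) = 0) :
    ip 2 (M.cF k v F : M.face F → ℝ) (restr (M.face F) r) + M.bdryCurlF k v.2 F r = 0 := by
  have h1 := M.ev_eq_of_restrV_rotTan h
  rw [M.bdryCurlF_congr k v.2 h1, restr_congr.2 fun x hx => h1 x (M.face_subset F hx), ip_cF_C]
  ring

/-- The zero-mean constraint in the definition can be dropped, since constants contribute nothing to
either side. -/
lemma γtF_spec (k : ℕ) (v : M.XcurlF k) (F : ℱ) {r : P3} (hr : r ∈ Pol ((k : ℤ) + 1)) {w : V3}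
    (hw : w ∈ M.cRolF F k) :
    ip 2 (M.γtF k v F : M.face F → E3) (restrV (M.face F) (rotTan (M.normal F) r + w))
      = ip 2 (M.cF k v F : M.face F → ℝ) (restr (M.face F) r) + M.bdryCurlF k v.2 F r
        + ip 2 ((v.1 F).2 : M.face F → E3) (restrV (M.face F) w) := by
  have hg := M.good_face F
  have hspec := the_spec (S := M.VPolOnF F k) (p := fun g => ∀ r ∈ Pol ((k : ℤ) + 1),
    ip 2 (restr (M.face F) r) 1 = 0 → ∀ w ∈ M.cRolF F k,
      ip 2 (g : M.face F → E3) (restrV (M.face F) (rotTan (M.normal F) r + w))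
        = ip 2 (M.cF k v F : M.face F → ℝ) (restr (M.face F) r) + M.bdryCurlF k v.2 F r
          + ip 2 ((v.1 F).2 : M.face F → E3) (restrV (M.face F) w)) ?_
  · have h1 : (1 : M.face F → ℝ) = restr (M.face F) (MvPolynomial.C 1) := by
      funext x
      rw [restr_apply, ev_C, Pi.one_apply]
    have hne : ip 2 (1 : M.face F → ℝ) 1 ≠ 0 := fun h => by
      have h2 := hg.eq_zero_of_ip_self (f := (1 : M.face F → ℝ))
        (by rw [h1]; exact restr_mem_BC hg.bounded _) h
      exact one_ne_zero (congrFun h2 ⟨_, M.centerF_mem F⟩)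
    -- The mean value of r on the face.
    set m := ip 2 (restr (M.face F) r) 1 / ip 2 (1 : M.face F → ℝ) 1 with hm
    have hC : restr (M.face F) (MvPolynomial.C m) = m • (1 : M.face F → ℝ) := by
      funext x
      rw [restr_apply, ev_C, Pi.smul_apply, Pi.one_apply, smul_eq_mul, mul_one]
    have h3 := hspec (r - MvPolynomial.C m) (sub_mem hr (C_mem (by positivity) m)) (by
      rw [map_sub, hg.ip_sub_left (restr_mem_BC hg.bounded _) (restr_mem_BC hg.bounded _)
        (by rw [h1]; exact restr_mem_BC hg.bounded _), hC, ip_smul_left, hm,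
        div_mul_cancel₀ _ hne, sub_self]) w hw
    rw [map_sub, rotTan_C, sub_zero, map_sub, hg.ip_sub_right (M.bcF _)
      (restr_mem_BC hg.bounded _) (restr_mem_BC hg.bounded _), ip_cF_C,
      (M.bdryCurlF_isLinear k v.2 F).map_sub] at h3
    refine h3.trans ?_
    ring
  · have hmem : ∀ z ∈ (Pol ((k : ℤ) + 1)).prod (M.cRolF F k),
        (restrV (M.face F) ∘ₗ (rotTan (M.normal F)).coprod LinearMap.id) z ∈ M.VPolOnF F k := by
      rintro ⟨r, w⟩ ⟨hr, hw⟩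
      change restrV (M.face F) (rotTan (M.normal F) r + w) ∈ _
      have h1 : rotTan (M.normal F) r + w ∈ VPol k :=
        add_mem (rotTan_mem hr).1 (M.cRolF_le F _ hw)
      refine ⟨_, tang_mem (M.normal_norm F) h1, ?_⟩
      refine restrV_congr.2 fun x hx i => ev_tang ?_ i
      rw [add_dotProduct, map_add, M.ev_cRolF_dotProduct hw (M.face_subset F hx),
        (rotTan_mem hr).2, map_zero, add_zero]
    obtain ⟨g, hgs⟩ := hg.exists_rep' (hg.VOn_le (VPolTan (M.normal F) k))
      ((Pol ((k : ℤ) + 1)).prod (M.cRolF F k))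
      (restrV (M.face F) ∘ₗ (rotTan (M.normal F)).coprod LinearMap.id)
      (isLin_add (isLin_comp (isLin_add (hg.isLin_restr (M.bcF (M.cF k v F)))
        (M.bdryCurlF_isLinear k v.2 F)) (LinearMap.fst ℝ P3 V3))
        (isLin_comp (hg.isLin_restrV (M.bcVF (v.1 F).2)) (LinearMap.snd ℝ P3 V3)))
      hmem <| by
      rintro ⟨r, w⟩ ⟨hr, hw⟩ h
      change restrV (M.face F) (rotTan (M.normal F) r + w) = 0 at h
      change ip 2 _ (restr (M.face F) r) + M.bdryCurlF k v.2 F r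
        + ip 2 _ (restrV (M.face F) w) = 0
      obtain ⟨p, -, rfl⟩ := hw
      -- Independence of rotations and Koszul fields removes w, which leaves the condition on r
      -- alone.
      have h1 : ∀ x ∈ M.planeF F, ev x p = 0 := fun x hx =>
        ev_eq_zero_of_rotTan_add_posMul (M.normal_norm F)
          (fun y hy i => ev_eq_zero_of_faceV h hy i) hx
      have h2 : restrV (M.face F) (posMul (M.centerF F) p) = 0 :=
        restrV_eq_zero.2 fun x hx i => by
          rw [posMul_apply, map_mul, h1 x (M.face_subset F hx), mul_zero]
      rw [map_add, h2, add_zero] at h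
      rw [h2, ip_zero_right, add_zero]
      exact M.cF_kernel k v h
    exact ⟨g, fun r hr _ w hw => hgs (r, w) ⟨hr, hw⟩⟩

lemma bdryCurlT_isLinear (k : ℕ) (v : M.XcurlF k) (T : 𝒯) :
    IsLinearMap ℝ (M.bdryCurlT k v T) :=
  isLin_sum _ fun F => isLin_mul (isLin_comp ((M.good_face F).isLin_restrV (M.bcVF _))
    (crossCst (M.normal F))) _

lemma cT_spec (k : ℕ) (v : M.Xcurl k) (T : 𝒯) {w : V3} (hw : w ∈ VPol k) :
    ip 3 (M.cT k v T : M.elem T → E3) (restrV (M.elem T) w)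
      = ip 3 ((v.1 T).1 : M.elem T → E3) (restrV (M.elem T) (curl w))
        + M.bdryCurlT k v.2 T w := by
  have hg := M.good_elem T
  refine the_spec (S := M.VPolOnT T k) (p := fun c => ∀ w ∈ VPol k,
    ip 3 (c : M.elem T → E3) (restrV (M.elem T) w)
      = ip 3 ((v.1 T).1 : M.elem T → E3) (restrV (M.elem T) (curl w))
        + M.bdryCurlT k v.2 T w) ?_ w hw
  have hlin := isLin_add (isLin_comp (hg.isLin_restrV (M.bcVT (v.1 T).1)) curl)
    (M.bdryCurlT_isLinear k v.2 T)
  refine hg.exists_rep' (hg.VOn_le _) (VPol k) (restrV (M.elem T)) hlin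
    (fun v hv => ⟨v, hv, rfl⟩) fun v _ h => ?_
  rw [M.eq_zero_of_elemV h]
  exact hlin.map_zero

/-! ## The discrete divergence -/

lemma bdryDivT_isLinear (k : ℕ) (w : ∀ F, PolyOn k (M.face F)) (T : 𝒯) :
    IsLinearMap ℝ (M.bdryDivT k w T) :=
  isLin_sum _ fun F => isLin_mul ((M.good_face F).isLin_restr (M.bcF _)) _

lemma dT_spec (k : ℕ) (w : M.Xdiv k) (T : 𝒯) {r : P3} (hr : r ∈ Pol k) :
    ip 3 (M.dT k w T : M.elem T → ℝ) (restr (M.elem T) r)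
      = - ip 3 ((w.1 T).1 : M.elem T → E3) (restrV (M.elem T) (grad r))
        + M.bdryDivT k w.2 T r := by
  have hg := M.good_elem T
  refine the_spec (S := PolyOn k (M.elem T)) (p := fun d => ∀ r ∈ Pol k,
    ip 3 (d : M.elem T → ℝ) (restr (M.elem T) r)
      = - ip 3 ((w.1 T).1 : M.elem T → E3) (restrV (M.elem T) (grad r))
        + M.bdryDivT k w.2 T r) ?_ r hr
  have hlin := isLin_add (isLin_neg (isLin_comp (hg.isLin_restrV (M.bcVT (w.1 T).1)) grad))
    (M.bdryDivT_isLinear k w.2 T)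
  refine hg.exists_rep' (hg.PolyOn_le _) (Pol k) (restr (M.elem T)) hlin
    (fun r hr => ⟨r, hr, rfl⟩) fun r _ h => ?_
  rw [M.eq_zero_of_elem h]
  exact hlin.map_zero

lemma ip_dT_C (k : ℕ) (w : M.Xdiv k) (T : 𝒯) (c : ℝ) :
    ip 3 (M.dT k w T : M.elem T → ℝ) (restr (M.elem T) (MvPolynomial.C c))
      = M.bdryDivT k w.2 T (MvPolynomial.C c) := by
  rw [M.dT_spec k w T (C_mem (by simp) c), grad_C, map_zero, ip_zero_right, neg_zero, zero_add]

/-! ## Extension to the discrete curl and divergence spaces -/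

lemma sub_one_add_one_mem {k : ℕ} {r : P3} (hr : r ∈ Pol k) : r ∈ Pol ((k : ℤ) - 1 + 1) := by
  rwa [sub_add_cancel]

lemma ErolF_spec (k : ℕ) (v : M.XcurlF 0) (F : ℱ) {r : P3} (hr : r ∈ Pol k) :
    ip 2 (M.ErolF k v F : M.face F → E3) (restrV (M.face F) (rotTan (M.normal F) r))
      = ip 2 (M.cF 0 v F : M.face F → ℝ) (restr (M.face F) r) + M.bdryCurlF 0 v.2 F r := by
  have hg := M.good_face F
  refine the_spec (S := M.RolOnF F ((k : ℤ) - 1)) (p := fun g => ∀ r ∈ Pol k,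
    ip 2 (g : M.face F → E3) (restrV (M.face F) (rotTan (M.normal F) r))
      = ip 2 (M.cF 0 v F : M.face F → ℝ) (restr (M.face F) r) + M.bdryCurlF 0 v.2 F r) ?_ r hr
  exact hg.exists_rep' (hg.VOn_le _) (Pol k) (restrV (M.face F) ∘ₗ rotTan (M.normal F))
    (isLin_add (hg.isLin_restr (M.bcF _)) (M.bdryCurlF_isLinear 0 v.2 F))
    (fun r hr => ⟨_, ⟨r, sub_one_add_one_mem hr, rfl⟩, rfl⟩) fun r _ h => M.cF_kernel 0 v h

lemma eq_zero_of_curl_cGolT {T : 𝒯} {l : ℤ} {w : V3} (hw : w ∈ M.cGolT T l)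
    (h : restrV (M.elem T) (curl w) = 0) : w = 0 := by
  obtain ⟨u, -, rfl⟩ := hw
  exact eq_zero_of_curl_posCross (M.eq_zero_of_elemV h)

lemma curl_cGolT_mem {T : 𝒯} {k : ℕ} {w : V3} (hw : w ∈ M.cGolT T k) :
    curl w ∈ RolT ((k : ℤ) - 1) :=
  ⟨w, by rw [sub_add_cancel]; exact M.cGolT_le T _ hw, rfl⟩

lemma ErolT_spec (k : ℕ) (v : M.Xcurl 0) (T : 𝒯) {w : V3} (hw : w ∈ M.cGolT T k) :
    ip 3 (M.ErolT k v T : M.elem T → E3) (restrV (M.elem T) (curl w))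
      = ip 3 (M.cT 0 v T : M.elem T → E3) (restrV (M.elem T) w)
        - M.bdryCurlT k (M.EcurlF k v.2) T w := by
  have hg := M.good_elem T
  refine the_spec (S := M.RolOnT T ((k : ℤ) - 1)) (p := fun g => ∀ w ∈ M.cGolT T k,
    ip 3 (g : M.elem T → E3) (restrV (M.elem T) (curl w))
      = ip 3 (M.cT 0 v T : M.elem T → E3) (restrV (M.elem T) w)
        - M.bdryCurlT k (M.EcurlF k v.2) T w) ?_ w hw
  have hlin := isLin_sub (hg.isLin_restrV (M.bcVT (M.cT 0 v T)))
    (M.bdryCurlT_isLinear k (M.EcurlF k v.2) T)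
  refine hg.exists_rep' (hg.VOn_le _) (M.cGolT T k) (restrV (M.elem T) ∘ₗ curl) hlin
    (fun w hw => ⟨_, M.curl_cGolT_mem hw, rfl⟩) fun w hw h => ?_
  rw [M.eq_zero_of_curl_cGolT hw h]
  exact hlin.map_zero

lemma EgolT_spec (k : ℕ) (w : M.Xdiv 0) (T : 𝒯) {r : P3} (hr : r ∈ Pol k) :
    ip 3 (M.EgolT k w T : M.elem T → E3) (restrV (M.elem T) (grad r))
      = - ip 3 (M.dT 0 w T : M.elem T → ℝ) (restr (M.elem T) r) + M.bdryDivT 0 w.2 T r := by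
  have hg := M.good_elem T
  refine the_spec (S := M.GolOnT T ((k : ℤ) - 1)) (p := fun g => ∀ r ∈ Pol k,
    ip 3 (g : M.elem T → E3) (restrV (M.elem T) (grad r))
      = - ip 3 (M.dT 0 w T : M.elem T → ℝ) (restr (M.elem T) r) + M.bdryDivT 0 w.2 T r) ?_ r hr
  refine hg.exists_rep' (hg.VOn_le _) (Pol k) (restrV (M.elem T) ∘ₗ grad)
    (isLin_add (isLin_neg (hg.isLin_restr (M.bcT _))) (M.bdryDivT_isLinear 0 w.2 T))
    (fun r hr => ⟨_, ⟨r, sub_one_add_one_mem hr, rfl⟩, rfl⟩) fun r _ h => ?_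
  obtain ⟨c, rfl⟩ := eq_C_of_grad_eq_zero (M.eq_zero_of_elemV h)
  rw [ip_dT_C]
  ring

end PolyhedralMesh


lemma Good.ip_proj_C {d k : ℕ} {P : Set E3} (hP : Good d P) (f : PolyOn k P) (c : ℝ) :
    ip d (proj d (PolyOn ((0 : ℕ) : ℤ) P) (f : P → ℝ) : P → ℝ) (restr P (MvPolynomial.C c))
      = ip d (f : P → ℝ) (restr P (MvPolynomial.C c)) :=
  hP.ip_proj (hP.PolyOn_le _) (hP.PolyOn_le _ f.2) ⟨_, C_mem (by simp) c, rfl⟩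

/-- Subtracting f from its mean leaves zero mean, the solvability condition for the
lowest-dimensional preimages below. -/
lemma Good.ip_incl_proj_sub {d k : ℕ} {P : Set E3} (hP : Good d P) (f : PolyOn k P) (c : ℝ) :
    ip d ((PolyhedralMesh.incl k (proj d _ (f : P → ℝ)) - f : PolyOn k P) : P → ℝ)
      (restr P (MvPolynomial.C c)) = 0 := by
  refine (hP.ip_sub_left (hP.PolyOn_le ((0 : ℕ) : ℤ) (Subtype.prop _)) (hP.PolyOn_le k f.2)
    (restr_mem_BC hP.bounded _)).trans ?_
  rw [hP.ip_proj_C, sub_self]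

lemma Good.ip_eq_zero_of_proj {H : Type*} [NormedAddCommGroup H] [InnerProductSpace ℝ H] {d : ℕ}
    {P : Set E3} (hP : Good d P) {S : Submodule ℝ (P → H)}
    [FiniteDimensional ℝ S] (hS : S ≤ BC P H) {f : P → H} (hf : f ∈ BC P H)
    (h : proj d S f = 0) {s : P → H} (hs : s ∈ S) : ip d f s = 0 := by
  rw [← hP.ip_proj hS hf hs, h, ZeroMemClass.coe_zero, ip_zero_left]

lemma exists_eq_C_of_mem_Pol_zero {p : P3} (hp : p ∈ Pol ((0 : ℕ) : ℤ)) :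
    ∃ c, p = MvPolynomial.C c := by
  obtain ⟨c, hc⟩ := eq_C_of_mem_Pol_zero (p := p) (by simpa using hp)
  exact ⟨c, hc⟩

namespace PolyhedralMesh

variable {Ω : Set E3} {𝒯 ℱ ℰ 𝒱 : Type*} [Fintype 𝒯] [Fintype ℱ] [Fintype ℰ] [Fintype 𝒱]
variable (M : PolyhedralMesh Ω 𝒯 ℱ ℰ 𝒱)

/-! ## Exactness at the end of the complex -/

/-- The difference s has zero mean on each element, so p ↦ -∫ s p depends only on grad p and is
represented in G. With zero face fluxes the divergence is exactly s. -/
theorem exists_divH_eq (k : ℕ) (r : M.PolyTh k) :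
    ∃ w : M.Xdiv k, M.inclTh k (M.π0 k r) - r = M.divH k w := by
  set s : M.PolyTh k := M.inclTh k (M.π0 k r) - r with hs
  have h0 : ∀ T c, ip 3 (s T : M.elem T → ℝ) (restr (M.elem T) (MvPolynomial.C c)) = 0 :=
    fun T c => (M.good_elem T).ip_incl_proj_sub (r T) c
  have h1 : ∀ T, ∃ g : M.GolOnT T ((k : ℤ) - 1), ∀ p ∈ Pol k,
      ip 3 (g : M.elem T → E3) (restrV (M.elem T) (grad p))
        = - ip 3 (s T : M.elem T → ℝ) (restr (M.elem T) p) := fun T => by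
    refine (M.good_elem T).exists_rep' ((M.good_elem T).VOn_le _) (Pol k)
      (restrV (M.elem T) ∘ₗ grad) (isLin_neg ((M.good_elem T).isLin_restr (M.bcT (s T))))
      (fun p hp => ⟨_, ⟨p, sub_one_add_one_mem hp, rfl⟩, rfl⟩) fun p _ h => ?_
    obtain ⟨c, rfl⟩ := eq_C_of_grad_eq_zero (M.eq_zero_of_elemV h)
    rw [h0, neg_zero]
  choose g hg using h1
  refine ⟨(fun T => (g T, 0), 0), ?_⟩
  funext T
  refine Subtype.ext ((M.good_elem T).ext ((M.good_elem T).PolyOn_le k) (s T).2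
    (M.dT k (fun T => (g T, 0), 0) T).2 ?_)
  rintro _ ⟨p, hp, rfl⟩
  have h2 := M.dT_spec k (fun T => (g T, 0), 0) T hp
  rw [hg T p hp, neg_neg] at h2
  refine (h2.trans ?_).symm
  simp [bdryDivT]

/-! ## Exactness at the discrete divergence space -/

/-- Tested against constants, the divergence sees only the face averages, which reduction preserves.
-/
lemma dT_Rdiv (k : ℕ) {w : M.Xdiv k} (T : 𝒯) (h : M.dT k w T = 0) :
    M.dT 0 (M.Rdiv k w) T = 0 := by
  refine Subtype.ext ((M.good_elem T).ext ((M.good_elem T).PolyOn_le _) (Subtype.prop _)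
    (zero_mem _) ?_)
  rintro _ ⟨p, hp, rfl⟩
  obtain ⟨c, rfl⟩ := exists_eq_C_of_mem_Pol_zero hp
  have h1 := M.ip_dT_C k w T c
  rw [h] at h1
  rw [M.ip_dT_C, ZeroMemClass.coe_zero, ip_zero_left]
  rw [ZeroMemClass.coe_zero, ip_zero_left] at h1
  rw [h1]
  refine Finset.sum_congr rfl fun F _ => ?_
  congr 1
  exact (M.good_face F).ip_proj_C (w.2 F) c

lemma bdryDivT_sub (k : ℕ) (w : ∀ F, PolyOn ((0 : ℕ) : ℤ) (M.face F))
    (w' : ∀ F, PolyOn k (M.face F)) (T : 𝒯) (r : P3) :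
    M.bdryDivT k (fun F => incl k (w F) - w' F) T r = M.bdryDivT 0 w T r - M.bdryDivT k w' T r := by
  rw [bdryDivT, bdryDivT, bdryDivT, ← Finset.sum_sub_distrib]
  refine Finset.sum_congr rfl fun F _ => ?_
  rw [← mul_sub]
  congr 1
  exact (M.good_face F).ip_sub_left (M.bcF (w F)) (M.bcF (w' F))
    (restr_mem_BC (M.good_face F).bounded _)

lemma grad_cross_cst (r : P3) (n : E3) : grad r ⨯₃ cst n = rotTan n r := (rotTan_eq n r).symm

theorem exists_curlH_eq (k : ℕ) (w : M.Xdiv k) (hw : M.divH k w = 0) :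
    ∃ v : M.Xcurl k, M.Ediv k (M.Rdiv k w) - w = M.curlH k v := by
  have hd : ∀ T, M.dT k w T = 0 := fun T => congrFun hw T
  set u : M.Xdiv k := M.Ediv k (M.Rdiv k w) - w with hu
  have h0 : ∀ F c, ip 2 (u.2 F : M.face F → ℝ) (restr (M.face F) (MvPolynomial.C c)) = 0 :=
    fun F c => (M.good_face F).ip_incl_proj_sub (w.2 F) c
  -- With zero edge components, this choice makes the face curl equal to the flux u_F; zero mean
  -- settles the kernel of rot_F.
  have hF : ∀ F, ∃ g : M.RolOnF F ((k : ℤ) - 1), ∀ r ∈ Pol k,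
      ip 2 (g : M.face F → E3) (restrV (M.face F) (rotTan (M.normal F) r))
        = ip 2 (u.2 F : M.face F → ℝ) (restr (M.face F) r) := fun F => by
    refine (M.good_face F).exists_rep' ((M.good_face F).VOn_le _) (Pol k)
      (restrV (M.face F) ∘ₗ rotTan (M.normal F)) ((M.good_face F).isLin_restr (M.bcF (u.2 F)))
      (fun p hp => ⟨_, ⟨p, sub_one_add_one_mem hp, rfl⟩, rfl⟩) fun p _ h => ?_
    rw [restr_congr.2 fun x hx => M.ev_eq_of_restrV_rotTan h x (M.face_subset F hx), h0]
  choose g hg using hF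
  set vF : M.XcurlF k := (fun F => (g F, 0), 0) with hvF
  have hvE : ∀ F r, M.bdryCurlF k vF.2 F r = 0 := fun F r => by simp [bdryCurlF, hvF]
  have hcF : ∀ F, M.cF k vF F = u.2 F := fun F => by
    refine Subtype.ext ((M.good_face F).ext ((M.good_face F).PolyOn_le k) (Subtype.prop _)
      (Subtype.prop _) ?_)
    rintro _ ⟨r, hr, rfl⟩
    rw [M.cF_spec k _ F hr, hvE, sub_zero]
    exact hg F r hr
  -- Prescribes the part of the element curl in the Koszul complement; there is no condition, since
  -- curl is injective there.
  have hT : ∀ T, ∃ g : M.RolOnT T ((k : ℤ) - 1), ∀ z ∈ M.cGolT T k,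
      ip 3 (g : M.elem T → E3) (restrV (M.elem T) (curl z))
        = ip 3 ((u.1 T).2 : M.elem T → E3) (restrV (M.elem T) z) - M.bdryCurlT k vF T z :=
    fun T => by
    have hlin := isLin_sub ((M.good_elem T).isLin_restrV (M.bcVT (u.1 T).2))
      (M.bdryCurlT_isLinear k vF T)
    refine (M.good_elem T).exists_rep' ((M.good_elem T).VOn_le _) (M.cGolT T k)
      (restrV (M.elem T) ∘ₗ curl) hlin (fun z hz => ⟨_, M.curl_cGolT_mem hz, rfl⟩) fun z hz h => ?_
    rw [M.eq_zero_of_curl_cGolT hz h]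
    exact hlin.map_zero
  choose f hf using hT
  set v : M.Xcurl k := (fun T => (f T, 0), vF) with hv
  refine ⟨v, Prod.ext (funext fun T => Prod.ext ?_ ?_) (funext fun F => (hcF F).symm)⟩
  · refine ((M.good_elem T).proj_eq ((M.good_elem T).VOn_le _) (M.bcVT _) _ ?_).symm
    rintro _ ⟨_, ⟨r, hr, rfl⟩, rfl⟩
    rw [sub_add_cancel] at hr
    have h1 := M.EgolT_spec k (M.Rdiv k w) T hr
    have h2 := M.dT_spec k w T hr
    rw [hd, ZeroMemClass.coe_zero, ip_zero_left] at h2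
    rw [M.dT_Rdiv k T (hd T), ZeroMemClass.coe_zero, ip_zero_left, neg_zero, zero_add] at h1
    -- Both w and its reduction are divergence free, so the gradient part of u is determined by the
    -- fluxes of u.
    have h3 : ip 3 ((u.1 T).1 : M.elem T → E3) (restrV (M.elem T) (grad r))
        = M.bdryDivT k u.2 T r := by
      refine ((M.good_elem T).ip_sub_left (M.bcVT _) (M.bcVT _)
        (restrV_mem_BC (M.good_elem T).bounded _)).trans ?_
      refine (congrArg (· - _) h1).trans ?_
      have h4 := M.bdryDivT_sub k (M.Rdiv k w).2 w.2 T r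
      change M.bdryDivT k u.2 T r = _ at h4
      rw [h4]
      linarith
    rw [h3, M.cT_spec k v T (VPol_mono (by linarith) (grad_mem (sub_one_add_one_mem hr))), curl_grad,
      map_zero, ip_zero_right, zero_add]
    -- On a face, grad r × n_F = rot_F r. Tested against it, the tangential trace gives ∫ u_F r,
    -- because the edge components vanish.
    refine Finset.sum_congr rfl fun F _ => ?_
    congr 1
    have h5 := M.γtF_spec k vF F (Pol_mono (by linarith) hr) (zero_mem (M.cRolF F k))
    rw [add_zero, map_zero, ip_zero_right, add_zero, hvE, add_zero, hcF] at h5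
    rw [grad_cross_cst]
    exact h5
  · refine ((M.good_elem T).proj_eq ((M.good_elem T).VOn_le _) (M.bcVT _) _ ?_).symm
    rintro _ ⟨z, hz, rfl⟩
    rw [M.cT_spec k v T (M.cGolT_le T _ hz), hf T z hz, sub_add_cancel]

end PolyhedralMesh


lemma cst_dotProduct_cst (a b : E3) : cst a ⬝ᵥ cst b = MvPolynomial.C (inner ℝ a b) := by
  rw [dotProduct_three, inner_three]
  simp only [cst_apply, map_add, map_mul]

lemma divTan_add (n : E3) (v w : V3) : divTan n (v + w) = divTan n v + divTan n w :=
  (divTanL n).map_add v w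

namespace PolyhedralMesh

variable {Ω : Set E3} {𝒯 ℱ ℰ 𝒱 : Type*} [Fintype 𝒯] [Fintype ℱ] [Fintype ℰ] [Fintype 𝒱]
variable (M : PolyhedralMesh Ω 𝒯 ℱ ℰ 𝒱)

/-! ## Further identities for the discrete gradient -/

lemma cross_dotProduct_normalFE {F : ℱ} {E : ℰ} (h : E ∈ M.edgesOf F) (z : V3) :
    (z ⨯₃ cst (M.normal F)) ⬝ᵥ cst (M.normalFE F E) = -(z ⬝ᵥ cst (M.tangent E)) := by
  have h1 : cst (M.normalFE F E) = cst (M.normal F) ⨯₃ cst (M.tangent E) := by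
    refine vec3_ext ?_ ?_ ?_ <;>
    simp [normalFE_eq, cr_zero, cr_one, cr_two, cross_apply, cst_apply]
  rw [h1, cross_dot_cross, cst_dotProduct_cst, cst_dotProduct_cst, M.inner_normal_tangent h,
    real_inner_self_eq_norm_sq, M.normal_norm]
  simp

lemma rotTan_dotProduct_normalFE {F : ℱ} {E : ℰ} (h : E ∈ M.edgesOf F) (r : P3) :
    rotTan (M.normal F) r ⬝ᵥ cst (M.normalFE F E) = -dirDeriv (M.tangent E) r := by
  rw [rotTan_eq, M.cross_dotProduct_normalFE h, dirDeriv, dotProduct_comm]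

lemma ip_restr_neg {d : ℕ} {P : Set E3} (f : P → ℝ) (p : P3) :
    ip d f (restr P (-p)) = -ip d f (restr P p) := by
  rw [← neg_one_smul ℝ p, map_smul, ip_smul_right, neg_one_mul]

/-- As rot_F r · n_FE = -∂_t r, integrating by parts on each edge brings in the edge gradients. -/
lemma bdryGradF_rotTan (k : ℕ) (q : M.XgradE k) (F : ℱ) (r : P3) :
    M.bdryGradF k q F (rotTan (M.normal F) r) = ∑ E ∈ M.edgesOf F, M.ωFE F E *
      (ip 1 (M.gE k q E : M.edge E → ℝ) (restr (M.edge E) r)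
        - q.2 (M.tgt E) * ev (M.vert (M.tgt E)) r + q.2 (M.src E) * ev (M.vert (M.src E)) r) := by
  refine Finset.sum_congr rfl fun E hE => ?_
  rw [M.rotTan_dotProduct_normalFE hE, ip_restr_neg, M.gE_green]
  ring

lemma gF_rotTan (k : ℕ) (q : M.XgradF k) (F : ℱ) {r : P3} (hr : r ∈ Pol ((k : ℤ) + 1)) :
    ip 2 (M.gF k q F : M.face F → E3) (restrV (M.face F) (rotTan (M.normal F) r))
      = M.bdryGradF k q.2 F (rotTan (M.normal F) r) := by
  obtain ⟨h1, h2⟩ := rotTan_mem (n := M.normal F) hr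
  rw [M.gF_spec k q F h1 fun x _ => by rw [h2, map_zero], divTan_rotTan, map_zero, ip_zero_right,
    neg_zero, zero_add]

lemma exists_rotTan_add_cRolF (F : ℱ) {l : ℤ} {v : V3} (hv : v ∈ VPolTan (M.normal F) l) :
    ∃ r ∈ Pol (l + 1), ∃ w ∈ M.cRolF F l, ∀ x ∈ M.planeF F, ∀ i,
      ev x (v i) = ev x ((rotTan (M.normal F) r + w) i) := by
  obtain ⟨r, hr, p, hp, h⟩ := exists_rotTan_add_posMul (M.normal_norm F) (M.centerF F) hv
  exact ⟨r, hr, _, ⟨p, hp, rfl⟩, h⟩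

/-- The trace is defined by testing with Koszul fields only. For the rotated part of v both sides
vanish, because rotations are divergence free (`gF_rotTan`). -/
lemma γF_divTan (k : ℕ) (q : M.XgradF k) (F : ℱ) {v : V3} (hv : v ∈ VPolTan (M.normal F) k) :
    ip 2 (M.γF k q F : M.face F → ℝ) (restr (M.face F) (divTan (M.normal F) v))
      = - ip 2 (M.gF k q F : M.face F → E3) (restrV (M.face F) v) + M.bdryGradF k q.2 F v := by
  obtain ⟨r, hr, w, hw, h⟩ := M.exists_rotTan_add_cRolF F hv
  have hg := M.good_face F
  rw [M.divTan_congr h, M.bdryGradF_congr k q.2 h,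
    restrV_congr.2 fun x hx => h x (M.face_subset F hx), divTan_add, divTan_rotTan, zero_add,
    M.γF_spec k q F (M.cRolF_mono F (by linarith) hw), (M.bdryGradF_isLinear k q.2 F).map_add,
    map_add, hg.ip_add_right (M.bcVF _) (restrV_mem_BC hg.bounded _) (restrV_mem_BC hg.bounded _),
    M.gF_rotTan k q F hr]
  ring

lemma cross_cst_mem_VPolTan {z : V3} {l : ℤ} (hz : z ∈ VPol l) (n : E3) :
    z ⨯₃ cst n ∈ VPolTan n l := by
  refine ⟨cross_cst_mem hz n, ?_⟩
  rw [dotProduct_comm, dot_cross_self]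

/-- The element gradient tested against curls involves only the face gradients. -/
lemma gT_curl (k : ℕ) (q : M.Xgrad k) (T : 𝒯) {z : V3} (hz : z ∈ VPol k) :
    ip 3 (M.gT k q T : M.elem T → E3) (restrV (M.elem T) (curl z))
      = - ∑ F ∈ M.facesOf T, M.ωTF T F *
        ip 2 (M.gF k q.2 F : M.face F → E3) (restrV (M.face F) (z ⨯₃ cst (M.normal F))) := by
  rw [M.gT_spec k q T (VPol_mono (by linarith) (curl_mem hz)), div_curl, map_zero, ip_zero_right,
    neg_zero, zero_add, bdryGradT]
  -- The edge traces weighted by the tangential component of z are the same, up to orientation, seen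
  -- from all faces sharing an edge.
  have h1 := M.sum_boundary_boundary T fun E =>
    -ip 1 (M.γE k q.2.2 E : M.edge E → ℝ) (restr (M.edge E) (z ⬝ᵥ cst (M.tangent E)))
  have h2 : ∀ F, ∑ E ∈ M.edgesOf F, M.ωFE F E *
      -ip 1 (M.γE k q.2.2 E : M.edge E → ℝ) (restr (M.edge E) (z ⬝ᵥ cst (M.tangent E)))
      = M.bdryGradF k q.2.2 F (z ⨯₃ cst (M.normal F)) := fun F => by
    refine Finset.sum_congr rfl fun E hE => ?_
    rw [M.cross_dotProduct_normalFE hE, ip_restr_neg]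
  simp only [h2] at h1
  rw [← Finset.sum_neg_distrib, ← sub_eq_zero, ← Finset.sum_sub_distrib, ← h1]
  refine Finset.sum_congr rfl fun F _ => ?_
  rw [← divTan_cross_cst, M.γF_divTan k q.2 F (cross_cst_mem_VPolTan hz _)]
  ring

/-! ## Exactness at the discrete curl space -/

lemma bdryCurlF_sub (k : ℕ) (v : ∀ E, PolyOn ((0 : ℕ) : ℤ) (M.edge E))
    (v' : ∀ E, PolyOn k (M.edge E)) (F : ℱ) (r : P3) :
    M.bdryCurlF k (fun E => incl k (v E) - v' E) F r
      = M.bdryCurlF 0 v F r - M.bdryCurlF k v' F r := by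
  rw [bdryCurlF, bdryCurlF, bdryCurlF, ← Finset.sum_sub_distrib]
  refine Finset.sum_congr rfl fun E _ => ?_
  rw [← mul_sub]
  congr 1
  exact (M.good_edge E).ip_sub_left (M.bcE (v E)) (M.bcE (v' E))
    (restr_mem_BC (M.good_edge E).bounded _)

lemma cF_Rcurl (k : ℕ) {v : M.Xcurl k} (F : ℱ) (h : M.cF k v.2 F = 0) :
    M.cF 0 (M.Rcurl k v).2 F = 0 := by
  refine Subtype.ext ((M.good_face F).ext ((M.good_face F).PolyOn_le _) (Subtype.prop _)
    (zero_mem _) ?_)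
  rintro _ ⟨p, hp, rfl⟩
  obtain ⟨c, rfl⟩ := exists_eq_C_of_mem_Pol_zero hp
  have h1 := M.ip_cF_C k v.2 F c
  rw [h] at h1
  rw [M.ip_cF_C, ZeroMemClass.coe_zero, ip_zero_left]
  rw [ZeroMemClass.coe_zero, ip_zero_left] at h1
  rw [h1]
  congr 1
  refine Finset.sum_congr rfl fun E _ => ?_
  congr 1
  exact (M.good_edge E).ip_proj_C (v.2.2 E) c

/-- For a closed field, the identity defining the extension in R says that the face curl of degree k
vanishes. -/
lemma cF_EcurlF (k : ℕ) {v : M.XcurlF 0} (F : ℱ) (h : M.cF 0 v F = 0) :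
    M.cF k (M.EcurlF k v) F = 0 := by
  refine Subtype.ext ((M.good_face F).ext ((M.good_face F).PolyOn_le _) (Subtype.prop _)
    (zero_mem _) ?_)
  rintro _ ⟨p, hp, rfl⟩
  rw [M.cF_spec k _ F hp, ZeroMemClass.coe_zero, ip_zero_left]
  have h1 := M.ErolF_spec k v F hp
  rw [h, ZeroMemClass.coe_zero, ip_zero_left, zero_add] at h1
  exact sub_eq_zero.2 h1

/-- The boundary terms of a closed field vanish on gradients. -/
lemma bdryCurlT_grad (k : ℕ) {v : M.XcurlF k} (h : ∀ F, M.cF k v F = 0) (T : 𝒯) {r : P3}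
    (hr : r ∈ Pol ((k : ℤ) + 1)) : M.bdryCurlT k v T (grad r) = 0 := by
  rw [← M.sum_boundary_boundary T fun E => ip 1 (v.2 E : M.edge E → ℝ) (restr (M.edge E) r)]
  refine Finset.sum_congr rfl fun F _ => ?_
  congr 1
  have h5 := M.γtF_spec k v F hr (zero_mem (M.cRolF F k))
  rw [add_zero, map_zero, ip_zero_right, add_zero, h, ZeroMemClass.coe_zero, ip_zero_left,
    zero_add] at h5
  rw [grad_cross_cst]
  exact h5

/-- Constant fields are gradients of affine functions, so at degree 0 the test with gradients is
enough. -/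
lemma cT_Rcurl (k : ℕ) {v : M.Xcurl k} (T : 𝒯) (h : ∀ F, M.cF k v.2 F = 0) :
    M.cT 0 (M.Rcurl k v) T = 0 := by
  refine Subtype.ext ((M.good_elem T).ext ((M.good_elem T).VOn_le _) (Subtype.prop _)
    (zero_mem _) ?_)
  rintro _ ⟨w, hw, rfl⟩
  rw [M.cT_spec 0 _ T hw, ZeroMemClass.coe_zero, ip_zero_left]
  obtain ⟨r, hr, _, ⟨z, hz, rfl⟩, rfl⟩ := exists_grad_add_posCross (M.centerT T) hw
  have hz0 : z = 0 := by
    funext i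
    have := mem_VPol.1 hz i
    rwa [Pol_eq_bot (by norm_num), Submodule.mem_bot] at this
  rw [hz0, map_zero, add_zero, curl_grad, map_zero, ip_zero_right, zero_add]
  exact M.bdryCurlT_grad 0 (fun F => M.cF_Rcurl k F (h F)) T hr

/-- Primitives are chosen on edges, then face and element components are chosen to match the Koszul
parts. The parts in R follow from closedness on faces, and on elements from `gT_curl` together with
`hγ`: the difference of the tangential traces of E R v and v is the face gradient of q. -/
theorem exists_gradH_eq (k : ℕ) (v : M.Xcurl k) (hv : M.curlH k v = 0) :
    ∃ q : M.Xgrad k, M.Ecurl k (M.Rcurl k v) - v = M.gradH k q := by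
  have hc : ∀ F, M.cF k v.2 F = 0 := fun F => congrFun (congrArg Prod.snd hv) F
  have hc0 : ∀ F, M.cF 0 (M.Rcurl k v).2 F = 0 := fun F => M.cF_Rcurl k F (hc F)
  have hcE : ∀ F, M.cF k (M.EcurlF k (M.Rcurl k v).2) F = 0 := fun F => M.cF_EcurlF k F (hc0 F)
  -- For the elements only this half of the kernel condition enters, as the extension is defined by
  -- the same test fields.
  have hcT : ∀ T, ∀ z ∈ M.cGolT T k,
      ip 3 (M.cT k v T : M.elem T → E3) (restrV (M.elem T) z) = 0 := fun T z hz => by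
    have h1 := congrArg Prod.snd (congrFun (congrArg Prod.fst hv) T)
    exact (M.good_elem T).ip_eq_zero_of_proj ((M.good_elem T).VOn_le _) (M.bcVT _) h1 ⟨z, hz, rfl⟩
  set u : M.Xcurl k := M.Ecurl k (M.Rcurl k v) - v with hu
  have huE : ∀ F r, M.bdryCurlF k u.2.2 F r
      = M.bdryCurlF 0 (M.Rcurl k v).2.2 F r - M.bdryCurlF k v.2.2 F r :=
    fun F r => M.bdryCurlF_sub k (M.Rcurl k v).2.2 v.2.2 F r
  -- edges
  have h0 : ∀ E c, ip 1 (u.2.2 E : M.edge E → ℝ) (restr (M.edge E) (MvPolynomial.C c)) = 0 :=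
    fun E c => (M.good_edge E).ip_incl_proj_sub (v.2.2 E) c
  have hE : ∀ E, ∃ g : PolyOn ((k : ℤ) - 1) (M.edge E), ∀ r ∈ Pol k,
      ip 1 (g : M.edge E → ℝ) (restr (M.edge E) (dirDeriv (M.tangent E) r))
        = - ip 1 (u.2.2 E : M.edge E → ℝ) (restr (M.edge E) r) := fun E => by
    refine (M.good_edge E).exists_rep' ((M.good_edge E).PolyOn_le _) (Pol k)
      (restr (M.edge E) ∘ₗ dirDerivL (M.tangent E))
      (isLin_neg ((M.good_edge E).isLin_restr (M.bcE (u.2.2 E))))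
      (fun r hr => ⟨_, dirDeriv_mem hr, rfl⟩) fun r _ h => ?_
    have h1 := exists_ev_eq_of_dirDeriv h
    rw [map_sub, sub_eq_zero] at h1
    rw [h1, h0, neg_zero]
  choose qe hqe using hE
  -- Vertex values are zero, which agrees with the zero mean of u on edges and removes the vertex
  -- terms.
  set qE : M.XgradE k := (qe, 0) with hqE
  have hgE : ∀ E, M.gE k qE E = u.2.2 E := fun E => by
    refine Subtype.ext ((M.good_edge E).ext ((M.good_edge E).PolyOn_le k) (Subtype.prop _)
      (Subtype.prop _) ?_)
    rintro _ ⟨r, hr, rfl⟩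
    rw [M.gE_spec k _ E hr]
    refine Eq.trans ?_ (neg_eq_iff_eq_neg.2 (hqe E r hr))
    simp [hqE]
  have hbF : ∀ F r, M.bdryGradF k qE F (rotTan (M.normal F) r) = M.bdryCurlF k u.2.2 F r :=
    fun F r => by
    rw [bdryGradF_rotTan]
    refine Finset.sum_congr rfl fun E _ => ?_
    rw [hgE]
    simp [hqE]
  -- faces
  have hF : ∀ F, ∃ g : PolyOn ((k : ℤ) - 1) (M.face F), ∀ w ∈ M.cRolF F k,
      ip 2 (g : M.face F → ℝ) (restr (M.face F) (divTan (M.normal F) w))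
        = M.bdryGradF k qE F w
          - ip 2 ((u.2.1 F).2 : M.face F → E3) (restrV (M.face F) w) := fun F => by
    refine (M.good_face F).exists_rep' ((M.good_face F).PolyOn_le _) (M.cRolF F k)
      (restr (M.face F) ∘ₗ divTanL (M.normal F))
      (isLin_sub (M.bdryGradF_isLinear k qE F)
        ((M.good_face F).isLin_restrV (M.bcVF (u.2.1 F).2)))
      (fun w hw => ⟨_, divTan_mem (M.cRolF_le F _ hw), rfl⟩) fun w hw h => ?_
    have h1 := M.ev_eq_zero_of_divTan hw h
    rw [M.bdryGradF_eq_zero k _ h1, restrV_eq_zero.2 fun x hx => h1 x (M.face_subset F hx)]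
    simp
  choose qf hqf using hF
  set qF : M.XgradF k := (qf, qE) with hqF
  have hgFc : ∀ F, ∀ w ∈ M.cRolF F k,
      ip 2 (M.gF k qF F : M.face F → E3) (restrV (M.face F) w)
        = ip 2 ((u.2.1 F).2 : M.face F → E3) (restrV (M.face F) w) := fun F w hw => by
    rw [M.gF_spec k qF F (M.cRolF_le F _ hw) fun x hx => M.ev_cRolF_dotProduct hw hx, hqf F w hw]
    ring
  have hgFr : ∀ F, ∀ r ∈ Pol ((k : ℤ) + 1),
      ip 2 (M.gF k qF F : M.face F → E3) (restrV (M.face F) (rotTan (M.normal F) r))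
        = M.bdryCurlF k u.2.2 F r := fun F r hr => by
    rw [M.gF_rotTan k qF F hr, ← hbF]
  -- tangential traces
  have hγ : ∀ F, ∀ z ∈ VPolTan (M.normal F) k,
      ip 2 (M.γtF k (M.EcurlF k (M.Rcurl k v).2) F : M.face F → E3) (restrV (M.face F) z)
        - ip 2 (M.γtF k v.2 F : M.face F → E3) (restrV (M.face F) z)
        = ip 2 (M.gF k qF F : M.face F → E3) (restrV (M.face F) z) := fun F z hz => by
    obtain ⟨r, hr, w, hw, h⟩ := M.exists_rotTan_add_cRolF F hz
    have hg := M.good_face F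
    rw [restrV_congr.2 fun x hx => h x (M.face_subset F hx), M.γtF_spec k _ F hr hw,
      M.γtF_spec k _ F hr hw, hc, hcE, map_add, hg.ip_add_right (M.bcVF _)
      (restrV_mem_BC hg.bounded _) (restrV_mem_BC hg.bounded _), hgFr F r hr, hgFc F w hw, huE]
    have h1 : ip 2 ((u.2.1 F).2 : M.face F → E3) (restrV (M.face F) w)
        = ip 2 (((M.EcurlF k (M.Rcurl k v).2).1 F).2 : M.face F → E3) (restrV (M.face F) w)
          - ip 2 ((v.2.1 F).2 : M.face F → E3) (restrV (M.face F) w) :=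
      hg.ip_sub_left (M.bcVF _) (M.bcVF _) (restrV_mem_BC hg.bounded _)
    have h2 : M.bdryCurlF k (M.EcurlF k (M.Rcurl k v).2).2 F r
      = M.bdryCurlF 0 (M.Rcurl k v).2.2 F r := rfl
    rw [h1, h2, ZeroMemClass.coe_zero, ip_zero_left]
    ring
  -- elements
  have hT : ∀ T, ∃ g : PolyOn ((k : ℤ) - 1) (M.elem T), ∀ w ∈ M.cRolT T k,
      ip 3 (g : M.elem T → ℝ) (restr (M.elem T) (div w))
        = M.bdryGradT k qF T w
          - ip 3 ((u.1 T).2 : M.elem T → E3) (restrV (M.elem T) w) := fun T => by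
    have hlin := isLin_sub (M.bdryGradT_isLinear k qF T)
      ((M.good_elem T).isLin_restrV (M.bcVT (u.1 T).2))
    refine (M.good_elem T).exists_rep' ((M.good_elem T).PolyOn_le _) (M.cRolT T k)
      (restr (M.elem T) ∘ₗ divL) hlin
      (fun w hw => ⟨_, div_mem (M.cRolT_le T _ hw), rfl⟩) fun w hw h => ?_
    obtain ⟨p, -, rfl⟩ := hw
    rw [eq_zero_of_div_posMul (M.eq_zero_of_elem h), map_zero]
    exact hlin.map_zero
  choose qt hqt using hT
  set q : M.Xgrad k := (qt, qF) with hq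
  refine ⟨q, Prod.ext (funext fun T => Prod.ext ?_ ?_)
    (Prod.ext (funext fun F => Prod.ext ?_ ?_) (funext fun E => (hgE E).symm))⟩
  · refine ((M.good_elem T).proj_eq ((M.good_elem T).VOn_le _) (M.bcVT _) _ ?_).symm
    rintro _ ⟨_, ⟨w, hw, rfl⟩, rfl⟩
    rw [sub_add_cancel] at hw
    -- Curls do not see the gradient part, so z may be taken in the Koszul complement, where the
    -- extension and `hcT` are available.
    obtain ⟨r, -, z, hz, rfl⟩ := exists_grad_add_posCross (M.centerT T) hw
    have hz' : z ∈ M.cGolT T k := hz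
    have hg := M.good_elem T
    rw [map_add, curl_grad, zero_add, M.gT_curl k q T (M.cGolT_le T _ hz')]
    have h1 : ip 3 ((u.1 T).1 : M.elem T → E3) (restrV (M.elem T) (curl z))
        = ip 3 (M.ErolT k (M.Rcurl k v) T : M.elem T → E3) (restrV (M.elem T) (curl z))
          - ip 3 ((v.1 T).1 : M.elem T → E3) (restrV (M.elem T) (curl z)) :=
      hg.ip_sub_left (M.bcVT _) (M.bcVT _) (restrV_mem_BC hg.bounded _)
    have h2 := M.cT_spec k v T (M.cGolT_le T _ hz')
    rw [hcT T z hz'] at h2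
    rw [h1, M.ErolT_spec k _ T hz', M.cT_Rcurl k T hc, ZeroMemClass.coe_zero, ip_zero_left,
      zero_sub, ← sub_eq_zero]
    have h3 : M.bdryCurlT k (M.EcurlF k (M.Rcurl k v).2) T z - M.bdryCurlT k v.2 T z
        = ∑ F ∈ M.facesOf T, M.ωTF T F *
          ip 2 (M.gF k q.2 F : M.face F → E3) (restrV (M.face F) (z ⨯₃ cst (M.normal F))) := by
      rw [bdryCurlT, bdryCurlT, ← Finset.sum_sub_distrib]
      refine Finset.sum_congr rfl fun F _ => ?_
      rw [← mul_sub, hγ F _ (cross_cst_mem_VPolTan (M.cGolT_le T _ hz') _)]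
    rw [← h3]
    linarith
  · refine ((M.good_elem T).proj_eq ((M.good_elem T).VOn_le _) (M.bcVT _) _ ?_).symm
    rintro _ ⟨w, hw, rfl⟩
    rw [M.gT_spec k q T (M.cRolT_le T _ hw), hqt T w hw]
    ring
  · refine ((M.good_face F).proj_eq ((M.good_face F).VOn_le _) (M.bcVF _) _ ?_).symm
    rintro _ ⟨_, ⟨r, hr, rfl⟩, rfl⟩
    rw [sub_add_cancel] at hr
    have hg := M.good_face F
    refine (hgFr F r (Pol_mono (by linarith) hr)).trans ?_
    have h1 : ip 2 ((u.2.1 F).1 : M.face F → E3) (restrV (M.face F) (rotTan (M.normal F) r))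
        = ip 2 (M.ErolF k (M.Rcurl k v).2 F : M.face F → E3)
            (restrV (M.face F) (rotTan (M.normal F) r))
          - ip 2 ((v.2.1 F).1 : M.face F → E3) (restrV (M.face F) (rotTan (M.normal F) r)) :=
      hg.ip_sub_left (M.bcVF _) (M.bcVF _) (restrV_mem_BC hg.bounded _)
    have h2 := M.cF_spec k v.2 F hr
    rw [hc, ZeroMemClass.coe_zero, ip_zero_left] at h2
    refine Eq.trans ?_ h1.symm
    rw [M.ErolF_spec k _ F hr, hc0, ZeroMemClass.coe_zero, ip_zero_left, huE]
    linarith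
  · refine ((M.good_face F).proj_eq ((M.good_face F).VOn_le _) (M.bcVF _) _ ?_).symm
    rintro _ ⟨w, hw, rfl⟩
    exact hgFc F w hw

end PolyhedralMesh


lemma eq_zero_of_mem_PolyOn {l : ℤ} (hl : l < 0) {P : Set E3} {f : P → ℝ} (hf : f ∈ PolyOn l P) :
    f = 0 := by
  obtain ⟨p, hp, rfl⟩ := hf
  rw [Pol_eq_bot hl] at hp
  rw [(Submodule.mem_bot ℝ).1 hp, map_zero]

lemma eq_cst_of_mem_VPol_zero {z : V3} (hz : z ∈ VPol ((0 : ℕ) : ℤ)) : ∃ a, z = cst a := by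
  choose a ha using fun i => exists_eq_C_of_mem_Pol_zero (mem_VPol.1 hz i)
  exact ⟨WithLp.toLp 2 a, funext ha⟩

lemma div_cst (a : E3) : div (cst a) = 0 := by
  simp [div, cst_apply]

lemma cst_mem_VPol (a : E3) {l : ℤ} (hl : 0 ≤ l) : cst a ∈ VPol l :=
  mem_VPol.2 fun i => C_mem hl (a i)

lemma exists_curl_eq_cst (a : E3) : ∃ y ∈ VPol 1, curl y = cst a := by
  -- For a constant vector b, curl(x × b) = -2b.
  refine ⟨posCross 0 (cst (-(1 / 2 : ℝ) • a)), posCross_mem (l := 0) (cst_mem_VPol _ le_rfl) 0, ?_⟩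
  have h : ∀ b : ℝ, (MvPolynomial.C b : P3) = MvPolynomial.C (1 / 2 * b) + MvPolynomial.C (1 / 2 * b) :=
    fun b => by rw [← map_add]; congr 1; ring
  refine vec3_ext ?_ ?_ ?_ <;>
  · rw [cst_apply, h]
    simp [curl, posCross_apply, pos, cst_apply, cross_apply, MvPolynomial.pderiv_X]

namespace PolyhedralMesh

variable {Ω : Set E3} {𝒯 ℱ ℰ 𝒱 : Type*} [Fintype 𝒯] [Fintype ℱ] [Fintype ℰ] [Fintype 𝒱]
variable (M : PolyhedralMesh Ω 𝒯 ℱ ℰ 𝒱)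

/-! ## Exactness at the discrete gradient space -/

lemma vert_eq_of_gE {k : ℕ} {q : M.XgradE k} {E : ℰ} (h : M.gE k q E = 0) :
    q.2 (M.tgt E) = q.2 (M.src E) := by
  have h1 := M.gE_spec k q E (C_mem (by simp) 1)
  rw [h, dirDeriv_C, map_zero, ip_zero_right, ZeroMemClass.coe_zero, ip_zero_left, ev_C, ev_C] at h1
  linarith

lemma gE_zero_of_vert_eq {q : M.XgradE 0} {E : ℰ} (h : q.2 (M.tgt E) = q.2 (M.src E)) :
    M.gE 0 q E = 0 := by
  refine Subtype.ext ((M.good_edge E).ext ((M.good_edge E).PolyOn_le _) (Subtype.prop _)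
    (zero_mem _) ?_)
  rintro _ ⟨r, hr, rfl⟩
  obtain ⟨c, rfl⟩ := exists_eq_C_of_mem_Pol_zero hr
  rw [M.gE_spec 0 q E hr, dirDeriv_C, map_zero, ip_zero_right, ZeroMemClass.coe_zero, ip_zero_left,
    ev_C, ev_C, h]
  ring

lemma gE_zero_eq_zero {k : ℕ} {q : M.XgradE k} {E : ℰ} (h : M.gE k q E = 0) :
    M.gE 0 (0, q.2) E = 0 :=
  M.gE_zero_of_vert_eq (q := (0, q.2)) (M.vert_eq_of_gE (q := q) h :)

/-- Both edge gradients vanish, at degree k and after reduction, so the two components satisfy the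
same identity. The tangential derivatives of degree-k polynomials exhaust the polynomials of degree
k - 1 on the edge. -/
lemma EgradE_eq {k : ℕ} {q : M.XgradE k} (h : ∀ E, M.gE k q E = 0) :
    M.EgradE k (0, q.2) = q := by
  refine Prod.ext (funext fun E => Subtype.ext ?_) rfl
  refine (M.good_edge E).ext ((M.good_edge E).PolyOn_le _) (Subtype.prop _) (Subtype.prop _) ?_
  rintro _ ⟨s, hs, rfl⟩
  obtain ⟨r, hr, hrs⟩ := exists_dirDeriv_eq (M.vert (M.src E)) (M.norm_tangent E) hs
  rw [sub_add_cancel] at hr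
  have h1 : restr (M.edge E) s = restr (M.edge E) (dirDeriv (M.tangent E) r) := by
    rw [restr_congr]
    intro x hx
    obtain ⟨t, rfl⟩ := exists_of_mem_edge hx
    exact (hrs t).symm
  have h2 := M.gE_spec k q E hr
  have h3 := M.EpolE_spec k (0, q.2) E hr
  rw [h, ZeroMemClass.coe_zero, ip_zero_left] at h2
  rw [M.gE_zero_eq_zero (h E), ZeroMemClass.coe_zero, ip_zero_left] at h3
  rw [h1]
  refine h3.trans ?_
  linarith

/-- The boundary term is independent of the degree when the edge gradients vanish. -/
lemma bdryGradF_eq_of_gE {k : ℕ} {q : M.XgradE k} (h : ∀ E, M.gE k q E = 0) (F : ℱ) (v : V3) :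
    M.bdryGradF 0 (0, q.2) F v = M.bdryGradF k q F v := by
  refine Finset.sum_congr rfl fun E _ => ?_
  rw [M.γE_of_gE_eq_zero (k := k) (q := q) (by rw [h]; rfl),
    M.γE_of_gE_eq_zero (k := 0) (q := (0, q.2))
      (by rw [M.gE_zero_eq_zero (h E)]; rfl)]

/-- Constant tangential fields are rotations of affine functions, and for k ≥ 1 these belong to the
functions r tested in `hF`. The boundary terms of the two degrees coincide. -/
lemma gF_zero_eq_zero {k : ℕ} (hk : 1 ≤ k) {q : M.XgradF k} (h : ∀ E, M.gE k q.2 E = 0) {F : ℱ}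
    (hF : ∀ r ∈ Pol k, ip 2 (M.gF k q F : M.face F → E3)
      (restrV (M.face F) (rotTan (M.normal F) r)) = 0) :
    M.gF 0 (0, 0, q.2.2) F = 0 := by
  refine Subtype.ext ((M.good_face F).ext ((M.good_face F).VOn_le _) (Subtype.prop _)
    (zero_mem _) ?_)
  rintro _ ⟨z, hz, rfl⟩
  obtain ⟨r, hr, w, hw, hzr⟩ := M.exists_rotTan_add_cRolF F hz
  obtain ⟨p, hp, rfl⟩ := hw
  rw [Pol_eq_bot (by norm_num), SetLike.mem_coe, Submodule.mem_bot] at hp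
  have hr' : r ∈ Pol k := Pol_mono (by simpa using hk) hr
  rw [hp, map_zero, add_zero] at hzr
  rw [restrV_congr.2 fun x hx => hzr x (M.face_subset F hx), ZeroMemClass.coe_zero, ip_zero_left,
    M.gF_rotTan 0 _ F hr, M.bdryGradF_eq_of_gE h,
    ← M.gF_rotTan k q F (Pol_mono (by linarith) hr'), hF r hr']

lemma EgradF_eq {k : ℕ} {q : M.XgradF k} (h : ∀ E, M.gE k q.2 E = 0)
    (hr : ∀ F, ∀ r ∈ Pol k, ip 2 (M.gF k q F : M.face F → E3)
      (restrV (M.face F) (rotTan (M.normal F) r)) = 0)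
    (hc : ∀ F, ∀ w ∈ M.cRolF F k, ip 2 (M.gF k q F : M.face F → E3)
      (restrV (M.face F) w) = 0) :
    M.EgradF k (0, 0, q.2.2) = q := by
  refine Prod.ext (funext fun F => Subtype.ext ?_) (M.EgradE_eq h)
  -- For k = 0 the face components lie in the zero space, while the kernel condition carries no
  -- information on rotations of affine functions.
  rcases Nat.eq_zero_or_pos k with rfl | hk
  · rw [eq_zero_of_mem_PolyOn (by norm_num) (q.1 F).2,
      eq_zero_of_mem_PolyOn (by norm_num) ((M.EgradF 0 (0, 0, q.2.2)).1 F).2]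
  refine (M.good_face F).ext ((M.good_face F).PolyOn_le _) (Subtype.prop _) (Subtype.prop _) ?_
  rintro _ ⟨s, hs, rfl⟩
  obtain ⟨p, hp, hps⟩ := exists_divTan_posMul_eq (M.normal_norm F) (M.centerF F) hs
  have hw : posMul (M.centerF F) p ∈ M.cRolF F k := ⟨p, hp, rfl⟩
  have h1 : restr (M.face F) s
      = restr (M.face F) (divTan (M.normal F) (posMul (M.centerF F) p)) :=
    restr_congr.2 fun x hx => (hps x (M.face_subset F hx)).symm
  have h2 := M.gF_spec k q F (M.cRolF_le F _ hw) fun x hx => M.ev_cRolF_dotProduct hw hx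
  have h3 := M.EpolF_spec k (0, 0, q.2.2) F hw
  rw [hc F _ hw] at h2
  rw [M.gF_zero_eq_zero hk h (hr F), ZeroMemClass.coe_zero, ip_zero_left, M.EgradE_eq h] at h3
  rw [h1]
  refine h3.trans ?_
  linarith

/-- The face traces of both degrees have the same integral. -/
lemma ip_γF_C {k : ℕ} (hk : 1 ≤ k) {q : M.XgradF k} (h : ∀ E, M.gE k q.2 E = 0) {F : ℱ}
    (hr : ∀ r ∈ Pol k, ip 2 (M.gF k q F : M.face F → E3)
      (restrV (M.face F) (rotTan (M.normal F) r)) = 0)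
    (hc : ∀ w ∈ M.cRolF F k, ip 2 (M.gF k q F : M.face F → E3)
      (restrV (M.face F) w) = 0) (c : ℝ) :
    ip 2 (M.γF 0 (0, 0, q.2.2) F : M.face F → ℝ) (restr (M.face F) (MvPolynomial.C c))
      = ip 2 (M.γF k q F : M.face F → ℝ) (restr (M.face F) (MvPolynomial.C c)) := by
  obtain ⟨p, hp, hps⟩ := exists_divTan_posMul_eq (M.normal_norm F) (M.centerF F)
    (C_mem (l := 0) le_rfl c)
  have hw : posMul (M.centerF F) p ∈ M.cRolF F 1 := ⟨p, hp, rfl⟩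
  have h1 : restr (M.face F) (MvPolynomial.C c)
      = restr (M.face F) (divTan (M.normal F) (posMul (M.centerF F) p)) :=
    restr_congr.2 fun x hx => (hps x (M.face_subset F hx)).symm
  rw [h1, M.γF_spec 0 _ F (M.cRolF_mono F (by norm_num) hw),
    M.γF_spec k _ F (M.cRolF_mono F (by linarith) hw), M.gF_zero_eq_zero hk h hr,
    hc _ (M.cRolF_mono F (by exact_mod_cast hk) hw), ZeroMemClass.coe_zero, ip_zero_left,
    M.bdryGradF_eq_of_gE h]

/-- The constant C = 0 works: E R q = q, by the recursive identities on edges, faces and elements.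
-/
theorem exists_Igrad_eq (k : ℕ) (q : M.Xgrad k) (hq : M.gradH k q = 0) :
    ∃ C : ℝ, M.Egrad k (M.Rgrad k q) - q = M.Igrad k (fun _ => C) := by
  have hE : ∀ E, M.gE k q.2.2 E = 0 := fun E =>
    congrFun (congrArg (fun u : M.Xcurl k => u.2.2) hq) E
  have hFr : ∀ F, ∀ r ∈ Pol k, ip 2 (M.gF k q.2 F : M.face F → E3)
      (restrV (M.face F) (rotTan (M.normal F) r)) = 0 := fun F r hr =>
    (M.good_face F).ip_eq_zero_of_proj ((M.good_face F).VOn_le _) (M.bcVF _)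
      (congrArg Prod.fst (congrFun (congrArg (fun u : M.Xcurl k => u.2.1) hq) F))
      ⟨_, ⟨r, sub_one_add_one_mem hr, rfl⟩, rfl⟩
  have hFc : ∀ F, ∀ w ∈ M.cRolF F k, ip 2 (M.gF k q.2 F : M.face F → E3)
      (restrV (M.face F) w) = 0 := fun F w hw =>
    (M.good_face F).ip_eq_zero_of_proj ((M.good_face F).VOn_le _) (M.bcVF _)
      (congrArg Prod.snd (congrFun (congrArg (fun u : M.Xcurl k => u.2.1) hq) F)) ⟨w, hw, rfl⟩
  have hTr : ∀ T, ∀ z ∈ VPol k, ip 3 (M.gT k q T : M.elem T → E3)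
      (restrV (M.elem T) (curl z)) = 0 := fun T z hz =>
    (M.good_elem T).ip_eq_zero_of_proj ((M.good_elem T).VOn_le _) (M.bcVT _)
      (congrArg Prod.fst (congrFun (congrArg Prod.fst hq) T))
      ⟨_, ⟨z, by rwa [sub_add_cancel], rfl⟩, rfl⟩
  have hTc : ∀ T, ∀ w ∈ M.cRolT T k, ip 3 (M.gT k q T : M.elem T → E3)
      (restrV (M.elem T) w) = 0 := fun T w hw =>
    (M.good_elem T).ip_eq_zero_of_proj ((M.good_elem T).VOn_le _) (M.bcVT _)
      (congrArg Prod.snd (congrFun (congrArg Prod.fst hq) T)) ⟨w, hw, rfl⟩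
  have hF : M.EgradF k (M.Rgrad k q).2 = q.2 := M.EgradF_eq hE hFr hFc
  have hEq : M.Egrad k (M.Rgrad k q) = q := by
    refine Prod.ext (funext fun T => Subtype.ext ?_) hF
    have hg := M.good_elem T
    rcases Nat.eq_zero_or_pos k with rfl | hk
    · rw [eq_zero_of_mem_PolyOn (by norm_num) (q.1 T).2,
        eq_zero_of_mem_PolyOn (by norm_num) ((M.Egrad 0 (M.Rgrad 0 q)).1 T).2]
    -- A constant field is the curl of a field of degree 1 ≤ k, so the kernel condition applies to
    -- it at degree k. Its two boundary terms agree because they involve only the integrals of the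
    -- face traces.
    have hgT : M.gT 0 (M.Rgrad k q) T = 0 := by
      refine Subtype.ext (hg.ext (hg.VOn_le _) (Subtype.prop _) (zero_mem _) ?_)
      rintro _ ⟨z, hz, rfl⟩
      obtain ⟨a, rfl⟩ := eq_cst_of_mem_VPol_zero hz
      obtain ⟨y, hy, hya⟩ := exists_curl_eq_cst a
      have h1 := hTr T y (VPol_mono (by exact_mod_cast hk) hy)
      rw [hya, M.gT_spec k q T (cst_mem_VPol a (by simp)), div_cst, map_zero, ip_zero_right,
        neg_zero, zero_add] at h1
      rw [M.gT_spec 0 _ T hz, div_cst, map_zero, ip_zero_right, neg_zero, zero_add,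
        ZeroMemClass.coe_zero, ip_zero_left, ← h1]
      refine Finset.sum_congr rfl fun F _ => ?_
      rw [cst_dotProduct_cst]
      congr 1
      exact M.ip_γF_C hk hE (hFr F) (hFc F) _
    refine hg.ext (hg.PolyOn_le _) (Subtype.prop _) (Subtype.prop _) ?_
    rintro _ ⟨s, hs, rfl⟩
    obtain ⟨p, hp, rfl⟩ := exists_div_posMul_eq (M.centerT T) hs
    have hw : posMul (M.centerT T) p ∈ M.cRolT T k := ⟨p, hp, rfl⟩
    have h2 := M.gT_spec k q T (M.cRolT_le T _ hw)
    have h3 := M.EpolT_spec k (M.Rgrad k q) T hw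
    rw [hTc T _ hw] at h2
    rw [hgT, ZeroMemClass.coe_zero, ip_zero_left, hF] at h3
    refine h3.trans ?_
    linarith
  refine ⟨0, ?_⟩
  rw [hEq, sub_self]
  refine Prod.ext (funext fun T => ?_) (Prod.ext (funext fun F => ?_)
    (Prod.ext (funext fun E => ?_) rfl))
  · exact ((M.good_elem T).proj_eq ((M.good_elem T).PolyOn_le _) (zero_mem _) 0
      fun _ _ => rfl).symm
  · exact ((M.good_face F).proj_eq ((M.good_face F).PolyOn_le _) (zero_mem _) 0
      fun _ _ => rfl).symm
  · exact ((M.good_edge E).proj_eq ((M.good_edge E).PolyOn_le _) (zero_mem _) 0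
      fun _ _ => rfl).symm

end PolyhedralMesh

end DDR

theorem mainTheorem5 {𝒯 ℱ ℰ 𝒱 : Type*} [Fintype 𝒯] [Fintype ℱ] [Fintype ℰ] [Fintype 𝒱]
    (Ω : Set DDR.E3) (M : DDR.PolyhedralMesh Ω 𝒯 ℱ ℰ 𝒱) (k : ℕ) :
    (∀ q : M.Xgrad k, M.gradH k q = 0 →
      ∃ C : ℝ, M.Egrad k (M.Rgrad k q) - q = M.Igrad k (fun _ => C)) ∧
    (∀ v : M.Xcurl k, M.curlH k v = 0 →
      ∃ q : M.Xgrad k, M.Ecurl k (M.Rcurl k v) - v = M.gradH k q) ∧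
    (∀ w : M.Xdiv k, M.divH k w = 0 →
      ∃ v : M.Xcurl k, M.Ediv k (M.Rdiv k w) - w = M.curlH k v) ∧
    (∀ r : M.PolyTh k,
      ∃ w : M.Xdiv k, M.inclTh k (M.π0 k r) - r = M.divH k w) :=
  ⟨M.exists_Igrad_eq k, M.exists_gradH_eq k, M.exists_curlH_eq k, M.exists_divH_eq k⟩
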